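/- **Setting.** Let $(\Sigma,g)$ be a complete connected smooth Riemannian manifold of dimension $n\ge 1$ (Hausdorff, second countable, without boundary), $S\Sigma$ its unit tangent bundle and $\varphi^g$ its geodesic flow. Let $\Omega\subset\Sigma$ be a closed $n$-dimensional submanifold with smooth boundary (it need not be connected or compact), with inward unit normal $n_x$ at $x\in\partial\Omega$. Put $M=S(\Sigma\setminus\mathring\Omega)$, $\partial M=S\Sigma|_{\partial\Omega}$, $\mathring M=S(\Sigma\setminus\Omega)$, and $\partial_{\mathrm g}M=\{(x,v)\in\partial M: g_x(v,n_x)=0\}$. The *non-grazing billiard flow* $\varphi:D\to M\setminus\partial_{\mathrm g}M$ follows $\varphi^g$ until it meets $\partial M$. If it meets $\partial M$ outside $\partial_{\mathrm g}M$ it continues, in forward and in backward time, after the reflection $v\mapsto v'=v-2g_x(v,n_x)n_x$ (at the collision time itself its value is the arriving, not yet reflected, vector); if it meets $\partial_{\mathrm g}M$ it ceases to exist. Also $\varphi_0=\mathrm{id}$, and $D=\{(t,q): T_{\min}(q)<t<T_{\max}(q)\}$ is its maximal domain. Its *trapped set* $K$ is the set of all $q\in M\setminus\partial_{\mathrm g}M$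 with $\mathbb R\times\{q\}\subset D$ whose trajectory stays in a compact subset of $M\setminus\partial_{\mathrm g}M$. The flow $\varphi$ is *hyperbolic on $K$* if over $K\cap\mathring M$ there is a continuous splitting $T_qM=\mathbb R X(q)\oplus E_s(q)\oplus E_u(q)$, with $X$ the flow direction, such that $d\varphi_t(q)E_{s/u}(q)=E_{s/u}(\varphi_t(q))$ whenever $q,\varphi_t(q)\in K\cap\mathring M$, and there are a continuous norm on $T(M\setminus\partial_{\mathrm g}M)$ and constants $C_0,C_1>0$ with $$\|d\varphi_t(q)W\|\le C_0e^{-C_1t}\|W\|\ (W\in E_s(q)),\qquad \|d\varphi_t(q)W\|\ge C_0^{-1}e^{C_1t}\|W\|\ (W\in E_u(q))$$ for all $t\ge 0$ and all $q$ with $q,\varphi_t(q)\in K\cap\mathring M$. A *smooth model* for $\varphi$ is a triple $(\mathcal M,\pi,\phi)$ of a smooth manifold $\mathcal M$ without boundary, a smooth surjection $\pi:M\setminus\partial_{\mathrm g}M\to\mathcal M$ such that $\mathcal D=(\mathrm{id}\times\pi)(D)$ is open in $\mathbb R\times\mathcal M$, and a smooth flow $\phi:\mathcal D\to\mathcal M$,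 such that $\pi|_{\mathring M}$ is a diffeomorphism onto its open image and $\phi_t(\pi(q))=\pi(\varphi_t(q))$ for $(t,q)\in D$. Its trapped set $\mathcal K$ is the set of $p\in\mathcal M$ with $\mathbb R\times\{p\}\subset\mathcal D$ whose trajectory stays in a compact subset of $\mathcal M$. The flow $\phi$, with generator $\mathbf X$, is *hyperbolic on $\mathcal K$* if over $\mathcal K$ there is a continuous splitting $T_p\mathcal M=\mathbb R\mathbf X(p)\oplus\mathcal E_s(p)\oplus\mathcal E_u(p)$, invariant under $d\phi_t$ for all $t\in\mathbb R$, and there are a continuous norm on $T\mathcal M$ and constants $C_0,C_1>0$ such that the analogous estimates hold for all $p\in\mathcal K$ and $t\ge0$. Let $\mathcal G=\pi(\partial M\setminus\partial_{\mathrm g}M)$ be the gluing region. **Proposition.** If $\varphi$ is hyperbolic on $K$, then for every smooth model $(\mathcal M,\pi,\phi)$ of $\varphi$ the flow $\phi$ is hyperbolic on $\mathcal K$. More precisely, for every hyperbolic splitting $(E_s,E_u)$ of $\varphi$ over $K\cap\mathring M$ there is a hyperbolic splitting $(\mathcal E_s,\mathcal E_u)$ of $\phi$ over $\mathcal K$ such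 that 1. $\mathcal E_{s/u}(\pi(q))=d\pi(q)E_{s/u}(q)$ and $\mathbf X(\pi(q))=d\pi(q)X(q)$ for all $q\in K\cap\mathring M$; 2. for every $p\in\mathcal K\cap\mathcal G$ one has $\phi_t(p)\notin\mathcal G$ for all sufficiently small $t\ne0$, and $\mathcal E_{s/u}(p)=(d\phi_t(p))^{-1}\big(\mathcal E_{s/u}(\phi_t(p))\big)$ for every $t\in\mathbb R$ with $\phi_t(p)\notin\mathcal G$; 3. if $K$ is compact, then for every continuous norm on $T\mathcal M$ there are constants $C_0,C_1>0$ with which the estimates for $(\mathcal E_s,\mathcal E_u)$ hold. -/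

import Mathlib

open Set Filter Topology Manifold
open scoped ContDiff

noncomputable section

/-! ### Sub-bundles and norms on tangent bundles -/

section Bundles

variable {E H N : Type*} [NormedAddCommGroup E] [NormedSpace ℝ E] [TopologicalSpace H]
  (I : ModelWithCorners ℝ E H) [TopologicalSpace N] [ChartedSpace H N] [IsManifold I 1 N]

/-- `F` is a continuous subbundle of `TN` over the set `A`: locally on `A` it is spanned by a
continuous frame. -/
def IsContinuousSubbundleOn (A : Set N) (F : ∀ p : N, Submodule ℝ (TangentSpace I p)) : Prop :=
  ∀ p₀ ∈ A, ∃ U : Set N, IsOpen U ∧ p₀ ∈ U ∧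
    ∃ (k : ℕ) (e : Fin k → ∀ p : N, TangentSpace I p),
      (∀ i, ContinuousOn (fun p => (⟨p, e i p⟩ : TangentBundle I N)) (A ∩ U)) ∧
      ∀ p ∈ A ∩ U, LinearIndependent ℝ (fun i => e i p) ∧
        Submodule.span ℝ (Set.range fun i => e i p) = F p

/-- `ν` is a continuous norm on the vector bundle over `A` whose fibre at `p ∈ A` is the subspace
`T p` of the tangent space (the values of `ν` elsewhere are irrelevant). -/
structure IsContinuousNormOn (A : Set N) (T : ∀ p : N, Submodule ℝ (TangentSpace I p))
    (ν : ∀ p : N, TangentSpace I p → ℝ) : Prop where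
  pos : ∀ p ∈ A, ∀ W ∈ T p, W ≠ 0 → 0 < ν p W
  smul : ∀ p ∈ A, ∀ W ∈ T p, ∀ c : ℝ, ν p (c • W) = |c| * ν p W
  add_le : ∀ p ∈ A, ∀ W ∈ T p, ∀ W' ∈ T p, ν p (W + W') ≤ ν p W + ν p W'
  continuousOn : ContinuousOn (fun W : TangentBundle I N => ν W.1 W.2)
    {W : TangentBundle I N | W.1 ∈ A ∧ W.2 ∈ T W.1}

end Bundles

/-- The subspace `T` is the internal direct sum of the line `ℝ X` and the subspaces `A`, `B`
(with `X ≠ 0`). -/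
def IsSplitting {V : Type*} [AddCommGroup V] [Module ℝ V] (X : V) (A B T : Submodule ℝ V) : Prop :=
  X ≠ 0 ∧ Submodule.span ℝ {X} ⊔ A ⊔ B = T ∧
    iSupIndep ![Submodule.span ℝ {X}, A, B]

/-! ### Geodesics of a Riemannian metric -/

section Geodesics

variable {n : ℕ} {Q : Type*} [TopologicalSpace Q] [ChartedSpace (EuclideanSpace ℝ (Fin n)) Q]
  [IsManifold (𝓡 n) ∞ Q]

/-- Smooth Riemannian metrics on the `n`-manifold `Q`. -/
abbrev RiemMetric (n : ℕ) (Q : Type*) [TopologicalSpace Q]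
    [ChartedSpace (EuclideanSpace ℝ (Fin n)) Q] [IsManifold (𝓡 n) ∞ Q] :=
  Bundle.ContMDiffRiemannianMetric (𝓡 n) ∞ (EuclideanSpace ℝ (Fin n))
    (fun x : Q => TangentSpace (𝓡 n) x)

/-- The coordinate expression of the metric in the chart at `x₀`, as a bilinear form on `ℝⁿ`
depending on the point `y` of the chart's target. -/
def RiemMetric.inChart (g : RiemMetric n Q) (x₀ : Q)
    (y a b : EuclideanSpace ℝ (Fin n)) : ℝ :=
  g.inner ((extChartAt (𝓡 n) x₀).symm y)
    (mfderiv 𝓘(ℝ, EuclideanSpace ℝ (Fin n)) (𝓡 n) (extChartAt (𝓡 n) x₀).symm y a)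
    (mfderiv 𝓘(ℝ, EuclideanSpace ℝ (Fin n)) (𝓡 n) (extChartAt (𝓡 n) x₀).symm y b)

/-- `γ : ℝ → Q` is a geodesic: it is smooth, and in every chart its coordinate expression `u`
solves the geodesic equation, written as the Euler-Lagrange equation of the energy
`½ g_u(u', u')`, namely `d/ds g_u(u', w) = ½ (∂_w g)_u(u', u')` for all `w ∈ ℝⁿ`. -/
def IsGeodesic (g : RiemMetric n Q) (γ : ℝ → Q) : Prop :=
  ContMDiff 𝓘(ℝ, ℝ) (𝓡 n) ∞ γ ∧
  ∀ (x₀ : Q) (s : ℝ), γ s ∈ (extChartAt (𝓡 n) x₀).source →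
    let u : ℝ → EuclideanSpace ℝ (Fin n) := fun r => extChartAt (𝓡 n) x₀ (γ r)
    ∀ w : EuclideanSpace ℝ (Fin n),
      HasDerivAt (fun r => g.inChart x₀ (u r) (deriv u r) w)
        ((1 / 2 : ℝ) * fderiv ℝ (fun y => g.inChart x₀ y (deriv u s) (deriv u s)) (u s) w) s

/-- The curve `t ↦ (γ t, γ' t)` in the tangent bundle. -/
def velocityLift (γ : ℝ → Q) (t : ℝ) : TangentBundle (𝓡 n) Q :=
  ⟨γ t, mfderiv 𝓘(ℝ, ℝ) (𝓡 n) γ t (1 : ℝ)⟩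

/-- Geodesic completeness: every tangent vector is the initial velocity of a geodesic that is
defined for all times. -/
def IsCompleteMetric (g : RiemMetric n Q) : Prop :=
  ∀ p : TangentBundle (𝓡 n) Q, ∃ γ : ℝ → Q, IsGeodesic g γ ∧ velocityLift (n := n) γ 0 = p

open Classical in
/-- The geodesic flow `φ^g` on the tangent bundle (of a complete metric). -/
def geodesicFlow (g : RiemMetric n Q) (t : ℝ) (p : TangentBundle (𝓡 n) Q) :
    TangentBundle (𝓡 n) Q :=
  if h : ∃ γ : ℝ → Q, IsGeodesic g γ ∧ velocityLift (n := n) γ 0 = p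
  then velocityLift (n := n) h.choose t else p

/-- The squared length `g_x(v, v)` as a function on the tangent bundle. -/
def normSq (g : RiemMetric n Q) (p : TangentBundle (𝓡 n) Q) : ℝ := g.inner p.1 p.2 p.2

/-- The unit tangent bundle. -/
def unitBundle (g : RiemMetric n Q) : Set (TangentBundle (𝓡 n) Q) := {p | normSq g p = 1}

/-- The tangent space of the unit tangent bundle at one of its points `p`, as a subspace of the
tangent space of `TQ` at `p`: the kernel of the differential of the defining function. -/
def unitTangent (g : RiemMetric n Q) (p : TangentBundle (𝓡 n) Q) :
    Submodule ℝ (TangentSpace (𝓡 n).tangent p) :=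
  (mfderiv (𝓡 n).tangent 𝓘(ℝ, ℝ) (normSq g) p).ker

end Geodesics

/-! ### Geodesic billiard systems -/

/-- `f` is, on the open set `U`, a smooth defining function of `Ω` near `x`: on `U` the set `Ω` is
given by `f ≥ 0`, and `df ≠ 0` at `x`. -/
structure IsDefiningFunction {n : ℕ} {Q : Type*} [TopologicalSpace Q]
    [ChartedSpace (EuclideanSpace ℝ (Fin n)) Q]
    (Ω : Set Q) (x : Q) (U : Set Q) (f : Q → ℝ) : Prop where
  isOpen : IsOpen U
  mem : x ∈ U
  contMDiffOn : ContMDiffOn (𝓡 n) 𝓘(ℝ, ℝ) ∞ f U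
  mem_iff : ∀ y ∈ U, y ∈ Ω ↔ 0 ≤ f y
  mfderiv_ne_zero : mfderiv (𝓡 n) 𝓘(ℝ, ℝ) f x ≠ 0

/-- A geodesic billiard system on the manifold `Q` of dimension `n`: a complete Riemannian metric
and an obstacle set `Ω`, which is a (closed, embedded) `n`-dimensional submanifold with smooth
boundary. The manifold boundary of `Ω` is its topological frontier. -/
structure BilliardSystem (n : ℕ) (Q : Type*) [TopologicalSpace Q]
    [ChartedSpace (EuclideanSpace ℝ (Fin n)) Q] [IsManifold (𝓡 n) ∞ Q] where
  /-- the Riemannian metric -/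
  metric : RiemMetric n Q
  complete : IsCompleteMetric metric
  /-- the union of the obstacles -/
  obstacle : Set Q
  isClosed_obstacle : IsClosed obstacle
  smooth_boundary : ∀ x ∈ frontier obstacle,
    ∃ U f, IsDefiningFunction (n := n) obstacle x U f

namespace BilliardSystem

variable {n : ℕ} {Q : Type*} [TopologicalSpace Q] [ChartedSpace (EuclideanSpace ℝ (Fin n)) Q]
  [IsManifold (𝓡 n) ∞ Q] (B : BilliardSystem n Q)

/-- `ν` is the inward (pointing into `Ω`) unit normal of `∂Ω` at `x`: a unit vector that is a
positive multiple of the gradient of a defining function. -/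
def IsInwardNormal (x : Q) (ν : TangentSpace (𝓡 n) x) : Prop :=
  B.metric.inner x ν ν = 1 ∧ ∃ U f, IsDefiningFunction (n := n) B.obstacle x U f ∧
    ∃ c : ℝ, 0 < c ∧ ∀ w : TangentSpace (𝓡 n) x,
      mfderiv (𝓡 n) 𝓘(ℝ, ℝ) f x w = (c * B.metric.inner x ν w : ℝ)

open Classical in
/-- The inward unit normal `n_x` at `x ∈ ∂Ω`. -/
def normal (x : Q) : TangentSpace (𝓡 n) x :=
  if h : ∃ ν, B.IsInwardNormal x ν then h.choose else 0

/-- The normal component `g_x(v, n_x)` of a vector at a boundary point. -/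
def normalComp (p : TangentBundle (𝓡 n) Q) : ℝ := B.metric.inner p.1 p.2 (B.normal p.1)

/-- The phase space `M = S(Q \ int Ω)`. -/
def phase : Set (TangentBundle (𝓡 n) Q) :=
  {p | p ∈ unitBundle B.metric ∧ p.1 ∉ interior B.obstacle}

/-- The manifold interior `S(Q \ Ω)` of `M`. -/
def phaseInt : Set (TangentBundle (𝓡 n) Q) :=
  {p | p ∈ unitBundle B.metric ∧ p.1 ∉ B.obstacle}

/-- The boundary `∂M`. -/
def phaseBdry : Set (TangentBundle (𝓡 n) Q) :=
  {p | p ∈ unitBundle B.metric ∧ p.1 ∈ frontier B.obstacle}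

/-- The grazing boundary `∂_g M`, the unit vectors tangent to `∂Ω`. -/
def grazing : Set (TangentBundle (𝓡 n) Q) := {p | p ∈ B.phaseBdry ∧ B.normalComp p = 0}

/-- The space `M \ ∂_g M` on which the non-grazing billiard flow lives. -/
def nonGrazing : Set (TangentBundle (𝓡 n) Q) := B.phase \ B.grazing

/-- The tangential reflection `(x, v) ↦ (x, v - 2 g_x(v, n_x) n_x)`. -/
def reflect (p : TangentBundle (𝓡 n) Q) : TangentBundle (𝓡 n) Q :=
  ⟨p.1, p.2 - (2 * B.normalComp p) • B.normal p.1⟩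

open Classical in
/-- The point from which the geodesic starts that the billiard trajectory of `p` follows in the
time direction `σ = 1` (forward) or `σ = -1` (backward): the reflected point if `p` is an inward
boundary point and `σ = 1`, or an outward one and `σ = -1`, and `p` itself otherwise. -/
def launch (σ : ℝ) (p : TangentBundle (𝓡 n) Q) : TangentBundle (𝓡 n) Q :=
  if p ∈ B.phaseBdry ∧ 0 < σ * B.normalComp p then B.reflect p else p

/-- The first boundary intersection time in the time direction `σ`: this is `t_+(p)` for `σ = 1`
and `-t_-(p)` for `σ = -1`. It is `⊤` if the boundary is never reached. -/
def hitTime (σ : ℝ) (p : TangentBundle (𝓡 n) Q) : EReal :=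
  sInf {T : EReal | ∃ s : ℝ, 0 < s ∧ T = (s : EReal) ∧
    (geodesicFlow B.metric (σ * s) (B.launch σ p)).1 ∈ B.obstacle}

/-- The point at which the trajectory of `p` first reaches the boundary (if it does). -/
def hitPoint (σ : ℝ) (p : TangentBundle (𝓡 n) Q) : TangentBundle (𝓡 n) Q :=
  geodesicFlow B.metric (σ * (B.hitTime σ p).toReal) (B.launch σ p)

open Classical in
/-- The time of the `(k+1)`-st boundary intersection in the time direction `σ`: `t_+^k(p)` for
`σ = 1` and `-t_-^k(p)` for `σ = -1`. The sequence is constant from the moment on when the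
trajectory hits the boundary in a grazing way or does not return to the boundary. -/
def nthTime (σ : ℝ) : ℕ → TangentBundle (𝓡 n) Q → EReal
  | 0, p => B.hitTime σ p
  | k + 1, p =>
    if B.hitTime σ p ≠ ⊤ ∧ B.hitPoint σ p ∉ B.grazing then
      B.hitTime σ p + nthTime σ k (B.hitPoint σ p)
    else B.hitTime σ p

/-- The maximal existence time in the time direction `σ`: `T_max(p)` for `σ = 1` and `-T_min(p)`
for `σ = -1`. -/
def maxTime (σ : ℝ) (p : TangentBundle (𝓡 n) Q) : EReal := ⨆ k, B.nthTime σ k p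

open Classical in
/-- Follow the billiard trajectory of `p` in the time direction `σ` for a time `t > 0` in which at
most `k` reflections are carried out. At an intersection time the value is the point at which the
trajectory arrives, before it is reflected. -/
def travel (σ : ℝ) : ℕ → ℝ → TangentBundle (𝓡 n) Q → TangentBundle (𝓡 n) Q
  | 0, t, p => geodesicFlow B.metric (σ * t) (B.launch σ p)
  | k + 1, t, p =>
    if (t : EReal) ≤ B.hitTime σ p then geodesicFlow B.metric (σ * t) (B.launch σ p)
    else travel σ k (t - (B.hitTime σ p).toReal) (B.hitPoint σ p)

/-- The domain `D` of the non-grazing billiard flow. -/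
def domain : Set (ℝ × TangentBundle (𝓡 n) Q) :=
  {z | z.2 ∈ B.nonGrazing ∧ -B.maxTime (-1) z.2 < (z.1 : EReal) ∧
    (z.1 : EReal) < B.maxTime 1 z.2}

open Classical in
/-- The non-grazing billiard flow `φ_t` (meaningful for `(t, p)` in the domain `D`). -/
def flow (t : ℝ) (p : TangentBundle (𝓡 n) Q) : TangentBundle (𝓡 n) Q :=
  if 0 < t then B.travel 1 (sInf {k | (t : EReal) ≤ B.nthTime 1 k p}) t p
  else if t < 0 then B.travel (-1) (sInf {k | ((-t : ℝ) : EReal) ≤ B.nthTime (-1) k p}) (-t) p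
  else p

/-- The trapped set `K` of the non-grazing billiard flow. -/
def trapped : Set (TangentBundle (𝓡 n) Q) :=
  {p | p ∈ B.nonGrazing ∧ (∀ t : ℝ, (t, p) ∈ B.domain) ∧
    ∃ W : Set (TangentBundle (𝓡 n) Q), IsCompact W ∧ W ⊆ B.nonGrazing ∧ ∀ t : ℝ, B.flow t p ∈ W}

/-- The flow direction `X(p) = d/dt|₀ φ_t(p)`. -/
def flowDir (p : TangentBundle (𝓡 n) Q) : TangentSpace (𝓡 n).tangent p :=
  mfderiv 𝓘(ℝ, ℝ) (𝓡 n).tangent (fun t : ℝ => B.flow t p) 0 (1 : ℝ)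

/-- The differential `dφ_t(p)` for `p` in the interior of `M`. It is the derivative within the
submanifold `S(Q \ Ω)` of `TQ`, hence determined on the tangent space `unitTangent` of that
submanifold; it is only ever applied to vectors in there. -/
def dflow (t : ℝ) (p : TangentBundle (𝓡 n) Q) :
    TangentSpace (𝓡 n).tangent p →L[ℝ] TangentSpace (𝓡 n).tangent (B.flow t p) :=
  mfderivWithin (𝓡 n).tangent (𝓡 n).tangent (B.flow t) B.phaseInt p

/-- `(Es, Eu)` is a hyperbolic splitting for the non-grazing billiard flow over the interior part
`K ∩ int M` of its trapped set. -/
structure IsHyperbolicSplitting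
    (Es Eu : ∀ p : TangentBundle (𝓡 n) Q, Submodule ℝ (TangentSpace (𝓡 n).tangent p)) :
    Prop where
  splitting : ∀ p ∈ B.trapped ∩ B.phaseInt,
    IsSplitting (B.flowDir p) (Es p) (Eu p) (unitTangent B.metric p)
  continuous_stable : IsContinuousSubbundleOn (𝓡 n).tangent (B.trapped ∩ B.phaseInt) Es
  continuous_unstable : IsContinuousSubbundleOn (𝓡 n).tangent (B.trapped ∩ B.phaseInt) Eu
  invariant : ∀ p ∈ B.trapped ∩ B.phaseInt, ∀ t : ℝ, B.flow t p ∈ B.trapped ∩ B.phaseInt →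
    (Es p).map (B.dflow t p).toLinearMap = Es (B.flow t p) ∧
    (Eu p).map (B.dflow t p).toLinearMap = Eu (B.flow t p)
  estimates : ∃ ν : ∀ p : TangentBundle (𝓡 n) Q, TangentSpace (𝓡 n).tangent p → ℝ,
    IsContinuousNormOn (𝓡 n).tangent B.nonGrazing (unitTangent B.metric) ν ∧
    ∃ C₀ C₁ : ℝ, 0 < C₀ ∧ 0 < C₁ ∧
      ∀ p ∈ B.trapped ∩ B.phaseInt, ∀ t : ℝ, 0 ≤ t → B.flow t p ∈ B.trapped ∩ B.phaseInt →
        (∀ W ∈ Es p, ν (B.flow t p) (B.dflow t p W) ≤ C₀ * Real.exp (-C₁ * t) * ν p W) ∧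
        (∀ W ∈ Eu p, C₀⁻¹ * Real.exp (C₁ * t) * ν p W ≤ ν (B.flow t p) (B.dflow t p W))

/-- The non-grazing billiard flow is hyperbolic on its trapped set. -/
def IsHyperbolic : Prop :=
  ∃ Es Eu : ∀ p : TangentBundle (𝓡 n) Q, Submodule ℝ (TangentSpace (𝓡 n).tangent p),
    B.IsHyperbolicSplitting Es Eu

end BilliardSystem

/-! ### Smooth models -/

/-- A smooth model `(𝓜, π, φ)` for the non-grazing billiard flow of `B`. The maps `proj` and `flow`
are total functions, whose values outside `M \ ∂_g M` and outside the flow domain are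
irrelevant. Smoothness of a map on a subset of `TQ` is understood within the subset. -/
structure SmoothModel {n : ℕ} {Q : Type*} [TopologicalSpace Q]
    [ChartedSpace (EuclideanSpace ℝ (Fin n)) Q] [IsManifold (𝓡 n) ∞ Q] (B : BilliardSystem n Q)
    (E : Type*) [NormedAddCommGroup E] [NormedSpace ℝ E]
    (𝓜 : Type*) [TopologicalSpace 𝓜] [ChartedSpace E 𝓜] where
  /-- the projection `π : M \ ∂_g M → 𝓜` -/
  proj : TangentBundle (𝓡 n) Q → 𝓜
  /-- the model flow -/
  flow : ℝ → 𝓜 → 𝓜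
  proj_smooth : ContMDiffOn (𝓡 n).tangent 𝓘(ℝ, E) ∞ proj B.nonGrazing
  proj_surj : ∀ p : 𝓜, ∃ q ∈ B.nonGrazing, proj q = p
  /-- the flow domain `𝓓 = (id × π)(D)` is open -/
  isOpen_domain : IsOpen ((fun z : ℝ × TangentBundle (𝓡 n) Q => (z.1, proj z.2)) '' B.domain)
  flow_smooth : ContMDiffOn (𝓘(ℝ, ℝ).prod 𝓘(ℝ, E)) 𝓘(ℝ, E) ∞ (fun z : ℝ × 𝓜 => flow z.1 z.2)
    ((fun z : ℝ × TangentBundle (𝓡 n) Q => (z.1, proj z.2)) '' B.domain)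
  flow_zero : ∀ p : 𝓜, flow 0 p = p
  flow_add : ∀ (s t : ℝ) (p : 𝓜),
    (s, p) ∈ (fun z : ℝ × TangentBundle (𝓡 n) Q => (z.1, proj z.2)) '' B.domain →
    (t, flow s p) ∈ (fun z : ℝ × TangentBundle (𝓡 n) Q => (z.1, proj z.2)) '' B.domain →
    (t + s, p) ∈ (fun z : ℝ × TangentBundle (𝓡 n) Q => (z.1, proj z.2)) '' B.domain →
    flow (t + s) p = flow t (flow s p)
  /-- on the interior of `M` the projection is a diffeomorphism onto its (open) image -/
  isOpen_image : IsOpen (proj '' B.phaseInt)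
  exists_smooth_inverse : ∃ κ : 𝓜 → TangentBundle (𝓡 n) Q,
    ContMDiffOn 𝓘(ℝ, E) (𝓡 n).tangent ∞ κ (proj '' B.phaseInt) ∧
    ∀ q ∈ B.phaseInt, κ (proj q) = q
  intertwines : ∀ z ∈ B.domain, flow z.1 (proj z.2) = proj (B.flow z.1 z.2)

namespace SmoothModel

variable {n : ℕ} {Q : Type*} [TopologicalSpace Q] [ChartedSpace (EuclideanSpace ℝ (Fin n)) Q]
  [IsManifold (𝓡 n) ∞ Q] {B : BilliardSystem n Q}
  {E : Type*} [NormedAddCommGroup E] [NormedSpace ℝ E]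
  {𝓜 : Type*} [TopologicalSpace 𝓜] [ChartedSpace E 𝓜] (m : SmoothModel B E 𝓜)

/-- The domain `𝓓` of the model flow. -/
def domain : Set (ℝ × 𝓜) :=
  (fun z : ℝ × TangentBundle (𝓡 n) Q => (z.1, m.proj z.2)) '' B.domain

/-- The gluing region `𝓖 = π(∂M \ ∂_g M)`. -/
def gluing : Set 𝓜 := m.proj '' (B.phaseBdry \ B.grazing)

/-- The trapped set `𝓚` of the model flow. -/
def trapped : Set 𝓜 :=
  {p | (∀ t : ℝ, (t, p) ∈ m.domain) ∧
    ∃ W : Set 𝓜, IsCompact W ∧ ∀ t : ℝ, m.flow t p ∈ W}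

/-- The generator of the model flow. -/
def generator (p : 𝓜) : TangentSpace 𝓘(ℝ, E) p :=
  mfderiv 𝓘(ℝ, ℝ) 𝓘(ℝ, E) (fun t : ℝ => m.flow t p) 0 (1 : ℝ)

/-- The differential of the time-`t` map of the model flow. -/
def dflow (t : ℝ) (p : 𝓜) :
    TangentSpace 𝓘(ℝ, E) p →L[ℝ] TangentSpace 𝓘(ℝ, E) (m.flow t p) :=
  mfderiv 𝓘(ℝ, E) 𝓘(ℝ, E) (m.flow t) p

/-- The differential `dπ(q)` at an interior point `q` of `M`, the derivative within the submanifold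
`S(Q \ Ω)` of `TQ`; it is only ever applied to vectors tangent to that submanifold. -/
def dproj (q : TangentBundle (𝓡 n) Q) :
    TangentSpace (𝓡 n).tangent q →L[ℝ] TangentSpace 𝓘(ℝ, E) (m.proj q) :=
  mfderivWithin (𝓡 n).tangent 𝓘(ℝ, E) m.proj B.phaseInt q

/-- The hyperbolicity estimates of the model flow for the splitting `(Es, Eu)` with respect to
`ν`. -/
def Estimates (Es Eu : ∀ p : 𝓜, Submodule ℝ (TangentSpace 𝓘(ℝ, E) p))
    (ν : ∀ p : 𝓜, TangentSpace 𝓘(ℝ, E) p → ℝ) : Prop :=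
  ∃ C₀ C₁ : ℝ, 0 < C₀ ∧ 0 < C₁ ∧ ∀ p ∈ m.trapped, ∀ t : ℝ, 0 ≤ t →
    (∀ W ∈ Es p, ν (m.flow t p) (m.dflow t p W) ≤ C₀ * Real.exp (-C₁ * t) * ν p W) ∧
    (∀ W ∈ Eu p, C₀⁻¹ * Real.exp (C₁ * t) * ν p W ≤ ν (m.flow t p) (m.dflow t p W))

variable [IsManifold 𝓘(ℝ, E) ∞ 𝓜]

/-- `(Es, Eu)` is a hyperbolic splitting for the model flow over its trapped set. -/
structure IsHyperbolicSplitting (Es Eu : ∀ p : 𝓜, Submodule ℝ (TangentSpace 𝓘(ℝ, E) p)) :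
    Prop where
  splitting : ∀ p ∈ m.trapped, IsSplitting (m.generator p) (Es p) (Eu p) ⊤
  continuous_stable : IsContinuousSubbundleOn 𝓘(ℝ, E) m.trapped Es
  continuous_unstable : IsContinuousSubbundleOn 𝓘(ℝ, E) m.trapped Eu
  invariant : ∀ p ∈ m.trapped, ∀ t : ℝ,
    (Es p).map (m.dflow t p).toLinearMap = Es (m.flow t p) ∧
    (Eu p).map (m.dflow t p).toLinearMap = Eu (m.flow t p)
  estimates : ∃ ν : ∀ p : 𝓜, TangentSpace 𝓘(ℝ, E) p → ℝ,
    IsContinuousNormOn 𝓘(ℝ, E) Set.univ (fun _ => ⊤) ν ∧ m.Estimates Es Eu ν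

/-- The model flow is hyperbolic on its trapped set. -/
def IsHyperbolic : Prop :=
  ∃ Es Eu : ∀ p : 𝓜, Submodule ℝ (TangentSpace 𝓘(ℝ, E) p), m.IsHyperbolicSplitting Es Eu

end SmoothModel

end

open Set Filter Topology Manifold
open scoped ContDiff

noncomputable section

set_option maxSynthPendingDepth 3
set_option linter.unusedSectionVars false

/-! ### Coordinate expression of the metric. -/

section ChartMetric

variable {n : ℕ} {Q : Type*} [TopologicalSpace Q] [ChartedSpace (EuclideanSpace ℝ (Fin n)) Q]
  [IsManifold (𝓡 n) ∞ Q]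

/-! Two non-grazing vectors with the same image under `π` have the same launches in both time
directions: shortly afterwards their trajectories run in the interior, where `π` and the geodesic
flow are injective (`launch_eq_of_proj_eq`). So `π` identifies a boundary vector at most with its
reflection, existence times descend to the model, and the gluing region `𝓖` is the closed complement
of the image of the interior. Non-grazing collisions are transversal, so every model trajectory is
off `𝓖` at all small nonzero times (`eventually_not_mem_gluing`).

The trapped sets correspond because `π` is proper (`isCompact_preimage`). Over `𝓖` this is seen by
flowing for a short time into the interior, where `π` is invertible, and tracing the limit back
along the billiard trajectory, through the one reflection that may lie in between. The inputs are
continuity of the geodesic flow at small times (`eventually_continuousAt_geodesicFlow`), continuity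
of the reflection (`continuousWithinAt_reflect`) and transversality with a locally uniform time
bound (`exists_transversal`).

At a trapped `p` the splitting is obtained from a time `t` with `φ_t(p) ∉ 𝓖`: pull `E_s`, `E_u` back
through `dφ_t` and the differential of the inverse of `π` (`extend`). Invariance of the billiard
splitting makes the result independent of `t` (`extend_eq`), and one `t` serves a whole
neighbourhood, so the direct sum, continuity and invariance are inherited.

The estimates need a new norm. The billiard norm transported to `𝓜 ∖ 𝓖` need not extend over `𝓖`,
since nothing is required of `dπ` at the boundary. Call it `ν`, multiply it by a weight `w` that
vanishes exactly on `𝓖` and fast enough for `w ν` to extend by zero (`exists_weight`), and put `μ(W)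
= sup w(φ_t p) ν(dφ_t W) / sup w(φ_t p)`, both suprema over `0 ≤ t ≤ τ(p)`. No such window stays in
`𝓖`, so `μ` is a continuous norm on all of `T𝓜`. Evaluating one window where its numerator is
maximal and the other where its denominator is maximal reduces a comparison of `μ` at two points to
a comparison of `ν` at two times off `𝓖` (`ratio_le`, `exists_adapted_norm`). The bound `τ ≤ 1`
costs a factor `e^{C₁}`; the case of the two times in the wrong order is harmless because the right
end of the window never moves back along a trapped trajectory (`exists_timeSpan`). Over a compact
trapped set all continuous norms are comparable, whence the last claim. -/

theorem contMDiffOn_tangentMap_extChartAt_symm (x₀ : Q) (a : EuclideanSpace ℝ (Fin n)) :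
    ContMDiffOn 𝓘(ℝ, EuclideanSpace ℝ (Fin n)) (𝓡 n).tangent ∞
      (fun y => (⟨(extChartAt (𝓡 n) x₀).symm y,
        mfderiv 𝓘(ℝ, EuclideanSpace ℝ (Fin n)) (𝓡 n) (extChartAt (𝓡 n) x₀).symm y a⟩ :
        TangentBundle (𝓡 n) Q)) (extChartAt (𝓡 n) x₀).target := by
  have hopen : IsOpen (extChartAt (𝓡 n) x₀).target := isOpen_extChartAt_target x₀
  have h1 := (contMDiffOn_extChartAt_symm (I := (𝓡 n)) (n := ∞) x₀).contMDiffOn_tangentMapWithin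
    (m := ∞) (by simp) hopen.uniqueMDiffOn
  have h2 : ContMDiffOn 𝓘(ℝ, EuclideanSpace ℝ (Fin n)) 𝓘(ℝ, EuclideanSpace ℝ (Fin n)).tangent ∞
      (fun y => (⟨y, a⟩ : TangentBundle 𝓘(ℝ, EuclideanSpace ℝ (Fin n)) (EuclideanSpace ℝ (Fin n))))
      (extChartAt (𝓡 n) x₀).target := by
    exact (contMDiffOn_vectorSpace_iff_contDiffOn (V := fun _ => a)).2 contDiffOn_const
  refine (h1.comp h2 (fun y hy => hy)).congr fun y hy => ?_
  simp only [Function.comp, tangentMapWithin, mfderivWithin_of_isOpen hopen hy]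

theorem RiemMetric.contDiffOn_inChart (g : RiemMetric n Q) (x₀ : Q)
    (a b : EuclideanSpace ℝ (Fin n)) :
    ContDiffOn ℝ ∞ (fun y => g.inChart x₀ y a b) (extChartAt (𝓡 n) x₀).target := by
  rw [← contMDiffOn_iff_contDiffOn]
  have hs := contMDiffOn_extChartAt_symm (I := (𝓡 n)) (n := ∞) x₀
  have h := (g.contMDiff.comp_contMDiffOn hs).clm_bundle_apply₂ (F₃ := ℝ) (E₃ := fun _ : Q => ℝ)
    (contMDiffOn_tangentMap_extChartAt_symm x₀ a) (contMDiffOn_tangentMap_extChartAt_symm x₀ b)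
  intro y hy
  have := h y hy
  rw [Bundle.contMDiffWithinAt_totalSpace] at this
  exact this.2

/-- The metric at `x` as a bilinear form on the model space. -/
def RiemMetric.form (g : RiemMetric n Q) (x : Q) :
    EuclideanSpace ℝ (Fin n) →L[ℝ] EuclideanSpace ℝ (Fin n) →L[ℝ] ℝ := g.inner x

/-- The differential of the inverse of the chart at `x₀`, as an endomorphism of the model space. -/
def chartSymmDeriv (x₀ : Q) (y : EuclideanSpace ℝ (Fin n)) :
    EuclideanSpace ℝ (Fin n) →L[ℝ] EuclideanSpace ℝ (Fin n) :=
  mfderiv 𝓘(ℝ, EuclideanSpace ℝ (Fin n)) (𝓡 n) (extChartAt (𝓡 n) x₀).symm y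

/-- The coordinate expression of the metric as a bilinear form. -/
def RiemMetric.chartForm (g : RiemMetric n Q) (x₀ : Q) (y : EuclideanSpace ℝ (Fin n)) :
    EuclideanSpace ℝ (Fin n) →L[ℝ] EuclideanSpace ℝ (Fin n) →L[ℝ] ℝ :=
  (g.form ((extChartAt (𝓡 n) x₀).symm y)).bilinearComp
    (chartSymmDeriv x₀ y) (chartSymmDeriv x₀ y)

theorem RiemMetric.contDiffOn_chartForm (g : RiemMetric n Q) (x₀ : Q) :
    ContDiffOn ℝ ∞ (g.chartForm x₀) (extChartAt (𝓡 n) x₀).target :=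
  contDiffOn_clm_apply.2 fun a => contDiffOn_clm_apply.2 fun b => g.contDiffOn_inChart x₀ a b

theorem mfderiv_extChartAt_symm_injective (x₀ : Q) {y : EuclideanSpace ℝ (Fin n)}
    (hy : y ∈ (extChartAt (𝓡 n) x₀).target) :
    Function.Injective
      (mfderiv 𝓘(ℝ, EuclideanSpace ℝ (Fin n)) (𝓡 n) (extChartAt (𝓡 n) x₀).symm y) := by
  have h := mfderiv_extChartAt_comp_mfderivWithin_extChartAt_symm (I := 𝓡 n) hy
  rw [ModelWithCorners.range_eq_univ, mfderivWithin_univ] at h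
  exact Function.LeftInverse.injective (g := mfderiv (𝓡 n) 𝓘(ℝ, EuclideanSpace ℝ (Fin n)) _ _)
    fun v => congrArg (fun L => L v) h

theorem RiemMetric.chartForm_pos (g : RiemMetric n Q) (x₀ : Q) {y a : EuclideanSpace ℝ (Fin n)}
    (hy : y ∈ (extChartAt (𝓡 n) x₀).target) (ha : a ≠ 0) : 0 < g.chartForm x₀ y a a :=
  g.pos _ _ fun h => ha (mfderiv_extChartAt_symm_injective x₀ hy (h.trans (map_zero _).symm))

theorem RiemMetric.chartForm_symm (g : RiemMetric n Q) (x₀ : Q)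
    (y a b : EuclideanSpace ℝ (Fin n)) : g.chartForm x₀ y a b = g.chartForm x₀ y b a :=
  g.symm _ _ _

/-- A positive definite form on a finite-dimensional space is an isomorphism to the dual. -/
theorem exists_equiv_of_forall_pos {V : Type*} [NormedAddCommGroup V] [NormedSpace ℝ V]
    [FiniteDimensional ℝ V] (b : V →L[ℝ] V →L[ℝ] ℝ) (hb : ∀ v, v ≠ 0 → 0 < b v v) :
    ∃ e : V ≃L[ℝ] (V →L[ℝ] ℝ), (e : V →L[ℝ] V →L[ℝ] ℝ) = b := by
  have hinj : Function.Injective b := by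
    refine (injective_iff_map_eq_zero b).2 fun v hv => ?_
    by_contra h
    have := hb v h
    simp [hv] at this
  have hdim : Module.finrank ℝ V = Module.finrank ℝ (V →L[ℝ] ℝ) := by
    rw [← (LinearMap.toContinuousLinearMap (𝕜 := ℝ) (E := V) (F' := ℝ)).finrank_eq]
    exact (Subspace.dual_finrank_eq (K := ℝ) (V := V)).symm
  let e := LinearEquiv.ofInjectiveOfFinrankEq b.toLinearMap hinj hdim
  exact ⟨e.toContinuousLinearEquiv, by ext v w; rfl⟩

theorem RiemMetric.exists_equiv_chartForm (g : RiemMetric n Q) (x₀ : Q)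
    {y : EuclideanSpace ℝ (Fin n)} (hy : y ∈ (extChartAt (𝓡 n) x₀).target) :
    ∃ e : EuclideanSpace ℝ (Fin n) ≃L[ℝ] (EuclideanSpace ℝ (Fin n) →L[ℝ] ℝ),
      (e : EuclideanSpace ℝ (Fin n) →L[ℝ] EuclideanSpace ℝ (Fin n) →L[ℝ] ℝ) = g.chartForm x₀ y :=
  exists_equiv_of_forall_pos _ fun _ hv => g.chartForm_pos x₀ hy hv

/-- Inversion is smooth at invertible operators, and positivity makes the metric invertible. This is
the operation of raising an index. -/
theorem RiemMetric.contDiffOn_inverse_chartForm (g : RiemMetric n Q) (x₀ : Q) :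
    ContDiffOn ℝ ∞ (fun y => (g.chartForm x₀ y).inverse) (extChartAt (𝓡 n) x₀).target := by
  intro y hy
  obtain ⟨e, he⟩ := g.exists_equiv_chartForm x₀ hy
  have h := contDiffAt_map_inverse (n := ∞) e
  rw [he] at h
  exact h.comp_contDiffWithinAt y (g.contDiffOn_chartForm x₀ y hy)

theorem RiemMetric.chartForm_inverse_apply (g : RiemMetric n Q) (x₀ : Q)
    {y : EuclideanSpace ℝ (Fin n)} (hy : y ∈ (extChartAt (𝓡 n) x₀).target)
    (ξ : EuclideanSpace ℝ (Fin n) →L[ℝ] ℝ) :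
    g.chartForm x₀ y ((g.chartForm x₀ y).inverse ξ) = ξ := by
  obtain ⟨e, he⟩ := g.exists_equiv_chartForm x₀ hy
  rw [← he, ContinuousLinearMap.inverse_equiv]
  simp

theorem RiemMetric.chartForm_injective (g : RiemMetric n Q) (x₀ : Q)
    {y : EuclideanSpace ℝ (Fin n)} (hy : y ∈ (extChartAt (𝓡 n) x₀).target) :
    Function.Injective (g.chartForm x₀ y) := by
  obtain ⟨e, he⟩ := g.exists_equiv_chartForm x₀ hy
  rw [← he]
  exact e.injective

end ChartMetric

/-! ### The geodesic equation as a first-order system on a vector space. -/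

section Spray

variable {V : Type*} [NormedAddCommGroup V] [NormedSpace ℝ V]

/-- The right-hand side of the geodesic equation of the metric `b` on an open subset of a vector
space, before the index is raised. -/
def geodesicForce (b : V → V →L[ℝ] V →L[ℝ] ℝ) (y v : V) : V →L[ℝ] ℝ :=
  (1 / 2 : ℝ) • ((fderiv ℝ b y).flip v).flip v - fderiv ℝ b y v v

/-- The geodesic spray of the metric `b` on an open subset of a vector space. -/
def geodesicSpray (b : V → V →L[ℝ] V →L[ℝ] ℝ) (z : V × V) : V × V :=
  (z.2, (b z.1).inverse (geodesicForce b z.1 z.2))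

theorem geodesicForce_apply (b : V → V →L[ℝ] V →L[ℝ] ℝ) (y v w : V) :
    geodesicForce b y v w = 1 / 2 * fderiv ℝ b y w v v - fderiv ℝ b y v v w := rfl

/-- Class `C¹` is all that Picard-Lindelöf and local uniqueness require. -/
theorem contDiffOn_geodesicSpray [FiniteDimensional ℝ V] {b : V → V →L[ℝ] V →L[ℝ] ℝ} {T : Set V}
    (hT : IsOpen T) (hb : ContDiffOn ℝ ∞ b T)
    (hI : ContDiffOn ℝ ∞ (fun y => (b y).inverse) T) :
    ContDiffOn ℝ 1 (geodesicSpray b) (T ×ˢ univ) := by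
  have h1 : MapsTo Prod.fst (T ×ˢ (univ : Set V)) T := fun z hz => hz.1
  have hD : ContDiffOn ℝ 1 (fun z : V × V => fderiv ℝ b z.1) (T ×ˢ univ) :=
    (hb.fderiv_of_isOpen hT (m := 1) (by norm_cast)).comp contDiffOn_fst h1
  have hI : ContDiffOn ℝ 1 (fun z : V × V => (b z.1).inverse) (T ×ˢ univ) :=
    (hI.of_le (by norm_cast)).comp contDiffOn_fst h1
  refine contDiffOn_snd.prodMk (hI.clm_apply ?_)
  refine contDiffOn_clm_apply.2 fun w => ?_
  have hw := ((hD.clm_apply (contDiffOn_const (c := w))).clm_apply contDiffOn_snd).clm_apply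
    contDiffOn_snd
  have hv := ((hD.clm_apply contDiffOn_snd).clm_apply contDiffOn_snd).clm_apply
    (contDiffOn_const (c := w))
  exact (contDiffOn_const.mul hw).sub hv

theorem hasDerivAt_bilin {b : V → V →L[ℝ] V →L[ℝ] ℝ} {u v w : ℝ → V} {u' v' w' : V} {s : ℝ}
    (hb : DifferentiableAt ℝ b (u s)) (hu : HasDerivAt u u' s) (hv : HasDerivAt v v' s)
    (hw : HasDerivAt w w' s) :
    HasDerivAt (fun r => b (u r) (v r) (w r))
      (fderiv ℝ b (u s) u' (v s) (w s) + b (u s) v' (w s) + b (u s) (v s) w') s := by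
  have := ((hb.hasFDerivAt.comp_hasDerivAt s hu).clm_apply hv).clm_apply hw
  simpa using this

/-- A curve satisfying the Euler-Lagrange equation of the energy is an integral curve of the
spray. -/
theorem hasDerivAt_geodesicSpray {b : V → V →L[ℝ] V →L[ℝ] ℝ} {u : ℝ → V} {s : ℝ}
    (hb : DifferentiableAt ℝ b (u s)) (hinj : Function.Injective (b (u s)))
    (hinv : ∀ ξ, b (u s) ((b (u s)).inverse ξ) = ξ) (hu : ContDiffAt ℝ ∞ u s)
    (hode : ∀ w, HasDerivAt (fun r => b (u r) (deriv u r) w)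
      (1 / 2 * fderiv ℝ (fun y => b y (deriv u s) (deriv u s)) (u s) w) s) :
    HasDerivAt (fun r => (u r, deriv u r)) (geodesicSpray b (u s, deriv u s)) s := by
  have h1 : HasDerivAt u (deriv u s) s := (hu.differentiableAt (by simp)).hasDerivAt
  have h2 : HasDerivAt (deriv u) (deriv (deriv u) s) s :=
    ((hu.derivWithin (m := 1) (by norm_cast)).differentiableAt (by simp)).hasDerivAt
  refine h1.prodMk ?_
  convert h2 using 1
  -- The product rule and the Euler-Lagrange equation compute the same derivative, which determines
  -- `b (u, u'')` as a functional; nondegeneracy of `b` then determines `u''`.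
  apply hinj
  rw [hinv]
  ext w
  have h3 := (hasDerivAt_bilin hb h1 h2 (hasDerivAt_const s w)).unique (hode w)
  have h4 : fderiv ℝ (fun y => b y (deriv u s) (deriv u s)) (u s) w
      = fderiv ℝ b (u s) w (deriv u s) (deriv u s) := by
    rw [((hb.hasFDerivAt.clm_apply (hasFDerivAt_const _ _)).clm_apply
      (hasFDerivAt_const _ _)).fderiv]
    simp
  rw [geodesicForce_apply, ← h4]
  simp at h3
  linarith

/-- The energy is constant along integral curves of the spray. -/
theorem hasDerivAt_energy {b : V → V →L[ℝ] V →L[ℝ] ℝ} {u v : ℝ → V} {s : ℝ}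
    (hb : DifferentiableAt ℝ b (u s)) (hsymm : ∀ w w', b (u s) w w' = b (u s) w' w)
    (hinv : ∀ ξ, b (u s) ((b (u s)).inverse ξ) = ξ)
    (h : HasDerivAt (fun r => (u r, v r)) (geodesicSpray b (u s, v s)) s) :
    HasDerivAt (fun r => b (u r) (v r) (v r)) 0 s := by
  have h1 : HasDerivAt u (v s) s := h.fst
  have h2 : HasDerivAt v ((b (u s)).inverse (geodesicForce b (u s) (v s))) s := h.snd
  convert hasDerivAt_bilin hb h1 h2 h2 using 1
  -- Each of the two acceleration terms is the force evaluated on `v`, that is, minus one half of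
  -- `∂_v b (v, v)`; together they cancel the derivative of `b`.
  rw [hsymm (v s), hinv, geodesicForce_apply]
  ring

end Spray

/-! ### Geodesics in charts of the tangent bundle; conservation of speed. -/

section GeodesicChart

variable {n : ℕ} {Q : Type*} [TopologicalSpace Q] [ChartedSpace (EuclideanSpace ℝ (Fin n)) Q]
  [IsManifold (𝓡 n) ∞ Q]

/-- The geodesic spray in the chart at `x₀`. -/
def RiemMetric.chartSpray (g : RiemMetric n Q) (x₀ : Q) :
    EuclideanSpace ℝ (Fin n) × EuclideanSpace ℝ (Fin n) →
      EuclideanSpace ℝ (Fin n) × EuclideanSpace ℝ (Fin n) :=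
  geodesicSpray (g.chartForm x₀)

theorem RiemMetric.contDiffAt_chartSpray (g : RiemMetric n Q) (x₀ : Q)
    {z : EuclideanSpace ℝ (Fin n) × EuclideanSpace ℝ (Fin n)}
    (hz : z.1 ∈ (extChartAt (𝓡 n) x₀).target) : ContDiffAt ℝ 1 (g.chartSpray x₀) z := by
  have hopen : IsOpen (extChartAt (𝓡 n) x₀).target := isOpen_extChartAt_target x₀
  exact (contDiffOn_geodesicSpray hopen (g.contDiffOn_chartForm x₀)
    (g.contDiffOn_inverse_chartForm x₀)).contDiffAt
    ((hopen.prod isOpen_univ).mem_nhds ⟨hz, mem_univ _⟩)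

theorem RiemMetric.differentiableAt_chartForm (g : RiemMetric n Q) (x₀ : Q)
    {y : EuclideanSpace ℝ (Fin n)} (hy : y ∈ (extChartAt (𝓡 n) x₀).target) :
    DifferentiableAt ℝ (g.chartForm x₀) y :=
  ((g.contDiffOn_chartForm x₀).contDiffAt
    ((isOpen_extChartAt_target x₀).mem_nhds hy)).differentiableAt (by simp)

theorem IsGeodesic.contDiffAt_chart {g : RiemMetric n Q} {γ : ℝ → Q} (hγ : IsGeodesic g γ)
    {x₀ : Q} {s : ℝ} (hs : γ s ∈ (extChartAt (𝓡 n) x₀).source) :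
    ContDiffAt ℝ ∞ (fun r => extChartAt (𝓡 n) x₀ (γ r)) s := by
  rw [← contMDiffAt_iff_contDiffAt]
  exact (contMDiffAt_extChartAt' (by simpa using hs)).comp s (hγ.1 s)

theorem IsGeodesic.hasDerivAt_chart {g : RiemMetric n Q} {γ : ℝ → Q} (hγ : IsGeodesic g γ)
    {x₀ : Q} {s : ℝ} (hs : γ s ∈ (extChartAt (𝓡 n) x₀).source) :
    HasDerivAt (fun r => (extChartAt (𝓡 n) x₀ (γ r),
        deriv (fun r => extChartAt (𝓡 n) x₀ (γ r)) r))
      (g.chartSpray x₀ (extChartAt (𝓡 n) x₀ (γ s),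
        deriv (fun r => extChartAt (𝓡 n) x₀ (γ r)) s)) s := by
  have ht := (extChartAt (𝓡 n) x₀).map_source hs
  exact hasDerivAt_geodesicSpray (g.differentiableAt_chartForm x₀ ht)
    (g.chartForm_injective x₀ ht) (g.chartForm_inverse_apply x₀ ht) (hγ.contDiffAt_chart hs)
    (hγ.2 x₀ s hs)

theorem IsGeodesic.mdifferentiableAt {g : RiemMetric n Q} {γ : ℝ → Q} (hγ : IsGeodesic g γ)
    (s : ℝ) : MDifferentiableAt 𝓘(ℝ, ℝ) (𝓡 n) γ s :=
  (hγ.1 s).mdifferentiableAt (by simp)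

theorem IsGeodesic.continuous_velocityLift {g : RiemMetric n Q} {γ : ℝ → Q}
    (hγ : IsGeodesic g γ) : Continuous (velocityLift (n := n) γ) := by
  have h1 := (hγ.1.contMDiff_tangentMap (m := 0) (by simp)).continuous
  have h2 : ContMDiff 𝓘(ℝ, ℝ) 𝓘(ℝ, ℝ).tangent ∞
      (fun t : ℝ => (⟨t, (1 : ℝ)⟩ : TangentBundle 𝓘(ℝ, ℝ) ℝ)) :=
    (contMDiff_vectorSpace_iff_contDiff (V := fun _ => (1 : ℝ))).2 contDiff_const
  exact h1.comp h2.continuous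

/-- The second component of the tangent bundle chart is the differential of the chart. -/
theorem extChartAt_tangent_apply (ℓ p : TangentBundle (𝓡 n) Q)
    (hp : p.1 ∈ (extChartAt (𝓡 n) ℓ.1).source) :
    extChartAt (𝓡 n).tangent ℓ p = (extChartAt (𝓡 n) ℓ.1 p.1,
      mfderiv (𝓡 n) 𝓘(ℝ, EuclideanSpace ℝ (Fin n)) (extChartAt (𝓡 n) ℓ.1) p.1 p.2) := by
  have hp' : p.1 ∈ (chartAt (EuclideanSpace ℝ (Fin n)) ℓ.1).source := by simpa using hp
  have h1 : Bundle.Trivialization.continuousLinearMapAt ℝ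
      (trivializationAt (EuclideanSpace ℝ (Fin n)) (TangentSpace (𝓡 n)) ℓ.1) p.1 p.2 =
      (trivializationAt (EuclideanSpace ℝ (Fin n)) (TangentSpace (𝓡 n)) ℓ.1 p).2 := by
    rw [Bundle.Trivialization.continuousLinearMapAt_apply,
      Bundle.Trivialization.linearMapAt_apply, if_pos (by simpa using hp')]
  have h2 := congrArg (fun L => L p.2)
    (TangentBundle.continuousLinearMapAt_trivializationAt (I := 𝓡 n) hp')
  rw [FiberBundle.extChartAt]
  exact Prod.ext rfl (h1.symm.trans h2)

theorem mem_extChartAt_tangent_source (ℓ p : TangentBundle (𝓡 n) Q) :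
    p ∈ (extChartAt (𝓡 n).tangent ℓ).source ↔ p.1 ∈ (extChartAt (𝓡 n) ℓ.1).source := by
  simp [TangentBundle.mem_chart_source_iff]

/-- By the chain rule. In charts of `TQ` the velocity curve thus becomes the pair `(u, u')` to which
the spray applies. -/
theorem IsGeodesic.extChartAt_velocityLift {g : RiemMetric n Q} {γ : ℝ → Q}
    (hγ : IsGeodesic g γ) (ℓ : TangentBundle (𝓡 n) Q) {s : ℝ}
    (hs : γ s ∈ (extChartAt (𝓡 n) ℓ.1).source) :
    extChartAt (𝓡 n).tangent ℓ (velocityLift (n := n) γ s) =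
      (extChartAt (𝓡 n) ℓ.1 (γ s), deriv (fun r => extChartAt (𝓡 n) ℓ.1 (γ r)) s) := by
  rw [extChartAt_tangent_apply ℓ _ hs]
  congr 1
  have h1 : MDifferentiableAt (𝓡 n) 𝓘(ℝ, EuclideanSpace ℝ (Fin n)) (extChartAt (𝓡 n) ℓ.1) (γ s) :=
    mdifferentiableAt_extChartAt (by simpa using hs)
  have h2 := mfderiv_comp s h1 (hγ.mdifferentiableAt s)
  rw [← fderiv_apply_one_eq_deriv, ← mfderiv_eq_fderiv]
  exact (congrArg (fun L => L (1 : ℝ)) h2).symm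

theorem RiemMetric.normSq_eq_chartForm (g : RiemMetric n Q) (ℓ p : TangentBundle (𝓡 n) Q)
    (hp : p.1 ∈ (extChartAt (𝓡 n) ℓ.1).source) :
    normSq g p = g.chartForm ℓ.1 (extChartAt (𝓡 n) ℓ.1 p.1) (extChartAt (𝓡 n).tangent ℓ p).2
      (extChartAt (𝓡 n).tangent ℓ p).2 := by
  rw [extChartAt_tangent_apply ℓ p hp]
  have h := mfderivWithin_extChartAt_symm_comp_mfderiv_extChartAt (I := 𝓡 n)
    ((extChartAt (𝓡 n) ℓ.1).map_source hp)
  rw [ModelWithCorners.range_eq_univ, mfderivWithin_univ, (extChartAt (𝓡 n) ℓ.1).left_inv hp] at h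
  have h' : chartSymmDeriv ℓ.1 (extChartAt (𝓡 n) ℓ.1 p.1)
      (mfderiv (𝓡 n) 𝓘(ℝ, EuclideanSpace ℝ (Fin n)) (extChartAt (𝓡 n) ℓ.1) p.1 p.2) = p.2 :=
    congrArg (fun L => L p.2) h
  change _ = g.form _ (chartSymmDeriv _ _ _) (chartSymmDeriv _ _ _)
  rw [h', (extChartAt (𝓡 n) ℓ.1).left_inv hp]
  rfl

/-- Conservation of energy, checked at each time in the chart centred at the current point. -/
theorem IsGeodesic.normSq_const {g : RiemMetric n Q} {γ : ℝ → Q}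
    (hγ : IsGeodesic g γ) (s t : ℝ) :
    normSq g (velocityLift (n := n) γ s) = normSq g (velocityLift (n := n) γ t) := by
  refine is_const_of_deriv_eq_zero
    (f := fun r => normSq g (velocityLift (n := n) γ r)) (fun r => ?_) (fun r => ?_) s t
  all_goals
    have hr : γ r ∈ (extChartAt (𝓡 n) (γ r)).source := mem_extChartAt_source (γ r)
    have ht := (extChartAt (𝓡 n) (γ r)).map_source hr
    have h := hasDerivAt_energy (g.differentiableAt_chartForm (γ r) ht) (g.chartForm_symm (γ r) _)
      (g.chartForm_inverse_apply (γ r) ht) (hγ.hasDerivAt_chart hr)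
    have hev : (fun r => normSq g (velocityLift (n := n) γ r)) =ᶠ[𝓝 r] fun r' =>
        g.chartForm (γ r) (extChartAt (𝓡 n) (γ r) (γ r'))
          (deriv (fun r' => extChartAt (𝓡 n) (γ r) (γ r')) r')
          (deriv (fun r' => extChartAt (𝓡 n) (γ r) (γ r')) r') := by
      filter_upwards [hγ.1.continuous.continuousAt.preimage_mem_nhds
        ((isOpen_extChartAt_source (I := 𝓡 n) (γ r)).mem_nhds hr)] with r' hr'
      rw [g.normSq_eq_chartForm (velocityLift (n := n) γ r) (velocityLift (n := n) γ r') hr',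
        hγ.extChartAt_velocityLift (velocityLift (n := n) γ r) hr']
      rfl
    first
    | exact (h.congr_of_eventuallyEq hev).differentiableAt
    | exact (h.congr_of_eventuallyEq hev).deriv

end GeodesicChart

/-! ### Uniqueness of curves from local uniqueness. -/

section Uniqueness

/-- Two curves that agree near every point at which they meet agree on an interval. -/
theorem eqOn_of_eventuallyEq_of_eq {X : Type*} [TopologicalSpace X] [T2Space X] {f h : ℝ → X}
    {s : Set ℝ} (hs : IsOpen s) (hs' : IsPreconnected s) (hf : ContinuousOn f s)
    (hh : ContinuousOn h s) {t₀ : ℝ} (ht₀ : t₀ ∈ s) (h0 : f t₀ = h t₀)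
    (hloc : ∀ t ∈ s, f t = h t → f =ᶠ[𝓝 t] h) : EqOn f h s := by
  set u : Set ℝ := {t | f =ᶠ[𝓝 t] h} with hu
  have huo : IsOpen u := isOpen_setOfPred_eventually_nhds
  have key : s ⊆ u := by
    -- The set of local agreement is open. At a limit point the curves agree since the space is
    -- Hausdorff, and `hloc` upgrades this to local agreement, so the set is relatively closed.
    refine hs'.subset_of_closure_inter_subset huo ⟨t₀, ht₀, hloc t₀ ht₀ h0⟩ ?_
    rintro t ⟨ht, hts⟩
    refine hloc t hts ?_
    have hne : (𝓝[u] t).NeBot := mem_closure_iff_nhdsWithin_neBot.1 ht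
    have hft := (hf.continuousAt (hs.mem_nhds hts)).tendsto.mono_left
      (nhdsWithin_le_nhds (s := u))
    have hht := (hh.continuousAt (hs.mem_nhds hts)).tendsto.mono_left
      (nhdsWithin_le_nhds (s := u))
    refine tendsto_nhds_unique (hft.congr' ?_) hht
    filter_upwards [self_mem_nhdsWithin] with r hr using hr.self_of_nhds
  exact fun t ht => (key ht).self_of_nhds

theorem eventuallyEq_of_hasDerivAt_of_contDiffAt {V : Type*} [NormedAddCommGroup V]
    [NormedSpace ℝ V] {F : V → V} {f h : ℝ → V} {t : ℝ} (hF : ContDiffAt ℝ 1 F (f t))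
    (hf : ∀ᶠ r in 𝓝 t, HasDerivAt f (F (f r)) r) (hh : ∀ᶠ r in 𝓝 t, HasDerivAt h (F (h r)) r)
    (heq : f t = h t) : f =ᶠ[𝓝 t] h := by
  obtain ⟨K, s, hs, hl⟩ := hF.exists_lipschitzOnWith
  refine ODE_solution_unique_of_eventually (v := fun _ => F) (s := fun _ => s)
    (Eventually.of_forall fun _ => hl) (hf.and ?_) (hh.and ?_) heq
  · exact hf.self_of_nhds.continuousAt.preimage_mem_nhds hs
  · exact hh.self_of_nhds.continuousAt.preimage_mem_nhds (heq ▸ hs)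

end Uniqueness

/-! ### The geodesic flow: group law and continuity at small times. -/

section GeodesicFlow

variable {n : ℕ} {Q : Type*} [TopologicalSpace Q] [ChartedSpace (EuclideanSpace ℝ (Fin n)) Q]
  [IsManifold (𝓡 n) ∞ Q]

/-- Vectors over different points are separated in the base, vectors over the same point in a common
trivialization. The uniqueness argument for curves in `TQ` uses this. -/
instance tangentBundle_t2Space [T2Space Q] : T2Space (TangentBundle (𝓡 n) Q) := by
  refine ⟨fun p q hpq => ?_⟩
  by_cases h : p.1 = q.1
  · set e := trivializationAt (EuclideanSpace ℝ (Fin n)) (TangentSpace (𝓡 n)) p.1 with he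
    have hp : p ∈ e.source := by simp [he]
    have hq : q ∈ e.source := by simp [he, ← h]
    obtain ⟨u, v, hu, hv, hpu, hqv, huv⟩ := t2_separation
      (fun h => hpq (e.toOpenPartialHomeomorph.injOn hp hq h) : e p ≠ e q)
    exact ⟨_, _, e.toOpenPartialHomeomorph.isOpen_inter_preimage hu,
      e.toOpenPartialHomeomorph.isOpen_inter_preimage hv, ⟨hp, hpu⟩, ⟨hq, hqv⟩,
      disjoint_left.2 fun x hx hx' => disjoint_left.1 huv hx.2 hx'.2⟩
  · obtain ⟨u, v, hu, hv, hpu, hqv, huv⟩ := t2_separation h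
    have hc : Continuous (fun x : TangentBundle (𝓡 n) Q => x.1) :=
      FiberBundle.continuous_proj (EuclideanSpace ℝ (Fin n)) (TangentSpace (𝓡 n))
    exact ⟨_, _, hu.preimage hc, hv.preimage hc, hpu, hqv, huv.preimage _⟩

theorem IsGeodesic.eventually_hasDerivAt_extChartAt {g : RiemMetric n Q} {γ : ℝ → Q}
    (hγ : IsGeodesic g γ) (ℓ : TangentBundle (𝓡 n) Q) {t : ℝ}
    (ht : velocityLift (n := n) γ t ∈ (extChartAt (𝓡 n).tangent ℓ).source) :
    ∀ᶠ r in 𝓝 t, HasDerivAt (fun r => extChartAt (𝓡 n).tangent ℓ (velocityLift (n := n) γ r))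
      (g.chartSpray ℓ.1 (extChartAt (𝓡 n).tangent ℓ (velocityLift (n := n) γ r))) r := by
  rw [mem_extChartAt_tangent_source] at ht
  have hU : ∀ᶠ r in 𝓝 t, γ r ∈ (extChartAt (𝓡 n) ℓ.1).source :=
    hγ.1.continuous.continuousAt.preimage_mem_nhds
      ((isOpen_extChartAt_source (I := 𝓡 n) ℓ.1).mem_nhds ht)
  filter_upwards [hU.eventually_nhds] with r hr
  rw [hγ.extChartAt_velocityLift ℓ hr.self_of_nhds]
  refine (hγ.hasDerivAt_chart hr.self_of_nhds).congr_of_eventuallyEq ?_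
  filter_upwards [hr] with r' hr'
  exact hγ.extChartAt_velocityLift ℓ hr'

/-- Where two velocity curves meet, both solve the spray equation in the chart centred at the common
vector, so they agree nearby. -/
theorem IsGeodesic.velocityLift_eq [T2Space Q] {g : RiemMetric n Q} {γ γ' : ℝ → Q}
    (hγ : IsGeodesic g γ) (hγ' : IsGeodesic g γ')
    (h : velocityLift (n := n) γ 0 = velocityLift γ' 0) :
    velocityLift (n := n) γ = velocityLift γ' := by
  funext t
  refine eqOn_of_eventuallyEq_of_eq isOpen_univ isPreconnected_univ
    hγ.continuous_velocityLift.continuousOn hγ'.continuous_velocityLift.continuousOn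
    (mem_univ 0) h (fun t _ ht => ?_) (mem_univ t)
  set ℓ := velocityLift (n := n) γ t with hℓ
  have hs : ℓ ∈ (extChartAt (𝓡 n).tangent ℓ).source := mem_extChartAt_source ℓ
  have hso := (isOpen_extChartAt_source (I := (𝓡 n).tangent) ℓ)
  have hF : ContDiffAt ℝ 1 (g.chartSpray ℓ.1) (extChartAt (𝓡 n).tangent ℓ ℓ) :=
    g.contDiffAt_chartSpray ℓ.1 (by
      rw [extChartAt_tangent_apply ℓ ℓ (mem_extChartAt_source _)]
      exact (extChartAt (𝓡 n) ℓ.1).map_source (mem_extChartAt_source _))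
  have := eventuallyEq_of_hasDerivAt_of_contDiffAt hF
    (hγ.eventually_hasDerivAt_extChartAt ℓ hs)
    (hγ'.eventually_hasDerivAt_extChartAt ℓ (ht ▸ hs)) (congrArg _ ht)
  filter_upwards [this, hγ.continuous_velocityLift.continuousAt.preimage_mem_nhds
    (hso.mem_nhds hs), hγ'.continuous_velocityLift.continuousAt.preimage_mem_nhds
    (hso.mem_nhds (ht ▸ hs))] with r hr h1 h2
  exact (extChartAt (𝓡 n).tangent ℓ).injOn h1 h2 hr

theorem velocityLift_comp_add {γ : ℝ → Q} (hγ : MDifferentiable 𝓘(ℝ, ℝ) (𝓡 n) γ) (s t : ℝ) :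
    velocityLift (n := n) (fun r => γ (r + s)) t = velocityLift γ (t + s) := by
  have h1 : MDifferentiableAt 𝓘(ℝ, ℝ) 𝓘(ℝ, ℝ) (fun r : ℝ => r + s) t :=
    (differentiableAt_id.add_const s).mdifferentiableAt
  have h2 := mfderiv_comp t (hγ (t + s)) h1
  have h3 : mfderiv 𝓘(ℝ, ℝ) 𝓘(ℝ, ℝ) (fun r : ℝ => r + s) t (1 : ℝ) = (1 : ℝ) := by
    rw [mfderiv_eq_fderiv, fderiv_add_const]
    exact congrFun (congrArg DFunLike.coe (fderiv_fun_id (𝕜 := ℝ) (x := t))) (1 : ℝ)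
  have h4 := congrArg (fun L => L (1 : ℝ)) h2
  simp only [velocityLift]
  congr 1
  refine h4.trans ?_
  exact congrArg _ h3

theorem IsGeodesic.comp_add {g : RiemMetric n Q} {γ : ℝ → Q} (hγ : IsGeodesic g γ) (c : ℝ) :
    IsGeodesic g (fun r => γ (r + c)) := by
  refine ⟨hγ.1.comp (contDiff_id.add contDiff_const).contMDiff, fun x₀ s hs => ?_⟩
  intro u w
  have h := hγ.2 x₀ (s + c) hs w
  set v : ℝ → EuclideanSpace ℝ (Fin n) := fun r => extChartAt (𝓡 n) x₀ (γ r) with hv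
  have hu : u = fun r => v (r + c) := rfl
  have hd : ∀ r, deriv u r = deriv v (r + c) := fun r => by rw [hu, deriv_comp_add_const]
  simp only [hd]
  exact h.comp_add_const s c

/-- `geodesicFlow` picks some geodesic by choice; uniqueness makes the pick harmless. All properties
of the flow are read off from this formula. -/
theorem geodesicFlow_velocityLift [T2Space Q] {g : RiemMetric n Q} {γ : ℝ → Q}
    (hγ : IsGeodesic g γ) (s t : ℝ) :
    geodesicFlow g t (velocityLift (n := n) γ s) = velocityLift γ (t + s) := by
  have h : ∃ γ', IsGeodesic g γ' ∧ velocityLift (n := n) γ' 0 = velocityLift (n := n) γ s :=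
    ⟨fun r => γ (r + s), hγ.comp_add s, by
      rw [velocityLift_comp_add hγ.mdifferentiableAt, zero_add]⟩
  rw [geodesicFlow, dif_pos h, ← velocityLift_comp_add hγ.mdifferentiableAt]
  refine congrFun (h.choose_spec.1.velocityLift_eq (hγ.comp_add s) ?_) t
  rw [h.choose_spec.2, velocityLift_comp_add hγ.mdifferentiableAt, zero_add]

variable [T2Space Q] {g : RiemMetric n Q}

theorem geodesicFlow_zero (hg : IsCompleteMetric g) (p : TangentBundle (𝓡 n) Q) :
    geodesicFlow g 0 p = p := by
  obtain ⟨γ, hγ, rfl⟩ := hg p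
  rw [geodesicFlow_velocityLift hγ, zero_add]

theorem geodesicFlow_add (hg : IsCompleteMetric g) (s t : ℝ) (p : TangentBundle (𝓡 n) Q) :
    geodesicFlow g s (geodesicFlow g t p) = geodesicFlow g (s + t) p := by
  obtain ⟨γ, hγ, rfl⟩ := hg p
  simp only [geodesicFlow_velocityLift hγ, add_zero]

theorem geodesicFlow_injective (hg : IsCompleteMetric g) (s : ℝ) :
    Function.Injective (geodesicFlow g s) := fun p q h => by
  have := congrArg (geodesicFlow g (-s)) h
  simpa [geodesicFlow_add hg, geodesicFlow_zero hg] using this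

theorem continuous_geodesicFlow_left (hg : IsCompleteMetric g) (p : TangentBundle (𝓡 n) Q) :
    Continuous fun t => geodesicFlow g t p := by
  obtain ⟨γ, hγ, rfl⟩ := hg p
  simpa only [geodesicFlow_velocityLift hγ, add_zero] using hγ.continuous_velocityLift

theorem normSq_geodesicFlow (hg : IsCompleteMetric g) (t : ℝ) (p : TangentBundle (𝓡 n) Q) :
    normSq g (geodesicFlow g t p) = normSq g p := by
  obtain ⟨γ, hγ, rfl⟩ := hg p
  rw [geodesicFlow_velocityLift hγ]
  exact hγ.normSq_const _ _

/-- The geodesic flow is jointly continuous at all small times. -/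
theorem eventually_continuousAt_geodesicFlow (hg : IsCompleteMetric g)
    (ℓ : TangentBundle (𝓡 n) Q) :
    ∀ᶠ z in 𝓝 ((0 : ℝ), ℓ), ContinuousAt
      (fun z : ℝ × TangentBundle (𝓡 n) Q => geodesicFlow g z.1 z.2) z := by
  set Ψ := extChartAt (𝓡 n).tangent ℓ with hΨ
  have hℓ : ℓ ∈ Ψ.source := mem_extChartAt_source ℓ
  have hso : IsOpen Ψ.source := isOpen_extChartAt_source ℓ
  have hto : IsOpen Ψ.target := isOpen_extChartAt_target ℓ
  have hbase : ∀ p ∈ Ψ.source, (Ψ p).1 ∈ (extChartAt (𝓡 n) ℓ.1).target := fun p hp => by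
    rw [hΨ, mem_extChartAt_tangent_source] at hp
    rw [hΨ, extChartAt_tangent_apply ℓ p hp]
    exact (extChartAt (𝓡 n) ℓ.1).map_source hp
  have hF : ∀ p ∈ Ψ.source, ContDiffAt ℝ 1 (g.chartSpray ℓ.1) (Ψ p) := fun p hp =>
    g.contDiffAt_chartSpray ℓ.1 (hbase p hp)
  obtain ⟨ε, hε, a, r, L, K, hr, hpl⟩ := IsPicardLindelof.of_contDiffAt_one (hF ℓ hℓ)
  -- `α` is the local flow of the spray in the chart at `ℓ`, jointly continuous in the initial value
  -- and time.
  obtain ⟨α, hα, hαc⟩ := (hpl 0).exists_forall_mem_closedBall_eq_hasDerivWithinAt_continuousOn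
  have hr' : (0 : ℝ) < r := hr
  have hα0 : α (Ψ ℓ, 0) = Ψ ℓ := (hα _ (Metric.mem_closedBall_self hr'.le)).1
  have hnhds : Metric.closedBall (Ψ ℓ) r ×ˢ Icc (0 - ε) (0 + ε) ∈ 𝓝 (Ψ ℓ, (0 : ℝ)) :=
    prod_mem_nhds (Metric.closedBall_mem_nhds _ hr') (Icc_mem_nhds (by linarith) (by linarith))
  have hmem : ∀ᶠ z in 𝓝 (Ψ ℓ, (0 : ℝ)), α z ∈ Ψ.target ∧
      z ∈ Metric.closedBall (Ψ ℓ) r ×ˢ Icc (0 - ε) (0 + ε) := by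
    have h : ∀ᶠ z in 𝓝 (Ψ ℓ, (0 : ℝ)), α z ∈ Ψ.target :=
      (hαc.continuousAt hnhds).preimage_mem_nhds
        (hto.mem_nhds (by rw [hα0]; exact Ψ.map_source hℓ))
    exact h.and hnhds
  -- Initial values and times are restricted so that `α` does not leave the chart.
  obtain ⟨U, hU, δ', hδ', hUδ⟩ : ∃ U ∈ 𝓝 (Ψ ℓ), ∃ δ > 0, ∀ y ∈ U, ∀ t ∈ Ioo (-δ) δ,
      α (y, t) ∈ Ψ.target ∧ (y, t) ∈ Metric.closedBall (Ψ ℓ) r ×ˢ Icc (0 - ε) (0 + ε) := by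
    obtain ⟨U, hU, I, hI, hUI⟩ := mem_nhds_prod_iff.1 hmem
    obtain ⟨δ, hδ, hδI⟩ := Metric.mem_nhds_iff.1 hI
    rw [Real.ball_eq_Ioo, zero_sub, zero_add] at hδI
    exact ⟨U, hU, δ, hδ, fun y hy t ht => hUI (mk_mem_prod hy (hδI ht))⟩
  obtain ⟨δ, hδ, hδ'', hδε⟩ : ∃ δ > 0, δ ≤ δ' ∧ δ ≤ ε := ⟨min δ' ε, by positivity, by simp, by simp⟩
  have hball : ∀ y ∈ U, y ∈ Metric.closedBall (Ψ ℓ) r := fun y hy =>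
    (hUδ y hy 0 (by constructor <;> linarith)).2.1
  have hαd : ∀ y ∈ U, ∀ t ∈ Ioo (-δ) δ, HasDerivAt (fun t => α (y, t))
      (g.chartSpray ℓ.1 (α (y, t))) t := fun y hy t ht =>
    ((hα y (hball y hy)).2 t (by constructor <;> linarith [ht.1, ht.2])).hasDerivAt
      (Icc_mem_nhds (by linarith [ht.1]) (by linarith [ht.2]))
  have hαt : ∀ y ∈ U, ∀ t ∈ Ioo (-δ) δ, α (y, t) ∈ Ψ.target := fun y hy t ht =>
    (hUδ y hy t (by constructor <;> linarith [ht.1, ht.2])).1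
  -- The geodesic is not known in advance to stay in the chart, but `α` does. Wherever the two
  -- curves meet the geodesic is in the chart as well, so local uniqueness propagates over the whole
  -- time interval.
  have key : ∀ p ∈ Ψ.source, Ψ p ∈ U →
      EqOn (fun t => geodesicFlow g t p) (fun t => Ψ.symm (α (Ψ p, t))) (Ioo (-δ) δ) := by
    intro p hp hpU
    have hsymm : ContinuousOn (fun t => Ψ.symm (α (Ψ p, t))) (Ioo (-δ) δ) :=
      (continuousOn_extChartAt_symm (I := (𝓡 n).tangent) ℓ).comp
        (fun t ht => (hαd _ hpU t ht).continuousAt.continuousWithinAt) (hαt _ hpU)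
    refine eqOn_of_eventuallyEq_of_eq isOpen_Ioo isPreconnected_Ioo
      (continuous_geodesicFlow_left hg p).continuousOn hsymm (t₀ := 0) (by constructor <;> linarith)
      ?_ fun t ht heq => ?_
    · rw [geodesicFlow_zero hg]
      exact ((congrArg Ψ.symm (hα _ (hball _ hpU)).1).trans (Ψ.left_inv hp)).symm
    · obtain ⟨γ, hγ, hγp⟩ := hg p
      have hγf : ∀ t, geodesicFlow g t p = velocityLift (n := n) γ t := fun t => by
        rw [← hγp, geodesicFlow_velocityLift hγ, add_zero]
      simp only [hγf] at heq ⊢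
      have hts : velocityLift (n := n) γ t ∈ Ψ.source := by
        rw [heq]; exact Ψ.map_target (hαt _ hpU t ht)
      have heq' : Ψ (velocityLift (n := n) γ t) = α (Ψ p, t) := by
        rw [heq, Ψ.right_inv (hαt _ hpU t ht)]
      have hIoo : ∀ᶠ r in 𝓝 t, r ∈ Ioo (-δ) δ := isOpen_Ioo.mem_nhds ht
      have := eventuallyEq_of_hasDerivAt_of_contDiffAt (hF _ hts)
        (hγ.eventually_hasDerivAt_extChartAt ℓ hts) (h := fun t => α (Ψ p, t))
        (hIoo.mono fun r hr => hαd _ hpU r hr) heq'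
      filter_upwards [this, hγ.continuous_velocityLift.continuousAt.preimage_mem_nhds
        (hso.mem_nhds hts)] with r hr hrs
      rw [← hr, Ψ.left_inv hrs]
  have hΨc : ContinuousAt Ψ ℓ := continuousAt_extChartAt ℓ
  obtain ⟨O, hOU, hO, hOℓ⟩ := mem_nhds_iff.1
    (inter_mem (hso.mem_nhds hℓ) (hΨc.preimage_mem_nhds (interior_mem_nhds.2 hU)))
  have hW : IsOpen (Ioo (-δ) δ ×ˢ O) := isOpen_Ioo.prod hO
  filter_upwards [hW.mem_nhds (⟨⟨by linarith, hδ⟩, hOℓ⟩ : ((0 : ℝ), ℓ) ∈ Ioo (-δ) δ ×ˢ O)] with z hz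
  have hev : (fun z : ℝ × TangentBundle (𝓡 n) Q => geodesicFlow g z.1 z.2) =ᶠ[𝓝 z]
      fun z => Ψ.symm (α (Ψ z.2, z.1)) := by
    filter_upwards [hW.mem_nhds hz] with w hw
    exact key w.2 (hOU hw.2).1 (interior_subset (hOU hw.2).2) hw.1
  refine ContinuousAt.congr ?_ hev.symm
  have hzU : Ψ z.2 ∈ interior U := (hOU hz.2).2
  have h1 : ContinuousAt α (Ψ z.2, z.1) := hαc.continuousAt
    (prod_mem_nhds (mem_of_superset (mem_interior_iff_mem_nhds.1 hzU) hball)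
      (Icc_mem_nhds (by linarith [hz.1.1]) (by linarith [hz.1.2])))
  have h2 : ContinuousAt (fun z : ℝ × TangentBundle (𝓡 n) Q => (Ψ z.2, z.1)) z :=
    ((continuousAt_extChartAt' (I := (𝓡 n).tangent) (by simpa [hΨ] using (hOU hz.2).1)).comp
      continuousAt_snd).prodMk continuousAt_fst
  have h3 : ContinuousAt Ψ.symm (α (Ψ z.2, z.1)) :=
    continuousAt_extChartAt_symm'' (hαt _ (interior_subset hzU) _ hz.1)
  exact ContinuousAt.comp (f := fun z : ℝ × TangentBundle (𝓡 n) Q => α (Ψ z.2, z.1)) h3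
    (ContinuousAt.comp (f := fun z : ℝ × TangentBundle (𝓡 n) Q => (Ψ z.2, z.1)) h1 h2)

theorem continuousAt_geodesicFlow_zero (hg : IsCompleteMetric g) (ℓ : TangentBundle (𝓡 n) Q) :
    Tendsto (fun z : ℝ × TangentBundle (𝓡 n) Q => geodesicFlow g z.1 z.2) (𝓝 ((0 : ℝ), ℓ))
      (𝓝 ℓ) := by
  have := (eventually_continuousAt_geodesicFlow hg ℓ).self_of_nhds
  rwa [ContinuousAt, geodesicFlow_zero hg] at this

end GeodesicFlow

/-! ### Defining functions of the obstacle set. -/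

section DefiningFunctions

/-- A linear functional that is nonnegative where another one is positive is a multiple of it. -/
theorem exists_pos_smul_eq_of_forall_nonneg {V : Type*} [AddCommGroup V] [Module ℝ V]
    {φ ψ : V →ₗ[ℝ] ℝ} (hφ : φ ≠ 0) (hψ : ψ ≠ 0) (h : ∀ w, 0 < ψ w → 0 ≤ φ w) :
    ∃ c : ℝ, 0 < c ∧ φ = c • ψ := by
  obtain ⟨w₀, hw₀⟩ : ∃ w, ψ w = 1 := by
    obtain ⟨w, hw⟩ : ∃ w, ψ w ≠ 0 := by
      by_contra! h; exact hψ (LinearMap.ext h)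
    exact ⟨(ψ w)⁻¹ • w, by simp [hw]⟩
  have hker : ∀ w, ψ w = 0 → 0 ≤ φ w := fun w hw => by
    by_contra! hneg
    -- The coefficient keeps `ψ` at `1` and moves `φ` to exactly `-1`.
    have h1 := h (w₀ + ((φ w₀ + 1) / (-φ w)) • w) (by simp [hw₀, hw])
    have h2 : (φ w₀ + 1) / (-φ w) * φ w = -(φ w₀ + 1) := by
      rw [div_neg, neg_mul, div_mul_cancel₀ _ hneg.ne]
    simp only [map_add, map_smul, smul_eq_mul, h2] at h1
    linarith
  have hker' : ∀ w, ψ w = 0 → φ w = 0 := fun w hw => by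
    have h1 := hker (-w) (by simp [hw])
    rw [map_neg] at h1
    linarith [hker w hw]
  have heq : φ = φ w₀ • ψ := LinearMap.ext fun w => by
    have := hker' (w - ψ w • w₀) (by simp [hw₀])
    simp only [map_sub, map_smul, smul_eq_mul, LinearMap.smul_apply] at this ⊢
    linarith
  refine ⟨φ w₀, lt_of_le_of_ne (h w₀ (by rw [hw₀]; exact one_pos)) fun h0 => hφ ?_, heq⟩
  rw [heq, ← h0, zero_smul]

variable {n : ℕ} {Q : Type*} [TopologicalSpace Q] [ChartedSpace (EuclideanSpace ℝ (Fin n)) Q]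

/-- The differential of a real function as a functional on the model space. -/
def dform (f : Q → ℝ) (x : Q) : EuclideanSpace ℝ (Fin n) →L[ℝ] ℝ := mfderiv (𝓡 n) 𝓘(ℝ, ℝ) f x

namespace IsDefiningFunction

variable {Ω : Set Q} {x : Q} {U : Set Q} {f : Q → ℝ}

theorem contMDiffAt (h : IsDefiningFunction (n := n) Ω x U f) {y : Q} (hy : y ∈ U) :
    ContMDiffAt (𝓡 n) 𝓘(ℝ, ℝ) ∞ f y :=
  h.contMDiffOn.contMDiffAt (h.isOpen.mem_nhds hy)

/-- If `f y` were positive, `f` would be positive near `y`, and `y` would be interior to `Ω`. -/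
theorem eq_zero (h : IsDefiningFunction (n := n) Ω x U f) (hΩ : IsClosed Ω) {y : Q} (hy : y ∈ U)
    (hy' : y ∈ frontier Ω) : f y = 0 := by
  have h1 : 0 ≤ f y := (h.mem_iff y hy).1 (hΩ.frontier_subset hy')
  by_contra h0
  have h2 : 0 < f y := lt_of_le_of_ne h1 (Ne.symm h0)
  refine hy'.2 (mem_interior_iff_mem_nhds.2 ?_)
  filter_upwards [(h.contMDiffAt hy).continuousAt.eventually (lt_mem_nhds h2),
    h.isOpen.mem_nhds hy] with z hz hzU
  exact (h.mem_iff z hzU).2 hz.le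

theorem of_mem (h : IsDefiningFunction (n := n) Ω x U f) {y : Q} (hy : y ∈ U)
    (hd : dform (n := n) f y ≠ 0) : IsDefiningFunction (n := n) Ω y U f :=
  ⟨h.isOpen, hy, h.contMDiffOn, h.mem_iff, hd⟩

end IsDefiningFunction

end DefiningFunctions

/-! ### Differentials along geodesics and the unit normal. -/

section Differential

variable {n : ℕ} {Q : Type*} [TopologicalSpace Q] [ChartedSpace (EuclideanSpace ℝ (Fin n)) Q]
  [IsManifold (𝓡 n) ∞ Q]

theorem continuousOn_dform {U : Set Q} (hU : IsOpen U) {f : Q → ℝ}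
    (hf : ContMDiffOn (𝓡 n) 𝓘(ℝ, ℝ) ∞ f U) :
    ContinuousOn (fun p : TangentBundle (𝓡 n) Q => dform (n := n) f p.1 p.2)
      ((fun p : TangentBundle (𝓡 n) Q => p.1) ⁻¹' U) := by
  have h1 := hf.continuousOn_tangentMapWithin (by simp) hU.uniqueMDiffOn
  have h2 : Continuous (fun p : TangentBundle 𝓘(ℝ, ℝ) ℝ => p.2) :=
    (contMDiff_snd_tangentBundle_modelSpace ℝ 𝓘(ℝ, ℝ) (n := 0)).continuous
  refine (h2.comp_continuousOn h1).congr fun p hp => ?_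
  have : mfderivWithin (𝓡 n) 𝓘(ℝ, ℝ) f U p.1 = mfderiv (𝓡 n) 𝓘(ℝ, ℝ) f p.1 :=
    mfderivWithin_of_isOpen hU hp
  change _ = mfderivWithin (𝓡 n) 𝓘(ℝ, ℝ) f U p.1 p.2
  rw [this]
  rfl

theorem IsGeodesic.hasDerivAt_comp {g : RiemMetric n Q} {γ : ℝ → Q} (hγ : IsGeodesic g γ)
    {f : Q → ℝ} {s : ℝ} (hf : MDifferentiableAt (𝓡 n) 𝓘(ℝ, ℝ) f (γ s)) :
    HasDerivAt (fun r => f (γ r)) (dform (n := n) f (γ s) (velocityLift (n := n) γ s).2) s := by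
  have h := (hf.hasMFDerivAt.comp s (hγ.mdifferentiableAt s).hasMFDerivAt)
  set L : ℝ →L[ℝ] ℝ :=
    (mfderiv (𝓡 n) 𝓘(ℝ, ℝ) f (γ s)).comp (mfderiv 𝓘(ℝ, ℝ) (𝓡 n) γ s) with hL
  have h' : HasFDerivAt (f ∘ γ) L s := hasMFDerivAt_iff_hasFDerivAt.1 h
  exact h'.hasDerivAt

variable [T2Space Q] (B : BilliardSystem n Q)

theorem hasDerivAt_comp_geodesicFlow {g : RiemMetric n Q} (hg : IsCompleteMetric g)
    (p : TangentBundle (𝓡 n) Q) {f : Q → ℝ} {s : ℝ}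
    (hf : MDifferentiableAt (𝓡 n) 𝓘(ℝ, ℝ) f (geodesicFlow g s p).1) :
    HasDerivAt (fun r => f (geodesicFlow g r p).1)
      (dform (n := n) f (geodesicFlow g s p).1 (geodesicFlow g s p).2) s := by
  obtain ⟨γ, hγ, hγp⟩ := hg p
  have e : ∀ r, geodesicFlow g r p = velocityLift (n := n) γ r := fun r => by
    rw [← hγp, geodesicFlow_velocityLift hγ, add_zero]
  have e' : (fun r => f (geodesicFlow g r p).1) = fun r => f (γ r) :=
    funext fun r => by rw [e r]; rfl
  rw [e s] at hf
  rw [e', e s]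
  exact hγ.hasDerivAt_comp hf

namespace BilliardSystem

/-- A geodesic whose initial vector has `df' > 0` enters `Ω`, so `f ≥ 0` along it and `df ≥ 0` on
the vector; a half-space inclusion of this kind forces proportionality. The lemma is needed since
`normal` refers to an unspecified defining function. -/
theorem exists_dform_eq_smul {x : Q} (hx : x ∈ frontier B.obstacle) {U U' : Set Q} {f f' : Q → ℝ}
    (h : IsDefiningFunction (n := n) B.obstacle x U f)
    (h' : IsDefiningFunction (n := n) B.obstacle x U' f') :
    ∃ c : ℝ, 0 < c ∧ dform (n := n) f x = c • dform (n := n) f' x := by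
  have hnonneg : ∀ w, 0 < dform (n := n) f' x w → 0 ≤ dform (n := n) f x w := by
    intro w hw
    set p : TangentBundle (𝓡 n) Q := ⟨x, w⟩ with hp
    have hp0 : geodesicFlow B.metric 0 p = p := geodesicFlow_zero B.complete p
    have hc : Continuous (fun s => (geodesicFlow B.metric s p).1) :=
      (FiberBundle.continuous_proj (EuclideanSpace ℝ (Fin n)) (TangentSpace (𝓡 n))).comp
        (continuous_geodesicFlow_left B.complete p)
    have hd : HasDerivAt (fun r => f (geodesicFlow B.metric r p).1) (dform (n := n) f x w) 0 := by
      have := hasDerivAt_comp_geodesicFlow B.complete p (f := f) (s := 0)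
        (by rw [hp0]; exact (h.contMDiffAt h.mem).mdifferentiableAt (by simp))
      rwa [hp0] at this
    have hd' : HasDerivAt (fun r => f' (geodesicFlow B.metric r p).1) (dform (n := n) f' x w) 0 := by
      have := hasDerivAt_comp_geodesicFlow B.complete p (f := f') (s := 0)
        (by rw [hp0]; exact (h'.contMDiffAt h'.mem).mdifferentiableAt (by simp))
      rwa [hp0] at this
    have e : f (geodesicFlow B.metric 0 p).1 = 0 := by
      rw [hp0]; exact h.eq_zero B.isClosed_obstacle h.mem hx
    have e' : f' (geodesicFlow B.metric 0 p).1 = 0 := by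
      rw [hp0]; exact h'.eq_zero B.isClosed_obstacle h'.mem hx
    have t : Tendsto _ (𝓝[>] (0 : ℝ)) _ := (hasDerivAt_iff_tendsto_slope.1 hd).mono_left
      (nhdsWithin_mono 0 (fun r (hr : 0 < r) => hr.ne'))
    have t' : Tendsto _ (𝓝[>] (0 : ℝ)) _ := (hasDerivAt_iff_tendsto_slope.1 hd').mono_left
      (nhdsWithin_mono 0 (fun r (hr : 0 < r) => hr.ne'))
    refine ge_of_tendsto t ?_
    filter_upwards [t'.eventually (lt_mem_nhds hw), self_mem_nhdsWithin,
      mem_nhdsWithin_of_mem_nhds (hc.continuousAt.preimage_mem_nhds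
        (h.isOpen.mem_nhds (by rw [hp0]; exact h.mem))),
      mem_nhdsWithin_of_mem_nhds (hc.continuousAt.preimage_mem_nhds
        (h'.isOpen.mem_nhds (by rw [hp0]; exact h'.mem)))] with r hr hr0 hrU hrU'
    have hr0' : (0 : ℝ) < r := hr0
    simp only [slope_def_field, e, e', sub_zero] at hr ⊢
    have : 0 < f' (geodesicFlow B.metric r p).1 := by
      by_contra! hle
      exact absurd hr (not_lt.2 (div_nonpos_of_nonpos_of_nonneg hle hr0'.le))
    exact div_nonneg ((h.mem_iff _ hrU).1 ((h'.mem_iff _ hrU').2 this.le)) hr0'.le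
  obtain ⟨c, hc, heq⟩ := exists_pos_smul_eq_of_forall_nonneg
    (φ := (dform (n := n) f x).toLinearMap) (ψ := (dform (n := n) f' x).toLinearMap)
    (fun h0 => h.mfderiv_ne_zero (ContinuousLinearMap.coe_injective h0))
    (fun h0 => h'.mfderiv_ne_zero (ContinuousLinearMap.coe_injective h0)) hnonneg
  exact ⟨c, hc, ContinuousLinearMap.ext fun w => LinearMap.congr_fun heq w⟩

theorem exists_isInwardNormal {x : Q} (hx : x ∈ frontier B.obstacle) :
    ∃ ν, B.IsInwardNormal x ν := by
  obtain ⟨U, f, h⟩ := B.smooth_boundary x hx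
  obtain ⟨e, he⟩ := exists_equiv_of_forall_pos (B.metric.form x) (fun v hv => B.metric.pos x v hv)
  set a := e.symm (dform (n := n) f x) with ha
  have ha' : ∀ w, B.metric.form x a w = dform (n := n) f x w := fun w => by rw [← he, ha]; simp
  have ha0 : a ≠ 0 := fun h0 => h.mfderiv_ne_zero ((e.symm.map_eq_zero_iff).1 (ha ▸ h0))
  have hpos : 0 < B.metric.form x a a := B.metric.pos x a ha0
  -- `a` is the gradient of `f` and `c` its length, so that `c⁻¹ • a` is a unit vector and `df = c
  -- g(c⁻¹ a, ·)`.
  set c := Real.sqrt (B.metric.form x a a) with hc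
  have hc0 : 0 < c := Real.sqrt_pos.2 hpos
  have hcc : c * c = B.metric.form x a a := Real.mul_self_sqrt hpos.le
  refine ⟨(c⁻¹ • a : EuclideanSpace ℝ (Fin n)), ?_, U, f, h, c, hc0,
    fun (w : EuclideanSpace ℝ (Fin n)) => ?_⟩
  · change B.metric.form x (c⁻¹ • a) (c⁻¹ • a) = 1
    simp only [map_smul, smul_apply, smul_eq_mul, ← hcc]
    field_simp
  · change dform (n := n) f x w = c * B.metric.form x (c⁻¹ • a) w
    have hs : B.metric.form x (c⁻¹ • a) w = c⁻¹ * B.metric.form x a w := by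
      rw [map_smul]; rfl
    exact (by rw [hs, ha', mul_inv_cancel_left₀ hc0.ne'])

theorem isInwardNormal_normal {x : Q} (hx : x ∈ frontier B.obstacle) :
    B.IsInwardNormal x (B.normal x) := by
  have h := B.exists_isInwardNormal hx
  rw [normal, dif_pos h]
  exact h.choose_spec

theorem normal_unit {x : Q} (hx : x ∈ frontier B.obstacle) :
    B.metric.form x (B.normal x) (B.normal x) = 1 := (B.isInwardNormal_normal hx).1

theorem exists_dform_eq_normal {x : Q} (hx : x ∈ frontier B.obstacle) {U : Set Q} {f : Q → ℝ}
    (h : IsDefiningFunction (n := n) B.obstacle x U f) :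
    ∃ c : ℝ, 0 < c ∧ ∀ w, dform (n := n) f x w = c * B.metric.form x (B.normal x) w := by
  obtain ⟨-, U', f', h', c', hc', heq⟩ := B.isInwardNormal_normal hx
  obtain ⟨c, hc, hcc⟩ := B.exists_dform_eq_smul hx h h'
  refine ⟨c * c', mul_pos hc hc', fun w => ?_⟩
  rw [hcc, mul_assoc]
  exact congrArg (c * ·) (heq w)

end BilliardSystem

end Differential

/-! ### The reflection and transversality at the boundary. -/

section Reflection

section Bilinear

variable {V : Type*} [NormedAddCommGroup V] [NormedSpace ℝ V] (b : V →L[ℝ] V →L[ℝ] ℝ) {ν : V}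

theorem bilin_reflect_normal (hν : b ν ν = 1) (v : V) :
    b (v - (2 * b v ν) • ν) ν = -b v ν := by
  simp only [map_sub, map_smul, sub_apply, smul_apply, hν, smul_eq_mul]
  ring

theorem bilin_reflect_self (hb : ∀ v w, b v w = b w v) (hν : b ν ν = 1) (v : V) :
    b (v - (2 * b v ν) • ν) (v - (2 * b v ν) • ν) = b v v := by
  simp only [map_sub, map_smul, sub_apply, smul_apply, hν, smul_eq_mul, hb ν v]
  ring

theorem bilin_reflect_reflect (hν : b ν ν = 1) (v : V) :
    (v - (2 * b v ν) • ν) - (2 * b (v - (2 * b v ν) • ν) ν) • ν = v := by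
  rw [bilin_reflect_normal b hν]
  module

end Bilinear

variable {n : ℕ} {Q : Type*} [TopologicalSpace Q] [ChartedSpace (EuclideanSpace ℝ (Fin n)) Q]
  [IsManifold (𝓡 n) ∞ Q] [T2Space Q] (B : BilliardSystem n Q)

theorem continuous_tangentBundle_proj : Continuous (fun p : TangentBundle (𝓡 n) Q => p.1) :=
  FiberBundle.continuous_proj (EuclideanSpace ℝ (Fin n)) (TangentSpace (𝓡 n))

namespace BilliardSystem

theorem form_symm (x : Q) (v w : EuclideanSpace ℝ (Fin n)) :
    B.metric.form x v w = B.metric.form x w v := B.metric.symm x v w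

theorem normalComp_reflect {p : TangentBundle (𝓡 n) Q} (hp : p.1 ∈ frontier B.obstacle) :
    B.normalComp (B.reflect p) = -B.normalComp p :=
  bilin_reflect_normal (B.metric.form p.1) (B.normal_unit hp) p.2

theorem normSq_reflect {p : TangentBundle (𝓡 n) Q} (hp : p.1 ∈ frontier B.obstacle) :
    normSq B.metric (B.reflect p) = normSq B.metric p :=
  bilin_reflect_self (B.metric.form p.1) (B.form_symm p.1) (B.normal_unit hp) p.2

theorem reflect_reflect {p : TangentBundle (𝓡 n) Q} (hp : p.1 ∈ frontier B.obstacle) :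
    B.reflect (B.reflect p) = p :=
  congrArg (fun v : EuclideanSpace ℝ (Fin n) => (⟨p.1, v⟩ : TangentBundle (𝓡 n) Q))
    (bilin_reflect_reflect (B.metric.form p.1) (B.normal_unit hp) p.2)

/-- Near a boundary point, whether a geodesic starting at the boundary is inside the obstacle is
determined by the normal component of its initial vector. -/
theorem exists_transversal {ℓ : TangentBundle (𝓡 n) Q} (hℓ : ℓ.1 ∈ frontier B.obstacle)
    (hn : B.normalComp ℓ ≠ 0) : ∃ c > (0 : ℝ), ∀ᶠ a in 𝓝 ℓ, a.1 ∈ frontier B.obstacle →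
      ∀ s : ℝ, s ≠ 0 → |s| < c →
        ((geodesicFlow B.metric s a).1 ∈ B.obstacle ↔ 0 < s * B.normalComp ℓ) := by
  obtain ⟨U, f, hf⟩ := B.smooth_boundary ℓ.1 hℓ
  obtain ⟨c, hc, hcf⟩ := B.exists_dform_eq_normal hℓ hf
  have hdℓ : dform (n := n) f ℓ.1 ℓ.2 = c * B.normalComp ℓ := by
    exact (hcf ℓ.2).trans (congrArg (c * ·) (B.form_symm ℓ.1 _ _))
  have hUo : IsOpen ((fun p : TangentBundle (𝓡 n) Q => p.1) ⁻¹' U) :=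
    hf.isOpen.preimage continuous_tangentBundle_proj
  have hcont : ContinuousAt (fun p : TangentBundle (𝓡 n) Q =>
      dform (n := n) f p.1 p.2 * B.normalComp ℓ) ℓ :=
    ((continuousOn_dform hf.isOpen hf.contMDiffOn).continuousAt (hUo.mem_nhds hf.mem)).mul
      continuousAt_const
  have hpos : 0 < dform (n := n) f ℓ.1 ℓ.2 * B.normalComp ℓ := by
    rw [hdℓ, mul_assoc]
    exact mul_pos hc (mul_self_pos.2 hn)
  have hevU : ∀ᶠ p in 𝓝 ℓ, p.1 ∈ U := hUo.mem_nhds hf.mem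
  have hev := hevU.and (hcont.eventually (lt_mem_nhds hpos))
  -- Joint continuity in time and initial vector makes the time bound uniform over all `a` near `ℓ`.
  have hev2 := (continuousAt_geodesicFlow_zero B.complete ℓ).eventually hev
  obtain ⟨I, hI, N, hN, hIN⟩ := mem_nhds_prod_iff.1 hev2
  obtain ⟨δ, hδ, hδI⟩ := Metric.mem_nhds_iff.1 hI
  refine ⟨δ, hδ, ?_⟩
  filter_upwards [hN, hUo.mem_nhds hf.mem] with a haN haU ha s hs0 hsδ
  have hloc : ∀ r ∈ Metric.ball (0 : ℝ) δ, (geodesicFlow B.metric r a).1 ∈ U ∧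
      0 < dform (n := n) f (geodesicFlow B.metric r a).1 (geodesicFlow B.metric r a).2 *
        B.normalComp ℓ := fun r hr => hIN (mk_mem_prod (hδI hr) haN)
  have hd : ∀ r ∈ Metric.ball (0 : ℝ) δ,
      HasDerivAt (fun r => f (geodesicFlow B.metric r a).1 * B.normalComp ℓ)
        (dform (n := n) f (geodesicFlow B.metric r a).1 (geodesicFlow B.metric r a).2 *
          B.normalComp ℓ) r := fun r hr =>
    (hasDerivAt_comp_geodesicFlow B.complete a
      ((hf.contMDiffAt (hloc r hr).1).mdifferentiableAt (by simp))).mul_const _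
  -- The factor `normalComp ℓ` treats arriving and departing vectors at once: the product increases
  -- through `0` at time `0`, so the sign of `f` is that of time multiplied by `normalComp ℓ`.
  have hmono : StrictMonoOn (fun r => f (geodesicFlow B.metric r a).1 * B.normalComp ℓ)
      (Metric.ball (0 : ℝ) δ) :=
    strictMonoOn_of_deriv_pos (convex_ball _ _)
      (fun r hr => (hd r hr).continuousAt.continuousWithinAt) fun r hr => by
        rw [(hd r (interior_subset hr)).deriv]
        exact (hloc r (interior_subset hr)).2
  have h0 : f (geodesicFlow B.metric 0 a).1 * B.normalComp ℓ = 0 := by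
    rw [geodesicFlow_zero B.complete, hf.eq_zero B.isClosed_obstacle haU ha, zero_mul]
  have hsb : s ∈ Metric.ball (0 : ℝ) δ := by simpa using hsδ
  have h0b : (0 : ℝ) ∈ Metric.ball (0 : ℝ) δ := Metric.mem_ball_self hδ
  rw [hf.mem_iff _ (hloc s hsb).1]
  rcases lt_or_gt_of_ne hs0 with h | h
  · have h1 := hmono hsb h0b h
    simp only [h0] at h1
    rcases lt_or_gt_of_ne hn with h2 | h2
    · exact iff_of_true (pos_of_mul_neg_left h1 h2.le).le (mul_pos_of_neg_of_neg h h2)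
    · exact iff_of_false (not_le.2 (neg_of_mul_neg_left h1 h2.le)) (by nlinarith)
  · have h1 := hmono h0b hsb h
    simp only [h0] at h1
    rcases lt_or_gt_of_ne hn with h2 | h2
    · exact iff_of_false (not_le.2 (neg_of_mul_pos_left h1 h2.le)) (by nlinarith)
    · exact iff_of_true (pos_of_mul_pos_left h1 h2.le).le (mul_pos h h2)

end BilliardSystem

end Reflection

/-! ### Continuity of the reflection. -/

section ReflectionContinuity

/-- The reflection formula is homogeneous of degree zero in the normal, so the gradient `α` of a
defining function may replace the unit normal. In this form no chosen normal occurs, and the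
continuity of the reflection becomes visible. The map `D` stands for the differential of an inverse
chart. -/
theorem reflect_eq_of_coordinates {V : Type*} [NormedAddCommGroup V] [NormedSpace ℝ V]
    (b : V →L[ℝ] V →L[ℝ] ℝ) (hsymm : ∀ v w, b v w = b w v) (hb : ∀ v, v ≠ 0 → 0 < b v v)
    {D : V →L[ℝ] V} (hD : Function.Surjective D) {ν : V} (hν : b ν ν = 1) {φ : V →L[ℝ] ℝ} {c : ℝ}
    (hc : 0 < c) (hφ : ∀ w, φ w = c * b ν w) {α : V} (hα : ∀ w, b (D α) (D w) = φ (D w)) (v : V) :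
    D (v - (2 * φ (D v) / φ (D α)) • α) = D v - (2 * b (D v) ν) • ν := by
  have h1 : D α = c • ν := by
    rw [← sub_eq_zero]
    by_contra h
    have h2 := hb _ h
    obtain ⟨w, hw⟩ := hD (D α - c • ν)
    have h3 : b (D α - c • ν) (D w) = 0 := by
      simp only [map_sub, map_smul, sub_apply, smul_apply, hα, hφ, smul_eq_mul, sub_self]
    rw [hw] at h3
    exact h2.ne' h3
  have h2 : φ (D α) = c * c := by
    rw [h1, hφ, map_smul, hν, smul_eq_mul, mul_one]
  rw [map_sub, map_smul, h1, smul_smul, ← h1, h2, hφ, hsymm (D v) ν]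
  congr 2
  field_simp

variable {n : ℕ} {Q : Type*} [TopologicalSpace Q] [ChartedSpace (EuclideanSpace ℝ (Fin n)) Q]
  [IsManifold (𝓡 n) ∞ Q] [T2Space Q] (B : BilliardSystem n Q)

theorem extChartAt_tangent_mk (ℓ : TangentBundle (𝓡 n) Q)
    {y : EuclideanSpace ℝ (Fin n)} (hy : y ∈ (extChartAt (𝓡 n) ℓ.1).target)
    (v : EuclideanSpace ℝ (Fin n)) :
    extChartAt (𝓡 n).tangent ℓ ⟨(extChartAt (𝓡 n) ℓ.1).symm y, chartSymmDeriv ℓ.1 y v⟩ =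
      (y, v) := by
  rw [extChartAt_tangent_apply ℓ _ ((extChartAt (𝓡 n) ℓ.1).map_target hy)]
  refine Prod.ext ((extChartAt (𝓡 n) ℓ.1).right_inv hy) ?_
  have h := mfderiv_extChartAt_comp_mfderivWithin_extChartAt_symm (I := 𝓡 n) hy
  rw [ModelWithCorners.range_eq_univ, mfderivWithin_univ] at h
  exact congrArg (fun L => L v) h

theorem extChartAt_tangent_symm_apply (ℓ : TangentBundle (𝓡 n) Q)
    {y : EuclideanSpace ℝ (Fin n)} (hy : y ∈ (extChartAt (𝓡 n) ℓ.1).target)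
    (v : EuclideanSpace ℝ (Fin n)) :
    (extChartAt (𝓡 n).tangent ℓ).symm (y, v) =
      ⟨(extChartAt (𝓡 n) ℓ.1).symm y, chartSymmDeriv ℓ.1 y v⟩ := by
  rw [← extChartAt_tangent_mk ℓ hy, (extChartAt (𝓡 n).tangent ℓ).left_inv
    ((mem_extChartAt_tangent_source ℓ _).2 ((extChartAt (𝓡 n) ℓ.1).map_target hy))]

theorem mem_extChartAt_tangent_target (ℓ : TangentBundle (𝓡 n) Q)
    {y : EuclideanSpace ℝ (Fin n)} (hy : y ∈ (extChartAt (𝓡 n) ℓ.1).target)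
    (v : EuclideanSpace ℝ (Fin n)) : (y, v) ∈ (extChartAt (𝓡 n).tangent ℓ).target := by
  rw [← extChartAt_tangent_mk ℓ hy]
  exact (extChartAt (𝓡 n).tangent ℓ).map_source
    ((mem_extChartAt_tangent_source ℓ _).2 ((extChartAt (𝓡 n) ℓ.1).map_target hy))

theorem chartSymmDeriv_surjective (x₀ : Q) {y : EuclideanSpace ℝ (Fin n)}
    (hy : y ∈ (extChartAt (𝓡 n) x₀).target) : Function.Surjective (chartSymmDeriv x₀ y) :=
  LinearMap.surjective_of_injective (f := (chartSymmDeriv x₀ y).toLinearMap)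
    (mfderiv_extChartAt_symm_injective x₀ hy)

theorem fderiv_comp_extChartAt_symm {f : Q → ℝ} (x₀ : Q) {y : EuclideanSpace ℝ (Fin n)}
    (hy : y ∈ (extChartAt (𝓡 n) x₀).target)
    (hf : MDifferentiableAt (𝓡 n) 𝓘(ℝ, ℝ) f ((extChartAt (𝓡 n) x₀).symm y))
    (v : EuclideanSpace ℝ (Fin n)) :
    fderiv ℝ (f ∘ (extChartAt (𝓡 n) x₀).symm) y v =
      dform (n := n) f ((extChartAt (𝓡 n) x₀).symm y) (chartSymmDeriv x₀ y v) := by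
  have h1 : MDifferentiableAt 𝓘(ℝ, EuclideanSpace ℝ (Fin n)) (𝓡 n) (extChartAt (𝓡 n) x₀).symm y :=
    ((contMDiffOn_extChartAt_symm (n := 1) x₀).contMDiffAt
      ((isOpen_extChartAt_target x₀).mem_nhds hy)).mdifferentiableAt (by simp)
  have h2 := mfderiv_comp y hf h1
  rw [← mfderiv_eq_fderiv]
  exact congrArg (fun L => L v) h2

namespace BilliardSystem

/-- The reflection is continuous on the boundary. -/
theorem continuousWithinAt_reflect {ℓ : TangentBundle (𝓡 n) Q} (hℓ : ℓ.1 ∈ frontier B.obstacle) :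
    ContinuousWithinAt B.reflect {p | p.1 ∈ frontier B.obstacle} ℓ := by
  obtain ⟨U, f, hf⟩ := B.smooth_boundary ℓ.1 hℓ
  set e := extChartAt (𝓡 n) ℓ.1 with he
  set Ψ := extChartAt (𝓡 n).tangent ℓ with hΨ
  set G := B.metric.chartForm ℓ.1 with hG
  set η : EuclideanSpace ℝ (Fin n) → EuclideanSpace ℝ (Fin n) →L[ℝ] ℝ :=
    fderiv ℝ (f ∘ e.symm) with hη
  set α : EuclideanSpace ℝ (Fin n) → EuclideanSpace ℝ (Fin n) := fun y => (G y).inverse (η y) with hα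
  -- The coordinate reflection in the gradient of `f`. It makes sense also off the boundary, so its
  -- continuity can be discussed on open sets.
  set R : EuclideanSpace ℝ (Fin n) × EuclideanSpace ℝ (Fin n) →
      EuclideanSpace ℝ (Fin n) × EuclideanSpace ℝ (Fin n) :=
    fun z => (z.1, z.2 - (2 * η z.1 z.2 / η z.1 (α z.1)) • α z.1) with hR
  have hsrc : ∀ᶠ p in 𝓝 ℓ, p ∈ Ψ.source :=
    (isOpen_extChartAt_source ℓ).mem_nhds (mem_extChartAt_source ℓ)
  have hUo : IsOpen ((fun p : TangentBundle (𝓡 n) Q => p.1) ⁻¹' U) :=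
    hf.isOpen.preimage continuous_tangentBundle_proj
  have hd0 : ∃ w, dform (n := n) f ℓ.1 w ≠ 0 := by
    by_contra! h
    exact hf.mfderiv_ne_zero (ContinuousLinearMap.ext h)
  have hℓs : ℓ.1 ∈ e.source := mem_extChartAt_source ℓ.1
  have hℓt : e ℓ.1 ∈ e.target := e.map_source hℓs
  have heo : IsOpen e.target := isOpen_extChartAt_target ℓ.1
  have hηα : ∀ y ∈ e.target, G y (α y) = η y := fun y hy =>
    B.metric.chartForm_inverse_apply ℓ.1 hy (η y)
  have hηf : ∀ y ∈ e.target, e.symm y ∈ U → ∀ v,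
      η y v = dform (n := n) f (e.symm y) (chartSymmDeriv ℓ.1 y v) := fun y hy hyU v =>
    fderiv_comp_extChartAt_symm ℓ.1 hy ((hf.contMDiffAt hyU).mdifferentiableAt (by simp)) v
  have hOo : IsOpen (e.target ∩ e.symm ⁻¹' U) :=
    (continuousOn_extChartAt_symm (I := 𝓡 n) ℓ.1).isOpen_inter_preimage heo hf.isOpen
  have hOℓ : e ℓ.1 ∈ e.target ∩ e.symm ⁻¹' U :=
    ⟨hℓt, by rw [mem_preimage, e.left_inv hℓs]; exact hf.mem⟩
  have hηc : ContinuousAt η (e ℓ.1) := by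
    have h1 : ContDiffOn ℝ ∞ (f ∘ e.symm) (e.target ∩ e.symm ⁻¹' U) := by
      rw [← contMDiffOn_iff_contDiffOn]
      exact hf.contMDiffOn.comp ((contMDiffOn_extChartAt_symm (I := 𝓡 n) ℓ.1).mono
        inter_subset_left) fun y hy => hy.2
    exact (h1.continuousOn_fderiv_of_isOpen hOo (by simp)).continuousAt (hOo.mem_nhds hOℓ)
  have hη0 : η (e ℓ.1) ≠ 0 := fun h => by
    obtain ⟨w, hw⟩ := hd0
    obtain ⟨v, hv⟩ := chartSymmDeriv_surjective ℓ.1 hℓt w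
    refine hw ?_
    have h2 := hηf _ hOℓ.1 hOℓ.2 v
    rw [hv, h, e.left_inv hℓs] at h2
    exact h2.symm
  have hαc : ContinuousAt α (e ℓ.1) :=
    ((B.metric.contDiffOn_inverse_chartForm ℓ.1).continuousOn.continuousAt
      (heo.mem_nhds hℓt)).clm_apply hηc
  have hΨ1 : ∀ p ∈ Ψ.source, (Ψ p).1 = e p.1 := fun p hp => by
    rw [hΨ, extChartAt_tangent_apply ℓ p ((mem_extChartAt_tangent_source ℓ p).1 hp)]
  have hΨc : ContinuousAt Ψ ℓ := continuousAt_extChartAt ℓ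
  have hΨℓ : (Ψ ℓ).1 = e ℓ.1 := hΨ1 ℓ (mem_extChartAt_source ℓ)
  have hΨ1c : Tendsto (fun p => (Ψ p).1) (𝓝 ℓ) (𝓝 (e ℓ.1)) := by
    rw [← hΨℓ]; exact continuous_fst.continuousAt.comp hΨc
  have hev : ∀ᶠ p in 𝓝 ℓ, p.1 ∈ frontier B.obstacle → B.reflect p = Ψ.symm (R (Ψ p)) := by
    filter_upwards [hsrc, hΨ1c.eventually (hOo.mem_nhds hOℓ),
      hΨ1c.eventually (hηc.eventually_ne hη0)] with p hps hpO hpη hpf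
    obtain ⟨y, v, hyv⟩ : ∃ y v, Ψ p = (y, v) := ⟨_, _, rfl⟩
    simp only [hyv] at hpO hpη ⊢
    have hp : p = ⟨e.symm y, chartSymmDeriv ℓ.1 y v⟩ := by
      rw [← extChartAt_tangent_symm_apply ℓ hpO.1, ← hΨ, ← hyv, Ψ.left_inv hps]
    have hx : e.symm y ∈ frontier B.obstacle := by
      have h : p.1 = e.symm y := congrArg (fun q => q.1) hp
      rw [← h]; exact hpf
    -- Since `df` does not vanish near `ℓ.1`, the same `f` is a defining function at all nearby
    -- boundary points and is proportional to the normal there.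
    have hdx : dform (n := n) f (e.symm y) ≠ 0 := fun h => hpη <| ContinuousLinearMap.ext fun v => by
      rw [hηf y hpO.1 hpO.2, h]; rfl
    obtain ⟨c, hc, hcf⟩ := B.exists_dform_eq_normal hx (hf.of_mem hpO.2 hdx)
    have key := reflect_eq_of_coordinates (B.metric.form (e.symm y)) (B.form_symm _)
      (fun v hv => B.metric.pos _ v hv) (chartSymmDeriv_surjective ℓ.1 hpO.1) (B.normal_unit hx)
      hc hcf (α := α y) (fun w => by
        rw [← hηf y hpO.1 hpO.2, ← hηα y hpO.1]; rfl) v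
    rw [← hηf y hpO.1 hpO.2, ← hηf y hpO.1 hpO.2] at key
    have h1 : Ψ.symm (R (y, v)) = _ := extChartAt_tangent_symm_apply ℓ hpO.1 _
    rw [h1, hp]
    exact congrArg (fun v : EuclideanSpace ℝ (Fin n) =>
      (⟨e.symm y, v⟩ : TangentBundle (𝓡 n) Q)) key.symm
  have hRc : ContinuousAt R (Ψ ℓ) := by
    have h1 : ContinuousAt (fun z : EuclideanSpace ℝ (Fin n) × EuclideanSpace ℝ (Fin n) => η z.1)
        (Ψ ℓ) := ContinuousAt.comp (g := η) (by rw [hΨℓ]; exact hηc) continuousAt_fst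
    have h2 : ContinuousAt (fun z : EuclideanSpace ℝ (Fin n) × EuclideanSpace ℝ (Fin n) => α z.1)
        (Ψ ℓ) := ContinuousAt.comp (g := α) (by rw [hΨℓ]; exact hαc) continuousAt_fst
    -- The denominator is the squared length of the gradient.
    have h3 : η (Ψ ℓ).1 (α (Ψ ℓ).1) ≠ 0 := by
      rw [hΨℓ, ← hηα _ hℓt]
      refine (B.metric.chartForm_pos ℓ.1 hℓt fun h => hη0 ?_).ne'
      rw [← hηα _ hℓt, h, map_zero]
    exact continuousAt_fst.prodMk (continuousAt_snd.sub
      (((continuousAt_const.mul (h1.clm_apply continuousAt_snd)).div (h1.clm_apply h2) h3).smul h2))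
  have hRt : R (Ψ ℓ) ∈ Ψ.target := by
    exact mem_extChartAt_tangent_target ℓ (by rw [hΨℓ]; exact hℓt) _
  have hcont : ContinuousAt (fun p => Ψ.symm (R (Ψ p))) ℓ :=
    ContinuousAt.comp (f := fun p => R (Ψ p)) (continuousAt_extChartAt_symm'' hRt)
      (ContinuousAt.comp (f := Ψ) hRc hΨc)
  refine hcont.continuousWithinAt.congr_of_eventuallyEq ?_ (hev.self_of_nhds hℓ)
  filter_upwards [mem_nhdsWithin_of_mem_nhds hev, self_mem_nhdsWithin] with p hp hpf using hp hpf

end BilliardSystem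

end ReflectionContinuity

/-! ### Single flights of the billiard: launch, hitting time and hitting point. -/

section BilliardTrajectories

variable {n : ℕ} {Q : Type*} [TopologicalSpace Q] [ChartedSpace (EuclideanSpace ℝ (Fin n)) Q]
  [IsManifold (𝓡 n) ∞ Q] [T2Space Q] (B : BilliardSystem n Q)

namespace BilliardSystem

/-- The geodesic flow of the billiard table. -/
abbrev geod (t : ℝ) (p : TangentBundle (𝓡 n) Q) : TangentBundle (𝓡 n) Q :=
  geodesicFlow B.metric t p

theorem geod_zero (p : TangentBundle (𝓡 n) Q) : B.geod 0 p = p := geodesicFlow_zero B.complete p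

theorem geod_add (s t : ℝ) (p : TangentBundle (𝓡 n) Q) :
    B.geod s (B.geod t p) = B.geod (s + t) p := geodesicFlow_add B.complete s t p

theorem geod_mem_unitBundle {t : ℝ} {p : TangentBundle (𝓡 n) Q} :
    B.geod t p ∈ unitBundle B.metric ↔ p ∈ unitBundle B.metric := by
  simp only [unitBundle, mem_ofPred_eq, normSq_geodesicFlow B.complete]

theorem continuous_geod_fst (p : TangentBundle (𝓡 n) Q) : Continuous fun t => (B.geod t p).1 :=
  continuous_tangentBundle_proj.comp (continuous_geodesicFlow_left B.complete p)

theorem mem_phaseBdry_of_not_mem_phaseInt {p : TangentBundle (𝓡 n) Q} (hp : p ∈ B.nonGrazing)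
    (h : p ∉ B.phaseInt) : p ∈ B.phaseBdry := by
  refine ⟨hp.1.1, ?_⟩
  rw [B.isClosed_obstacle.frontier_eq]
  exact ⟨by_contra fun h' => h ⟨hp.1.1, h'⟩, hp.1.2⟩

theorem phaseInt_subset_nonGrazing : B.phaseInt ⊆ B.nonGrazing := fun _ hp =>
  ⟨⟨hp.1, fun h => hp.2 (interior_subset h)⟩,
    fun h => hp.2 (B.isClosed_obstacle.frontier_subset h.1.2)⟩

theorem phaseBdry_diff_subset_nonGrazing : B.phaseBdry \ B.grazing ⊆ B.nonGrazing := fun _ hp =>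
  ⟨⟨hp.1.1, fun h => hp.1.2.2 h⟩, hp.2⟩

theorem mem_nonGrazing_iff {p : TangentBundle (𝓡 n) Q} :
    p ∈ B.nonGrazing ↔ p ∈ B.phaseInt ∨ p ∈ B.phaseBdry \ B.grazing := by
  refine ⟨fun h => ?_, ?_⟩
  · by_cases h' : p ∈ B.phaseInt
    · exact Or.inl h'
    · exact Or.inr ⟨B.mem_phaseBdry_of_not_mem_phaseInt h h', h.2⟩
  · rintro (h | h)
    · exact B.phaseInt_subset_nonGrazing h
    · exact B.phaseBdry_diff_subset_nonGrazing h

theorem normalComp_ne_zero {p : TangentBundle (𝓡 n) Q} (hp : p ∈ B.phaseBdry \ B.grazing) :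
    B.normalComp p ≠ 0 := fun h => hp.2 ⟨hp.1, h⟩

theorem mem_obstacle_of_mem_phaseBdry {p : TangentBundle (𝓡 n) Q} (hp : p ∈ B.phaseBdry) :
    p.1 ∈ B.obstacle := B.isClosed_obstacle.frontier_subset hp.2

theorem not_mem_phaseBdry_of_mem_phaseInt {p : TangentBundle (𝓡 n) Q} (hp : p ∈ B.phaseInt) :
    p ∉ B.phaseBdry := fun h => hp.2 (B.mem_obstacle_of_mem_phaseBdry h)

theorem reflect_mem_phaseBdry {p : TangentBundle (𝓡 n) Q} (hp : p ∈ B.phaseBdry) :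
    B.reflect p ∈ B.phaseBdry :=
  ⟨(B.normSq_reflect hp.2).trans hp.1, hp.2⟩

theorem reflect_mem {p : TangentBundle (𝓡 n) Q} (hp : p ∈ B.phaseBdry \ B.grazing) :
    B.reflect p ∈ B.phaseBdry \ B.grazing := by
  refine ⟨B.reflect_mem_phaseBdry hp.1, fun h => B.normalComp_ne_zero hp ?_⟩
  have := h.2
  rwa [B.normalComp_reflect hp.1.2, neg_eq_zero] at this

theorem launch_of_mem_phaseInt (σ : ℝ) {p : TangentBundle (𝓡 n) Q} (hp : p ∈ B.phaseInt) :
    B.launch σ p = p :=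
  if_neg fun h => B.not_mem_phaseBdry_of_mem_phaseInt hp h.1

theorem launch_of_pos {σ : ℝ} {p : TangentBundle (𝓡 n) Q} (hp : p ∈ B.phaseBdry)
    (h : 0 < σ * B.normalComp p) : B.launch σ p = B.reflect p := if_pos ⟨hp, h⟩

theorem launch_of_nonpos {σ : ℝ} {p : TangentBundle (𝓡 n) Q}
    (h : σ * B.normalComp p ≤ 0) : B.launch σ p = p := if_neg fun h' => h.not_gt h'.2

theorem launch_eq_or (σ : ℝ) (p : TangentBundle (𝓡 n) Q) :
    B.launch σ p = p ∨ B.launch σ p = B.reflect p := by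
  unfold launch; split_ifs <;> simp

theorem launch_fst (σ : ℝ) (p : TangentBundle (𝓡 n) Q) : (B.launch σ p).1 = p.1 := by
  rcases B.launch_eq_or σ p with h | h <;> rw [h]
  rfl

theorem launch_mem_phaseBdry (σ : ℝ) {p : TangentBundle (𝓡 n) Q}
    (hp : p ∈ B.phaseBdry \ B.grazing) : B.launch σ p ∈ B.phaseBdry \ B.grazing := by
  rcases B.launch_eq_or σ p with h | h <;> rw [h]
  exacts [hp, B.reflect_mem hp]

theorem launch_mem_nonGrazing (σ : ℝ) {p : TangentBundle (𝓡 n) Q} (hp : p ∈ B.nonGrazing) :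
    B.launch σ p ∈ B.nonGrazing := by
  rcases B.mem_nonGrazing_iff.1 hp with h | h
  · rwa [B.launch_of_mem_phaseInt σ h]
  · exact B.phaseBdry_diff_subset_nonGrazing (B.launch_mem_phaseBdry σ h)

/-- The launch reflects exactly those vectors that point into the obstacle in the time direction
`σ`; what it returns always points away. -/
theorem launch_normalComp_neg {σ : ℝ} (hσ : |σ| = 1) {p : TangentBundle (𝓡 n) Q}
    (hp : p ∈ B.phaseBdry \ B.grazing) : σ * B.normalComp (B.launch σ p) < 0 := by
  have hσ0 : σ ≠ 0 := fun h => by simp [h] at hσ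
  rcases lt_or_ge 0 (σ * B.normalComp p) with h | h
  · rw [B.launch_of_pos hp.1 h, B.normalComp_reflect hp.1.2]
    linarith
  · rw [B.launch_of_nonpos h]
    exact lt_of_le_of_ne h (mul_ne_zero hσ0 (B.normalComp_ne_zero hp))

/-- If `launch σ` has reflected, `launch (-σ)` undoes it. Hence a trajectory run back to the
collision it started from continues like that of `p` itself. -/
theorem launch_launch_neg {σ : ℝ} {p : TangentBundle (𝓡 n) Q}
    (hp : p ∈ B.nonGrazing) : B.launch (-σ) (B.launch σ p) = B.launch (-σ) p := by
  rcases B.mem_nonGrazing_iff.1 hp with h | h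
  · rw [B.launch_of_mem_phaseInt σ h]
  rcases lt_or_ge 0 (σ * B.normalComp p) with h' | h'
  · rw [B.launch_of_pos h.1 h', B.launch_of_pos (B.reflect_mem_phaseBdry h.1),
      B.reflect_reflect h.1.2, B.launch_of_nonpos (by linarith)]
    rw [B.normalComp_reflect h.1.2]
    linarith
  · rw [B.launch_of_nonpos h']

theorem launch_of_arrival {σ : ℝ} {p : TangentBundle (𝓡 n) Q} (h : 0 < σ * B.normalComp p) :
    B.launch (-σ) p = p := B.launch_of_nonpos (by linarith)

/-- Immediately after the launch the trajectory is off the obstacles. -/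
theorem exists_free {σ : ℝ} (hσ : |σ| = 1) {p : TangentBundle (𝓡 n) Q} (hp : p ∈ B.nonGrazing) :
    ∃ c > (0 : ℝ), ∀ s, 0 < s → s < c → (B.geod (σ * s) (B.launch σ p)).1 ∉ B.obstacle := by
  rcases B.mem_nonGrazing_iff.1 hp with h | h
  · rw [B.launch_of_mem_phaseInt σ h]
    have h1 : Tendsto (fun s : ℝ => (B.geod (σ * s) p).1) (𝓝 0) (𝓝 p.1) := by
      have := ((B.continuous_geod_fst p).comp (continuous_const_mul σ)).tendsto 0
      simpa only [Function.comp_def, mul_zero, B.geod_zero] using this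
    have h2 := h1.eventually (B.isClosed_obstacle.isOpen_compl.mem_nhds h.2)
    obtain ⟨c, hc, hc'⟩ := Metric.eventually_nhds_iff.1 h2
    exact ⟨c, hc, fun s h0 hs => hc' (by rwa [Real.dist_0_eq_abs, abs_of_pos h0])⟩
  · have hL := B.launch_mem_phaseBdry σ h
    obtain ⟨c, hc, hc'⟩ := B.exists_transversal hL.1.2 (B.normalComp_ne_zero hL)
    refine ⟨c, hc, fun s h0 hs hmem => ?_⟩
    have h1 := (hc'.self_of_nhds hL.1.2 (σ * s)
      (mul_ne_zero (fun h => by simp [h] at hσ) h0.ne')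
      (by rwa [abs_mul, hσ, one_mul, abs_of_pos h0])).1 hmem
    have h2 := B.launch_normalComp_neg hσ h
    nlinarith

theorem hitTime_eq_top {σ : ℝ} {p : TangentBundle (𝓡 n) Q}
    (h : ∀ s, 0 < s → (B.geod (σ * s) (B.launch σ p)).1 ∉ B.obstacle) : B.hitTime σ p = ⊤ := by
  have h0 : {T : EReal | ∃ s : ℝ, 0 < s ∧ T = (s : EReal) ∧
      (geodesicFlow B.metric (σ * s) (B.launch σ p)).1 ∈ B.obstacle} = ∅ :=
    eq_empty_iff_forall_notMem.2 fun T ⟨s, hs, _, h'⟩ => h s hs h'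
  rw [hitTime, h0, sInf_empty]

theorem hitTime_eq_coe {σ T : ℝ} {p : TangentBundle (𝓡 n) Q} (hT : 0 < T)
    (hit : (B.geod (σ * T) (B.launch σ p)).1 ∈ B.obstacle)
    (h : ∀ s, 0 < s → s < T → (B.geod (σ * s) (B.launch σ p)).1 ∉ B.obstacle) :
    B.hitTime σ p = T := by
  refine le_antisymm (sInf_le ⟨T, hT, rfl, hit⟩) (le_sInf ?_)
  rintro _ ⟨s, hs, rfl, h'⟩
  exact EReal.coe_le_coe_iff.2 (not_lt.1 fun hlt => h s hs hlt h')

theorem not_mem_obstacle_of_lt_hitTime {σ s : ℝ} {p : TangentBundle (𝓡 n) Q} (hs : 0 < s)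
    (h : (s : EReal) < B.hitTime σ p) : (B.geod (σ * s) (B.launch σ p)).1 ∉ B.obstacle :=
  fun h' => h.not_ge (sInf_le ⟨s, hs, rfl, h'⟩)

/-- The infimum is attained at a positive time: hits stay away from time `0` by `exists_free`, and
the obstacle set is closed. -/
theorem hitTime_cases {σ : ℝ} (hσ : |σ| = 1) {p : TangentBundle (𝓡 n) Q} (hp : p ∈ B.nonGrazing) :
    B.hitTime σ p = ⊤ ∨ ∃ T : ℝ, 0 < T ∧ B.hitTime σ p = T ∧
      (B.geod (σ * T) (B.launch σ p)).1 ∈ B.obstacle := by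
  by_cases h : ∀ s, 0 < s → (B.geod (σ * s) (B.launch σ p)).1 ∉ B.obstacle
  · exact Or.inl (B.hitTime_eq_top h)
  push Not at h
  obtain ⟨s, hs, hs'⟩ := h
  obtain ⟨c, hc, hc'⟩ := B.exists_free hσ hp
  set S : Set ℝ := Icc c s ∩ {r | (B.geod (σ * r) (B.launch σ p)).1 ∈ B.obstacle} with hS
  have hScl : IsCompact S := isCompact_Icc.inter_right
    (B.isClosed_obstacle.preimage ((B.continuous_geod_fst _).comp (continuous_const_mul σ)))
  have hcs : c ≤ s := not_lt.1 fun h => hc' s hs h hs'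
  obtain ⟨T, hT, hTmin⟩ := hScl.exists_isLeast ⟨s, ⟨hcs, le_rfl⟩, hs'⟩
  refine Or.inr ⟨T, hc.trans_le hT.1.1, B.hitTime_eq_coe (hc.trans_le hT.1.1) hT.2 ?_, hT.2⟩
  intro r hr hrT hmem
  have hcr : c ≤ r := not_lt.1 fun h => hc' r hr h hmem
  exact (hTmin ⟨⟨hcr, hrT.le.trans hT.1.2⟩, hmem⟩).not_gt hrT

theorem hitTime_pos {σ : ℝ} (hσ : |σ| = 1) {p : TangentBundle (𝓡 n) Q} (hp : p ∈ B.nonGrazing) :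
    0 < B.hitTime σ p := by
  rcases B.hitTime_cases hσ hp with h | ⟨T, hT, h, -⟩ <;> rw [h]
  · exact EReal.coe_lt_top 0
  · exact EReal.coe_pos.2 hT

theorem hitPoint_eq {σ T : ℝ} {p : TangentBundle (𝓡 n) Q} (h : B.hitTime σ p = T) :
    B.hitPoint σ p = B.geod (σ * T) (B.launch σ p) := by
  rw [hitPoint, h, EReal.toReal_coe]

theorem geod_launch_mem_phaseInt {σ s : ℝ} {p : TangentBundle (𝓡 n) Q} (hp : p ∈ B.nonGrazing)
    (hs : 0 < s) (h : (s : EReal) < B.hitTime σ p) :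
    B.geod (σ * s) (B.launch σ p) ∈ B.phaseInt :=
  ⟨B.geod_mem_unitBundle.2 (B.launch_mem_nonGrazing σ hp).1.1,
    B.not_mem_obstacle_of_lt_hitTime hs h⟩

/-- At an interior point of the obstacle set slightly earlier times would be hits too. -/
theorem hitPoint_mem_phaseBdry {σ T : ℝ} (hσ : |σ| = 1) {p : TangentBundle (𝓡 n) Q}
    (hp : p ∈ B.nonGrazing) (hT : 0 < T) (h : B.hitTime σ p = T) : B.hitPoint σ p ∈ B.phaseBdry := by
  have hmem : (B.geod (σ * T) (B.launch σ p)).1 ∈ B.obstacle := by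
    rcases B.hitTime_cases hσ hp with h' | ⟨T', -, h', h''⟩
    · rw [h] at h'; exact absurd h' (EReal.coe_ne_top T)
    · rw [h] at h'
      rwa [EReal.coe_eq_coe_iff.1 h']
  rw [B.hitPoint_eq h]
  refine ⟨B.geod_mem_unitBundle.2 (B.launch_mem_nonGrazing σ hp).1.1, ?_⟩
  rw [B.isClosed_obstacle.frontier_eq]
  refine ⟨hmem, fun hint => ?_⟩
  have h1 : Tendsto (fun s : ℝ => (B.geod (σ * s) (B.launch σ p)).1) (𝓝[<] T)
      (𝓝 (B.geod (σ * T) (B.launch σ p)).1) :=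
    (((B.continuous_geod_fst _).comp (continuous_const_mul σ)).tendsto T).mono_left
      nhdsWithin_le_nhds
  have h2 := h1.eventually (isOpen_interior.mem_nhds hint)
  obtain ⟨s, hs, hs0, hsT⟩ := (h2.and (Ioo_mem_nhdsLT hT)).exists
  exact B.not_mem_obstacle_of_lt_hitTime hs0 (h ▸ EReal.coe_lt_coe_iff.2 hsT)
    (interior_subset hs)

/-- With the opposite sign, transversality would place the trajectory inside the obstacle just
before the first hit. -/
theorem hitPoint_arrival {σ T : ℝ} (hσ : |σ| = 1) {p : TangentBundle (𝓡 n) Q}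
    (hp : p ∈ B.nonGrazing) (hT : 0 < T) (h : B.hitTime σ p = T)
    (hg : B.hitPoint σ p ∉ B.grazing) : 0 < σ * B.normalComp (B.hitPoint σ p) := by
  have hb := B.hitPoint_mem_phaseBdry hσ hp hT h
  have hn := B.normalComp_ne_zero ⟨hb, hg⟩
  have hσ0 : σ ≠ 0 := fun h => by simp [h] at hσ
  obtain ⟨c, hc, hc'⟩ := B.exists_transversal hb.2 hn
  by_contra hneg
  have hneg' : σ * B.normalComp (B.hitPoint σ p) < 0 :=
    lt_of_le_of_ne (not_lt.1 hneg) (mul_ne_zero hσ0 hn)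
  obtain ⟨s, hs0, hs⟩ := exists_between (lt_min hc hT)
  have h1 := (hc'.self_of_nhds hb.2 (-(σ * s)) (neg_ne_zero.2 (mul_ne_zero hσ0 hs0.ne'))
    (by rw [abs_neg, abs_mul, hσ, one_mul, abs_of_pos hs0]; exact hs.trans_le (min_le_left _ _))).2
    (by nlinarith)
  have h2 : geodesicFlow B.metric (-(σ * s)) (B.hitPoint σ p) =
      B.geod (σ * (T - s)) (B.launch σ p) := by
    rw [B.hitPoint_eq h]
    refine (B.geod_add _ _ _).trans ?_
    congr 1; ring
  rw [h2] at h1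
  have hsT := hs.trans_le (min_le_right c T)
  exact B.not_mem_obstacle_of_lt_hitTime (by linarith : 0 < T - s)
    (h ▸ EReal.coe_lt_coe_iff.2 (by linarith)) h1

end BilliardSystem

end BilliardTrajectories

/-! ### Arithmetic of extended reals. -/

theorem EReal.coe_lt_coe_add_iff (x T : ℝ) (a : EReal) :
    (x : EReal) < T + a ↔ ((x - T : ℝ) : EReal) < a := by
  induction a with
  | bot => simp
  | top => simp only [EReal.coe_add_top, EReal.coe_lt_top]
  | coe a => rw [← EReal.coe_add, EReal.coe_lt_coe_iff, EReal.coe_lt_coe_iff, sub_lt_iff_lt_add']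

theorem EReal.coe_le_coe_add_iff (x T : ℝ) (a : EReal) :
    (x : EReal) ≤ T + a ↔ ((x - T : ℝ) : EReal) ≤ a := by
  induction a with
  | bot => simp [-EReal.coe_sub]
  | top => simp only [EReal.coe_add_top, le_top]
  | coe a => rw [← EReal.coe_add, EReal.coe_le_coe_iff, EReal.coe_le_coe_iff, sub_le_iff_le_add']

theorem EReal.exists_coe_of_pos_of_ne_top {a : EReal} (h0 : 0 < a) (h : a ≠ ⊤) :
    ∃ T : ℝ, 0 < T ∧ a = T := by
  induction a with
  | bot => simp at h0
  | top => simp at h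
  | coe a => exact ⟨a, EReal.coe_pos.1 h0, rfl⟩

/-! ### The billiard flow: existence times, completeness and reflections. -/

section BilliardFlow

variable {n : ℕ} {Q : Type*} [TopologicalSpace Q] [ChartedSpace (EuclideanSpace ℝ (Fin n)) Q]
  [IsManifold (𝓡 n) ∞ Q] [T2Space Q] (B : BilliardSystem n Q)

namespace BilliardSystem

variable {σ : ℝ} {p q : TangentBundle (𝓡 n) Q}

theorem hitTime_congr (h : B.launch σ p = B.launch σ q) : B.hitTime σ p = B.hitTime σ q := by
  rw [hitTime, hitTime, h]

theorem hitPoint_congr (h : B.launch σ p = B.launch σ q) : B.hitPoint σ p = B.hitPoint σ q := by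
  rw [hitPoint, hitPoint, h, B.hitTime_congr h]

theorem nthTime_succ {T : ℝ} (h : B.hitTime σ p = T) (hg : B.hitPoint σ p ∉ B.grazing) (k : ℕ) :
    B.nthTime σ (k + 1) p = T + B.nthTime σ k (B.hitPoint σ p) := by
  rw [nthTime, if_pos ⟨h ▸ EReal.coe_ne_top T, hg⟩, h]

theorem nthTime_of_grazing (hg : B.hitPoint σ p ∈ B.grazing) (k : ℕ) :
    B.nthTime σ k p = B.hitTime σ p := by
  cases k with
  | zero => rfl
  | succ k => rw [nthTime, if_neg fun h => h.2 hg]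

theorem nthTime_congr (h : B.launch σ p = B.launch σ q) (k : ℕ) :
    B.nthTime σ k p = B.nthTime σ k q := by
  cases k with
  | zero => exact B.hitTime_congr h
  | succ k => rw [nthTime, nthTime, B.hitTime_congr h, B.hitPoint_congr h]

theorem maxTime_congr (h : B.launch σ p = B.launch σ q) : B.maxTime σ p = B.maxTime σ q :=
  iSup_congr fun k => B.nthTime_congr h k

theorem hitTime_le_maxTime (σ : ℝ) (p : TangentBundle (𝓡 n) Q) :
    B.hitTime σ p ≤ B.maxTime σ p := le_iSup (fun k => B.nthTime σ k p) 0

theorem maxTime_pos (hσ : |σ| = 1) (hp : p ∈ B.nonGrazing) : 0 < B.maxTime σ p :=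
  (B.hitTime_pos hσ hp).trans_le (B.hitTime_le_maxTime σ p)

/-- The collision times of `p` are `T` followed by those of the hit point shifted by `T`; the
condition `T ≤ x` makes the additional first term irrelevant. -/
theorem lt_maxTime_iff {T x : ℝ} (h : B.hitTime σ p = T) (hg : B.hitPoint σ p ∉ B.grazing)
    (hx : T ≤ x) :
    (x : EReal) < B.maxTime σ p ↔ ((x - T : ℝ) : EReal) < B.maxTime σ (B.hitPoint σ p) := by
  rw [maxTime, maxTime, lt_iSup_iff, lt_iSup_iff]
  constructor
  · rintro ⟨k, hk⟩
    cases k with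
    | zero =>
      change (x : EReal) < B.hitTime σ p at hk
      rw [h, EReal.coe_lt_coe_iff] at hk
      exact absurd hx hk.not_ge
    | succ k => exact ⟨k, by rwa [B.nthTime_succ h hg, EReal.coe_lt_coe_add_iff] at hk⟩
  · rintro ⟨k, hk⟩
    exact ⟨k + 1, by rwa [B.nthTime_succ h hg, EReal.coe_lt_coe_add_iff]⟩

theorem maxTime_of_grazing (hg : B.hitPoint σ p ∈ B.grazing) :
    B.maxTime σ p = B.hitTime σ p := by
  rw [maxTime, iSup_congr (B.nthTime_of_grazing hg), iSup_const]

theorem maxTime_eq_top_of_hitTime (h : B.hitTime σ p = ⊤) : B.maxTime σ p = ⊤ :=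
  top_le_iff.1 (h ▸ B.hitTime_le_maxTime σ p)

theorem maxTime_eq_top_iff_hitPoint {T : ℝ} (h : B.hitTime σ p = T) :
    B.maxTime σ p = ⊤ ↔ B.hitPoint σ p ∉ B.grazing ∧ B.maxTime σ (B.hitPoint σ p) = ⊤ := by
  by_cases hg : B.hitPoint σ p ∈ B.grazing
  · simp [hg, B.maxTime_of_grazing hg, h]
  simp only [hg, not_false_eq_true, true_and, EReal.eq_top_iff_forall_lt]
  constructor
  · intro hx x
    rcases le_total 0 x with h0 | h0
    · have := (B.lt_maxTime_iff h hg (x := T + x) (by linarith)).1 (hx _)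
      rwa [add_sub_cancel_left] at this
    · have := (B.lt_maxTime_iff h hg (x := T) le_rfl).1 (hx _)
      rw [sub_self] at this
      exact (EReal.coe_le_coe_iff.2 h0).trans_lt this
  · intro hx x
    rcases le_total T x with h0 | h0
    · exact (B.lt_maxTime_iff h hg h0).2 (hx _)
    · exact (EReal.coe_le_coe_iff.2 h0).trans_lt ((B.lt_maxTime_iff h hg le_rfl).2 (hx _))

/-- The time-shift of a flight by less than its length. -/
theorem hitTime_shift {c : ℝ} (hσ : |σ| = 1) (hp : p ∈ B.nonGrazing)
    (hc : 0 < c) (hcp : (c : EReal) < B.hitTime σ p)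
    (hl : B.launch σ q = B.geod (σ * c) (B.launch σ p)) :
    (B.hitTime σ p = ⊤ ∧ B.hitTime σ q = ⊤) ∨
    ∃ T : ℝ, c < T ∧ B.hitTime σ p = T ∧ B.hitTime σ q = ((T - c : ℝ) : EReal) ∧
      B.hitPoint σ q = B.hitPoint σ p := by
  have key : ∀ s, B.geod (σ * s) (B.launch σ q) = B.geod (σ * (s + c)) (B.launch σ p) := fun s => by
    rw [hl, B.geod_add]; congr 1; ring
  rcases B.hitTime_cases hσ hp with h | ⟨T, hT, h, hh⟩
  · refine Or.inl ⟨h, B.hitTime_eq_top fun s hs => ?_⟩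
    rw [key]
    exact B.not_mem_obstacle_of_lt_hitTime (by linarith) (h ▸ EReal.coe_lt_top _)
  · have hcT : c < T := EReal.coe_lt_coe_iff.1 (h ▸ hcp)
    have hq : B.hitTime σ q = ((T - c : ℝ) : EReal) := by
      refine B.hitTime_eq_coe (by linarith) ?_ fun s hs hsT => ?_
      · rwa [key, sub_add_cancel]
      · rw [key]
        exact B.not_mem_obstacle_of_lt_hitTime (by linarith)
          (h ▸ EReal.coe_lt_coe_iff.2 (by linarith))
    refine Or.inr ⟨T, hcT, h, hq, ?_⟩
    rw [B.hitPoint_eq hq, key, B.hitPoint_eq h, sub_add_cancel]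

theorem maxTime_eq_top_iff_shift {c : ℝ} (hσ : |σ| = 1) (hp : p ∈ B.nonGrazing)
    (hc : 0 < c) (hcp : (c : EReal) < B.hitTime σ p)
    (hl : B.launch σ q = B.geod (σ * c) (B.launch σ p)) :
    B.maxTime σ p = ⊤ ↔ B.maxTime σ q = ⊤ := by
  rcases B.hitTime_shift hσ hp hc hcp hl with ⟨h1, h2⟩ | ⟨T, -, h1, h2, h3⟩
  · simp [B.maxTime_eq_top_of_hitTime h1, B.maxTime_eq_top_of_hitTime h2]
  · rw [B.maxTime_eq_top_iff_hitPoint h1, B.maxTime_eq_top_iff_hitPoint h2, h3]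

theorem geod_launch_mem_nonGrazing {t : ℝ} (hσ : |σ| = 1) (hp : p ∈ B.nonGrazing)
    (ht : 0 < t) (h : (t : EReal) ≤ B.hitTime σ p) (h' : (t : EReal) < B.maxTime σ p) :
    B.geod (σ * t) (B.launch σ p) ∈ B.nonGrazing := by
  rcases h.lt_or_eq with h1 | h1
  · exact B.phaseInt_subset_nonGrazing (B.geod_launch_mem_phaseInt hp ht h1)
  · rw [← B.hitPoint_eq h1.symm]
    refine B.phaseBdry_diff_subset_nonGrazing ⟨B.hitPoint_mem_phaseBdry hσ hp ht h1.symm, ?_⟩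
    intro hg
    rw [B.maxTime_of_grazing hg, h1] at h'
    exact h'.false

/-- The trajectory of `p` exists for all times. -/
def Complete (p : TangentBundle (𝓡 n) Q) : Prop :=
  p ∈ B.nonGrazing ∧ B.maxTime 1 p = ⊤ ∧ B.maxTime (-1) p = ⊤

theorem Complete.maxTime_eq_top {B : BilliardSystem n Q} (hσ : |σ| = 1) (h : B.Complete p) :
    B.maxTime σ p = ⊤ := by
  rcases eq_or_eq_neg_of_abs_eq hσ with rfl | rfl
  exacts [h.2.1, h.2.2]

theorem complete_of {σ : ℝ} (hσ : |σ| = 1) (hp : p ∈ B.nonGrazing) (h1 : B.maxTime σ p = ⊤)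
    (h2 : B.maxTime (-σ) p = ⊤) : B.Complete p := by
  rcases eq_or_eq_neg_of_abs_eq hσ with rfl | rfl
  · exact ⟨hp, h1, h2⟩
  · rw [neg_neg] at h2; exact ⟨hp, h2, h1⟩

/-- In the direction `σ` the remaining trajectory is a time shift of the old one. In the direction
`-σ` the flight is retraced to its start and the old backward trajectory takes over. -/
theorem Complete.geod_launch {B : BilliardSystem n Q} {t : ℝ} (hσ : |σ| = 1) (hp : B.Complete p)
    (ht : 0 < t) (h : (t : EReal) ≤ B.hitTime σ p) :
    B.Complete (B.geod (σ * t) (B.launch σ p)) := by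
  have hσ' : |(-σ)| = 1 := by rwa [abs_neg]
  have hmax := hp.maxTime_eq_top hσ
  have hmax' := hp.maxTime_eq_top hσ'
  set r := B.geod (σ * t) (B.launch σ p) with hr
  have hrN : r ∈ B.nonGrazing :=
    B.geod_launch_mem_nonGrazing hσ hp.1 ht h (hmax ▸ EReal.coe_lt_top t)
  have hback : ∀ s, B.geod (-σ * s) r = B.geod (σ * (t - s)) (B.launch σ p) := fun s => by
    rw [hr, B.geod_add]; congr 1; ring
  have hlr : B.launch (-σ) r = r := by
    rcases h.lt_or_eq with h1 | h1
    · exact B.launch_of_mem_phaseInt _ (B.geod_launch_mem_phaseInt hp.1 ht h1)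
    · refine B.launch_of_arrival ?_
      rw [hr, ← B.hitPoint_eq h1.symm]
      exact B.hitPoint_arrival hσ hp.1 ht h1.symm
        ((B.maxTime_eq_top_iff_hitPoint h1.symm).1 hmax).1
  have hfree : ∀ s, 0 < s → s < t → (B.geod (-σ * s) (B.launch (-σ) r)).1 ∉ B.obstacle := by
    intro s h0 hs
    rw [hlr, hback]
    exact B.not_mem_obstacle_of_lt_hitTime (by linarith)
      ((EReal.coe_lt_coe_iff.2 (by linarith)).trans_le h)
  refine B.complete_of hσ hrN ?_ ?_
  · rcases h.lt_or_eq with h1 | h1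
    · have hl : B.launch σ r = r :=
        B.launch_of_mem_phaseInt _ (B.geod_launch_mem_phaseInt hp.1 ht h1)
      exact (B.maxTime_eq_top_iff_shift hσ hp.1 ht h1 hl).1 hmax
    · rw [hr, ← B.hitPoint_eq h1.symm]
      exact ((B.maxTime_eq_top_iff_hitPoint h1.symm).1 hmax).2
  -- The retraced flight passes through an interior `p` without stopping, whereas over a boundary
  -- `p` it ends with a collision at `launch σ p`, whose launch in the direction `-σ` is that of
  -- `p`.
  · rcases B.mem_nonGrazing_iff.1 hp.1 with hi | hb
    · have hlp : ∀ s, B.launch s p = p := fun s => B.launch_of_mem_phaseInt s hi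
      have hpr : B.geod (-σ * t) r = p := by
        rw [hback, sub_self, mul_zero, B.geod_zero, hlp]
      refine (B.maxTime_eq_top_iff_shift (c := t) hσ' hrN ht ?_ (by rw [hlr, hpr, hlp])).2 hmax'
      rcases B.hitTime_cases hσ' hrN with h1 | ⟨T, hT, h1, h2⟩
      · rw [h1]; exact EReal.coe_lt_top t
      · rw [h1, EReal.coe_lt_coe_iff]
        by_contra hle
        rcases (not_lt.1 hle).lt_or_eq with h3 | h3
        · exact hfree T hT h3 h2
        · rw [h3, hlr, hpr] at h2
          exact hi.2 h2
    · have hpr : B.geod (-σ * t) r = B.launch σ p := by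
        rw [hback, sub_self, mul_zero, B.geod_zero]
      have hLb := B.launch_mem_phaseBdry σ hb
      have h1 : B.hitTime (-σ) r = t := by
        refine B.hitTime_eq_coe ht ?_ hfree
        rw [hlr, hpr]
        exact B.mem_obstacle_of_mem_phaseBdry hLb.1
      have h2 : B.hitPoint (-σ) r = B.launch σ p := by rw [B.hitPoint_eq h1, hlr, hpr]
      rw [B.maxTime_eq_top_iff_hitPoint h1, h2, B.maxTime_congr (B.launch_launch_neg hp.1)]
      exact ⟨hLb.2, hmax'⟩

theorem travel_of_le {t : ℝ} (h : (t : EReal) ≤ B.hitTime σ p) (k : ℕ) :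
    B.travel σ k t p = B.geod (σ * t) (B.launch σ p) := by
  cases k with
  | zero => rfl
  | succ k => rw [travel, if_pos h]

theorem travel_succ_of_lt {t T : ℝ} (h : B.hitTime σ p = T) (hT : T < t) (k : ℕ) :
    B.travel σ (k + 1) t p = B.travel σ k (t - T) (B.hitPoint σ p) := by
  rw [travel, if_neg (by rw [h, EReal.coe_le_coe_iff]; exact hT.not_ge), h, EReal.toReal_coe]

/-- The sequence of collision times is constant after a grazing hit, so a later term can exceed `T`
only if the first hit is not grazing. -/
theorem hit_of_lt_nthTime {t T : ℝ} {k : ℕ} (h : B.hitTime σ p = T) (hT : T < t)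
    (hk : (t : EReal) ≤ B.nthTime σ k p) :
    B.hitPoint σ p ∉ B.grazing ∧ ∃ j, k = j + 1 ∧
      ((t - T : ℝ) : EReal) ≤ B.nthTime σ j (B.hitPoint σ p) := by
  have hg : B.hitPoint σ p ∉ B.grazing := fun hg => by
    rw [B.nthTime_of_grazing hg, h, EReal.coe_le_coe_iff] at hk
    exact hT.not_ge hk
  refine ⟨hg, ?_⟩
  cases k with
  | zero =>
    change (t : EReal) ≤ B.hitTime σ p at hk
    rw [h, EReal.coe_le_coe_iff] at hk
    exact absurd hk hT.not_ge
  | succ k => exact ⟨k, rfl, by rwa [B.nthTime_succ h hg, EReal.coe_le_coe_add_iff] at hk⟩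

theorem exists_hitTime_of_lt (hσ : |σ| = 1) (hp : p ∈ B.nonGrazing) {t : ℝ}
    (h : B.hitTime σ p < t) : ∃ T : ℝ, 0 < T ∧ B.hitTime σ p = T ∧ T < t := by
  obtain ⟨T, hT, hT'⟩ := EReal.exists_coe_of_pos_of_ne_top (B.hitTime_pos hσ hp)
    (h.trans (EReal.coe_lt_top t)).ne
  exact ⟨T, hT, hT', EReal.coe_lt_coe_iff.1 (hT' ▸ h)⟩

theorem Complete.travel {B : BilliardSystem n Q} (hσ : |σ| = 1) (k : ℕ) :
    ∀ {t : ℝ} {p : TangentBundle (𝓡 n) Q}, B.Complete p → 0 < t → (t : EReal) ≤ B.nthTime σ k p →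
      B.Complete (B.travel σ k t p) := by
  induction k with
  | zero => exact fun hp ht h => hp.geod_launch hσ ht h
  | succ k ih =>
    intro t p hp ht h
    rcases le_or_gt (t : EReal) (B.hitTime σ p) with h1 | h1
    · rw [B.travel_of_le h1]
      exact hp.geod_launch hσ ht h1
    · obtain ⟨T, hT, hpT, hTt⟩ := B.exists_hitTime_of_lt hσ hp.1 h1
      obtain ⟨-, j, hj, hle⟩ := B.hit_of_lt_nthTime hpT hTt h
      obtain rfl : k = j := by omega
      rw [B.travel_succ_of_lt hpT hTt]
      refine ih ?_ (by linarith) hle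
      rw [B.hitPoint_eq hpT]
      exact hp.geod_launch hσ hT hpT.ge

theorem travel_mem_nonGrazing (hσ : |σ| = 1) (k : ℕ) :
    ∀ {t : ℝ} {p : TangentBundle (𝓡 n) Q}, p ∈ B.nonGrazing → 0 < t →
      (t : EReal) ≤ B.nthTime σ k p → (t : EReal) < B.maxTime σ p →
      B.travel σ k t p ∈ B.nonGrazing := by
  induction k with
  | zero => exact fun hp ht h h' => B.geod_launch_mem_nonGrazing hσ hp ht h h'
  | succ k ih =>
    intro t p hp ht h h'
    rcases le_or_gt (t : EReal) (B.hitTime σ p) with h1 | h1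
    · rw [B.travel_of_le h1]
      exact B.geod_launch_mem_nonGrazing hσ hp ht h1 h'
    · obtain ⟨T, hT, hpT, hTt⟩ := B.exists_hitTime_of_lt hσ hp h1
      obtain ⟨hg, j, hj, hle⟩ := B.hit_of_lt_nthTime hpT hTt h
      obtain rfl : k = j := by omega
      rw [B.travel_succ_of_lt hpT hTt]
      exact ih (B.phaseBdry_diff_subset_nonGrazing ⟨B.hitPoint_mem_phaseBdry hσ hp hT hpT, hg⟩)
        (by linarith) hle ((B.lt_maxTime_iff hpT hg hTt.le).1 h')

/-- The last reflection before a given time. -/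
theorem exists_last_reflection (hσ : |σ| = 1) (k : ℕ) :
    ∀ {t : ℝ} {p : TangentBundle (𝓡 n) Q}, p ∈ B.nonGrazing → B.hitTime σ p < t →
      (t : EReal) ≤ B.nthTime σ k p →
      ∃ s : ℝ, 0 < s ∧ s < t ∧ ∃ b ∈ B.phaseBdry \ B.grazing, 0 < σ * B.normalComp b ∧
        B.travel σ k t p = B.geod (σ * (t - s)) (B.launch σ b) ∧
        (b = B.geod (σ * s) (B.launch σ p) ∨
          ∃ s', 0 < s' ∧ s' ≤ s ∧ (B.geod (-(σ * s')) b).1 ∈ B.obstacle) := by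
  induction k with
  | zero => exact fun _ h1 h2 => absurd h2 h1.not_ge
  | succ k ih =>
    intro t p hp h1 h
    obtain ⟨T, hT, hpT, hTt⟩ := B.exists_hitTime_of_lt hσ hp h1
    obtain ⟨hg, j, hj, hle⟩ := B.hit_of_lt_nthTime hpT hTt h
    obtain rfl : k = j := by omega
    rw [B.travel_succ_of_lt hpT hTt]
    have hb := B.hitPoint_mem_phaseBdry hσ hp hT hpT
    rcases le_or_gt ((t - T : ℝ) : EReal) (B.hitTime σ (B.hitPoint σ p)) with h2 | h2
    · refine ⟨T, hT, hTt, B.hitPoint σ p, ⟨hb, hg⟩, B.hitPoint_arrival hσ hp hT hpT hg, ?_,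
        Or.inl (B.hitPoint_eq hpT)⟩
      rw [B.travel_of_le h2]
    · obtain ⟨s, hs, hst, b, hb', hb'', hb3, hb4⟩ :=
        ih (B.phaseBdry_diff_subset_nonGrazing ⟨hb, hg⟩) h2 hle
      refine ⟨T + s, by linarith, by linarith, b, hb', hb'', ?_, Or.inr ?_⟩
      · rw [hb3]; congr 2; ring
      -- If `b` is the first collision after the hit point, tracing back from it arrives at the hit
      -- point, which lies in the obstacle set; this is the second alternative for `p`.
      · rcases hb4 with h3 | ⟨s', h3, h4, h5⟩
        · refine ⟨s, hs, by linarith, ?_⟩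
          rw [h3, B.geod_add, neg_add_cancel, B.geod_zero, B.launch_fst]
          exact B.mem_obstacle_of_mem_phaseBdry hb
        · exact ⟨s', h3, by linarith, h5⟩

theorem flow_zero (p : TangentBundle (𝓡 n) Q) : B.flow 0 p = p := by simp [flow]

theorem flow_eq_travel (hσ : |σ| = 1) {t : ℝ} (ht : 0 < t) (p : TangentBundle (𝓡 n) Q) :
    B.flow (σ * t) p = B.travel σ (sInf {k | (t : EReal) ≤ B.nthTime σ k p}) t p := by
  rcases eq_or_eq_neg_of_abs_eq hσ with rfl | rfl
  · rw [flow, if_pos (by linarith), one_mul]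
  · rw [flow, if_neg (by linarith), if_pos (by linarith), neg_mul, one_mul, neg_neg]

theorem flow_eq_geod (hσ : |σ| = 1) {t : ℝ} (ht : 0 < t) (h : (t : EReal) ≤ B.hitTime σ p) :
    B.flow (σ * t) p = B.geod (σ * t) (B.launch σ p) := by
  rw [B.flow_eq_travel hσ ht, B.travel_of_le h]

/-- `sInf` on `ℕ` is a minimum unless the set is empty, where it would be `0`; the bound by
`maxTime` excludes that. -/
theorem le_nthTime_sInf {t : ℝ} (h : (t : EReal) < B.maxTime σ p) :
    (t : EReal) ≤ B.nthTime σ (sInf {k | (t : EReal) ≤ B.nthTime σ k p}) p := by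
  obtain ⟨k, hk⟩ := lt_iSup_iff.1 h
  exact Nat.sInf_mem (s := {k | (t : EReal) ≤ B.nthTime σ k p}) ⟨k, hk.le⟩

theorem mem_domain_iff (hσ : |σ| = 1) {t : ℝ} (ht : 0 ≤ t) :
    (σ * t, p) ∈ B.domain ↔ p ∈ B.nonGrazing ∧ (t : EReal) < B.maxTime σ p := by
  have neg_of : ∀ {a : EReal} {x : ℝ}, 0 ≤ x → 0 < a → -a < x := fun {a x} hx ha =>
    (EReal.neg_lt_zero.2 ha).trans_le (EReal.coe_nonneg.2 hx)
  rcases eq_or_eq_neg_of_abs_eq hσ with rfl | rfl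
  · rw [one_mul]
    exact ⟨fun h => ⟨h.1, h.2.2⟩, fun h => ⟨h.1, neg_of ht (B.maxTime_pos (by simp) h.1), h.2⟩⟩
  · rw [neg_mul, one_mul]
    refine ⟨fun h => ⟨h.1, ?_⟩, fun h => ⟨h.1, ?_, ?_⟩⟩
    · have := h.2.1
      rwa [EReal.coe_neg, EReal.neg_lt_neg_iff] at this
    · rw [EReal.coe_neg, EReal.neg_lt_neg_iff]; exact h.2
    · exact (EReal.coe_nonpos.2 (by linarith)).trans_lt (B.maxTime_pos (by simp) h.1)

theorem zero_mem_domain (hp : p ∈ B.nonGrazing) : ((0 : ℝ), p) ∈ B.domain := by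
  have := (B.mem_domain_iff (σ := 1) (p := p) (by simp) le_rfl).2
    ⟨hp, B.maxTime_pos (by simp) hp⟩
  rwa [mul_zero] at this

theorem exists_sign_mul (t : ℝ) : ∃ σ : ℝ, |σ| = 1 ∧ t = σ * |t| := by
  rcases le_total 0 t with h | h
  · exact ⟨1, by simp, by rw [abs_of_nonneg h, one_mul]⟩
  · exact ⟨-1, by simp, by rw [abs_of_nonpos h]; ring⟩

theorem flow_mem_nonGrazing {t : ℝ} (h : (t, p) ∈ B.domain) : B.flow t p ∈ B.nonGrazing := by
  obtain ⟨σ, hσ, hσt⟩ := exists_sign_mul t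
  rcases eq_or_ne t 0 with rfl | h0
  · rw [B.flow_zero]; exact h.1
  · rw [hσt] at h ⊢
    have h' := (B.mem_domain_iff hσ (abs_nonneg t)).1 h
    rw [B.flow_eq_travel hσ (abs_pos.2 h0)]
    exact B.travel_mem_nonGrazing hσ _ h'.1 (abs_pos.2 h0) (B.le_nthTime_sInf h'.2) h'.2

theorem complete_iff : B.Complete p ↔ ∀ t : ℝ, (t, p) ∈ B.domain := by
  constructor
  · intro h t
    exact ⟨h.1, by rw [h.2.2]; exact EReal.bot_lt_coe t, by rw [h.2.1]; exact EReal.coe_lt_top t⟩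
  · intro h
    have key : ∀ σ : ℝ, |σ| = 1 → B.maxTime σ p = ⊤ := fun σ hσ => by
      refine (EReal.eq_top_iff_forall_lt _).2 fun x => ?_
      have := ((B.mem_domain_iff hσ (abs_nonneg x)).1 (h _)).2
      exact (EReal.coe_le_coe_iff.2 (le_abs_self x)).trans_lt this
    exact ⟨(h 0).1, key 1 (by simp), key (-1) (by simp)⟩

theorem Complete.flow {B : BilliardSystem n Q} (h : B.Complete p) (t : ℝ) :
    B.Complete (B.flow t p) := by
  obtain ⟨σ, hσ, hσt⟩ := exists_sign_mul t
  rcases eq_or_ne t 0 with rfl | h0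
  · rwa [B.flow_zero]
  · rw [hσt, B.flow_eq_travel hσ (abs_pos.2 h0)]
    refine h.travel hσ _ (abs_pos.2 h0) (B.le_nthTime_sInf ?_)
    rw [h.maxTime_eq_top hσ]
    exact EReal.coe_lt_top _

/-- Existence times depend on a vector only through its two launches; this is how they descend to
the model. -/
theorem mem_domain_congr (h : ∀ σ : ℝ, |σ| = 1 → B.launch σ p = B.launch σ q)
    (hq : q ∈ B.nonGrazing) {t : ℝ} (hp : (t, p) ∈ B.domain) : (t, q) ∈ B.domain := by
  refine ⟨hq, ?_, ?_⟩
  · rw [← B.maxTime_congr (h (-1) (by simp))]; exact hp.2.1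
  · rw [← B.maxTime_congr (h 1 (by simp))]; exact hp.2.2

end BilliardSystem

end BilliardFlow

/-! ### Topology of the model: gluing region, properness of `π`, trapped sets. -/

section ModelTopology

variable {n : ℕ} {Q : Type*} [TopologicalSpace Q] [ChartedSpace (EuclideanSpace ℝ (Fin n)) Q]
  [IsManifold (𝓡 n) ∞ Q] [T2Space Q] {B : BilliardSystem n Q}
  {E : Type*} [NormedAddCommGroup E] [NormedSpace ℝ E]
  {𝓜 : Type*} [TopologicalSpace 𝓜] [T2Space 𝓜] [ChartedSpace E 𝓜] (m : SmoothModel B E 𝓜)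

namespace SmoothModel

theorem mem_domain {t : ℝ} {q : TangentBundle (𝓡 n) Q} (h : (t, q) ∈ B.domain) :
    (t, m.proj q) ∈ m.domain := ⟨(t, q), h, rfl⟩

theorem zero_mem_domain (p : 𝓜) : ((0 : ℝ), p) ∈ m.domain := by
  obtain ⟨q, hq, rfl⟩ := m.proj_surj p
  exact m.mem_domain (B.zero_mem_domain hq)

theorem continuousAt_flow {z : ℝ × 𝓜} (hz : z ∈ m.domain) :
    ContinuousAt (fun z : ℝ × 𝓜 => m.flow z.1 z.2) z :=
  m.flow_smooth.continuousOn.continuousAt (m.isOpen_domain.mem_nhds hz)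

theorem tendsto_flow_zero (p : 𝓜) : Tendsto (fun t => m.flow t p) (𝓝 0) (𝓝 p) := by
  have h1 : Tendsto (fun t : ℝ => (t, p)) (𝓝 0) (𝓝 ((0 : ℝ), p)) :=
    (Continuous.prodMk_left p).tendsto 0
  have h2 := (m.continuousAt_flow (m.zero_mem_domain p)).tendsto.comp h1
  rwa [m.flow_zero] at h2

theorem flow_proj {t : ℝ} {q : TangentBundle (𝓡 n) Q} (h : (t, q) ∈ B.domain) :
    m.flow t (m.proj q) = m.proj (B.flow t q) := m.intertwines (t, q) h

theorem _root_.BilliardSystem.mem_domain_of_le_hitTime {σ t : ℝ} (hσ : |σ| = 1)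
    {q : TangentBundle (𝓡 n) Q} (hq : q ∈ B.nonGrazing) (ht : 0 ≤ t)
    (h : (t : EReal) < B.hitTime σ q) : (σ * t, q) ∈ B.domain :=
  (B.mem_domain_iff hσ ht).2 ⟨hq, h.trans_le (B.hitTime_le_maxTime σ q)⟩

theorem flow_proj_geod {σ t : ℝ} (hσ : |σ| = 1) {q : TangentBundle (𝓡 n) Q}
    (hq : q ∈ B.nonGrazing) (ht : 0 < t) (h : (t : EReal) < B.hitTime σ q) :
    m.flow (σ * t) (m.proj q) = m.proj (B.geod (σ * t) (B.launch σ q)) := by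
  rw [m.flow_proj (B.mem_domain_of_le_hitTime hσ hq ht.le h), B.flow_eq_geod hσ ht h.le]

theorem _root_.BilliardSystem.eventually_lt_hitTime {σ : ℝ} (hσ : |σ| = 1)
    {q : TangentBundle (𝓡 n) Q} (hq : q ∈ B.nonGrazing) :
    ∀ᶠ t : ℝ in 𝓝[>] 0, 0 < t ∧ (t : EReal) < B.hitTime σ q := by
  obtain ⟨c, hc, hc'⟩ := EReal.lt_iff_exists_real_btwn.1 (B.hitTime_pos hσ hq)
  filter_upwards [Ioo_mem_nhdsGT (EReal.coe_pos.1 hc)] with t ht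
  exact ⟨ht.1, (EReal.coe_lt_coe_iff.2 ht.2).trans hc'⟩

theorem proj_injOn : InjOn m.proj B.phaseInt := by
  obtain ⟨κ, -, hκ⟩ := m.exists_smooth_inverse
  intro q hq q' hq' h
  rw [← hκ q hq, h, hκ q' hq']

/-- At a small time before either trajectory collides, both are in the interior and have the same
image, hence coincide; the geodesic flow is injective. -/
theorem launch_eq_of_proj_eq {σ : ℝ} (hσ : |σ| = 1) {q q' : TangentBundle (𝓡 n) Q}
    (hq : q ∈ B.nonGrazing) (hq' : q' ∈ B.nonGrazing) (h : m.proj q = m.proj q') :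
    B.launch σ q = B.launch σ q' := by
  obtain ⟨t, h1, h2⟩ := ((B.eventually_lt_hitTime hσ hq).and
    (B.eventually_lt_hitTime hσ hq')).exists
  have h3 := m.flow_proj_geod hσ hq h1.1 h1.2
  rw [h, m.flow_proj_geod hσ hq' h2.1 h2.2] at h3
  exact (geodesicFlow_injective B.complete _ (m.proj_injOn
    (B.geod_launch_mem_phaseInt hq' h2.1 h2.2) (B.geod_launch_mem_phaseInt hq h1.1 h1.2) h3)).symm

theorem mem_domain_iff {t : ℝ} {q : TangentBundle (𝓡 n) Q} (hq : q ∈ B.nonGrazing) :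
    (t, m.proj q) ∈ m.domain ↔ (t, q) ∈ B.domain := by
  refine ⟨?_, m.mem_domain⟩
  rintro ⟨⟨t', q'⟩, h', heq⟩
  obtain ⟨rfl, hqq⟩ := Prod.ext_iff.1 heq
  exact B.mem_domain_congr (fun σ hσ => m.launch_eq_of_proj_eq hσ h'.1 hq hqq) hq h'

theorem proj_not_mem_gluing {q : TangentBundle (𝓡 n) Q} (hq : q ∈ B.phaseInt) :
    m.proj q ∉ m.gluing := by
  rintro ⟨b, hb, hbq⟩
  have h := m.launch_eq_of_proj_eq (σ := 1) (by simp) (B.phaseBdry_diff_subset_nonGrazing hb)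
    (B.phaseInt_subset_nonGrazing hq) hbq
  have h1 := congrArg (fun x => x.1) h
  rw [B.launch_fst, B.launch_fst] at h1
  exact hq.2 (h1 ▸ B.mem_obstacle_of_mem_phaseBdry hb.1)

theorem mem_phaseInt_of_not_mem_gluing {q : TangentBundle (𝓡 n) Q} (hq : q ∈ B.nonGrazing)
    (h : m.proj q ∉ m.gluing) : q ∈ B.phaseInt :=
  (B.mem_nonGrazing_iff.1 hq).resolve_right fun h' => h ⟨q, h', rfl⟩

/-- An interior and a boundary vector never share an image. Closedness of the gluing region follows
from the open image required of a model. -/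
theorem compl_gluing : m.gluingᶜ = m.proj '' B.phaseInt := by
  ext p
  constructor
  · intro h
    obtain ⟨q, hq, rfl⟩ := m.proj_surj p
    exact ⟨q, m.mem_phaseInt_of_not_mem_gluing hq h, rfl⟩
  · rintro ⟨q, hq, rfl⟩
    exact m.proj_not_mem_gluing hq

theorem isClosed_gluing : IsClosed m.gluing :=
  ⟨by rw [m.compl_gluing]; exact m.isOpen_image⟩

theorem eventually_not_mem_gluing (p : 𝓜) : ∀ᶠ t in 𝓝[≠] (0 : ℝ), m.flow t p ∉ m.gluing := by
  obtain ⟨q, hq, rfl⟩ := m.proj_surj p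
  have key : ∀ σ : ℝ, |σ| = 1 → ∀ᶠ t in 𝓝[>] (0 : ℝ), m.flow (σ * t) (m.proj q) ∉ m.gluing := by
    intro σ hσ
    filter_upwards [B.eventually_lt_hitTime hσ hq] with t ht
    rw [m.flow_proj_geod hσ hq ht.1 ht.2]
    exact m.proj_not_mem_gluing (B.geod_launch_mem_phaseInt hq ht.1 ht.2)
  rw [← Iio_union_Ioi, nhdsWithin_union, eventually_sup]
  constructor
  · have h2 : Tendsto (fun t : ℝ => -t) (𝓝[<] 0) (𝓝[>] 0) := by
      simpa using tendsto_neg_nhdsLT (a := (0 : ℝ))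
    filter_upwards [h2.eventually (key (-1) (by simp))] with t ht
    simpa using ht
  · filter_upwards [key 1 (by simp)] with t ht
    simpa using ht

variable {m}

/-- The ultrafilter decides whether the launch is the identity or the reflection; the latter is
undone by continuity of the reflection. -/
theorem le_nhds_of_tendsto_launch {𝒰 : Ultrafilter (TangentBundle (𝓡 n) Q)}
    (hN : B.nonGrazing ∈ 𝒰) {a : TangentBundle (𝓡 n) Q} (ha : a ∈ B.phaseBdry \ B.grazing)
    (h : Tendsto (B.launch 1) 𝒰 (𝓝 a)) :
    ∃ x ∈ B.nonGrazing, (𝒰 : Filter (TangentBundle (𝓡 n) Q)) ≤ 𝓝 x := by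
  rcases 𝒰.em (fun z => B.launch 1 z = z) with h1 | h1
  · refine ⟨a, B.phaseBdry_diff_subset_nonGrazing ha, ?_⟩
    exact tendsto_id'.1 (h.congr' h1)
  · refine ⟨B.reflect a, B.phaseBdry_diff_subset_nonGrazing (B.reflect_mem ha), ?_⟩
    have h2 : ∀ᶠ z in (𝒰 : Filter (TangentBundle (𝓡 n) Q)),
        (B.launch 1 z).1 ∈ frontier B.obstacle ∧ B.reflect (B.launch 1 z) = z := by
      filter_upwards [h1, hN] with z hz hzN
      have hb := (B.mem_nonGrazing_iff.1 hzN).resolve_left fun h =>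
        hz (B.launch_of_mem_phaseInt 1 h)
      have hzr := (B.launch_eq_or 1 z).resolve_left hz
      rw [hzr]
      exact ⟨hb.1.2, B.reflect_reflect hb.1.2⟩
    have h3 := (B.continuousWithinAt_reflect ha.1.2).tendsto.comp
      (tendsto_nhdsWithin_iff.2 ⟨h, h2.mono fun z hz => hz.1⟩)
    exact tendsto_id'.1 (h3.congr' (h2.mono fun z hz => hz.2))

variable (m)

theorem exists_le_nhds_of_not_mem_gluing {𝒰 : Ultrafilter (TangentBundle (𝓡 n) Q)}
    (hN : B.nonGrazing ∈ 𝒰) {p : 𝓜} (hp : p ∉ m.gluing) (h : Tendsto m.proj 𝒰 (𝓝 p)) :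
    ∃ x ∈ B.nonGrazing, (𝒰 : Filter (TangentBundle (𝓡 n) Q)) ≤ 𝓝 x := by
  obtain ⟨κ, hκs, hκ⟩ := m.exists_smooth_inverse
  have hp' : p ∈ m.proj '' B.phaseInt := m.compl_gluing ▸ hp
  obtain ⟨q, hq, rfl⟩ := hp'
  refine ⟨q, B.phaseInt_subset_nonGrazing hq, ?_⟩
  have h1 := (hκs.continuousOn.continuousAt (m.isOpen_image.mem_nhds ⟨q, hq, rfl⟩)).tendsto.comp h
  rw [hκ q hq] at h1
  refine tendsto_id'.1 (h1.congr' ?_)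
  filter_upwards [hN, h.eventually (m.isClosed_gluing.isOpen_compl.mem_nhds hp)] with z hz hz'
  exact hκ z (m.mem_phaseInt_of_not_mem_gluing hz hz')

/-- The inverse of `π` is not available at `p`, but it is at `φ_δ(p)` for small `δ > 0`. The limit
is found there and then transported back through the billiard flow, where at most one reflection has
to be undone. -/
theorem exists_le_nhds_of_mem_gluing {𝒰 : Ultrafilter (TangentBundle (𝓡 n) Q)}
    (hN : B.nonGrazing ∈ 𝒰) {p : 𝓜} (hp : p ∈ m.gluing) (h : Tendsto m.proj 𝒰 (𝓝 p)) :
    ∃ x ∈ B.nonGrazing, (𝒰 : Filter (TangentBundle (𝓡 n) Q)) ≤ 𝓝 x := by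
  obtain ⟨κ, hκs, hκ⟩ := m.exists_smooth_inverse
  obtain ⟨a, ha, rfl⟩ := hp
  -- Below, `a₁` is the departing and `a₂` the arriving vector of the collision over `p`; the
  -- ultrafilter will converge to one of these.
  have h11 : |(1 : ℝ)| = 1 := abs_one
  have haN := B.phaseBdry_diff_subset_nonGrazing ha
  set a₁ := B.launch 1 a with ha₁
  have ha₁b : a₁ ∈ B.phaseBdry \ B.grazing := B.launch_mem_phaseBdry 1 ha
  have hna₁ : B.normalComp a₁ < 0 := by simpa using B.launch_normalComp_neg h11 ha
  set a₂ := B.reflect a₁ with ha₂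
  have ha₂b : a₂ ∈ B.phaseBdry \ B.grazing := B.reflect_mem ha₁b
  have hna₂ : 0 < B.normalComp a₂ := by
    rw [ha₂, B.normalComp_reflect ha₁b.1.2]; linarith
  obtain ⟨c, hc, hct⟩ := B.exists_transversal ha₂b.1.2 hna₂.ne'
  -- a short time `δ` for which the geodesic flow is continuous where it is used
  obtain ⟨δ, hδ0, hδhit, hcont⟩ : ∃ δ : ℝ, 0 < δ ∧ (δ : EReal) < B.hitTime 1 a ∧
      ∀ s ∈ Icc 0 δ, ContinuousAt (fun z : ℝ × TangentBundle (𝓡 n) Q => B.geod z.1 z.2)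
        (-(δ - s), B.geod δ a₁) := by
    have h1 := eventually_continuousAt_geodesicFlow B.complete a₁
    rw [nhds_prod_eq] at h1
    obtain ⟨pa, hpa, pb, hpb, hab⟩ := eventually_prod_iff.1 h1
    obtain ⟨ε, hε, hε'⟩ := Metric.eventually_nhds_iff.1 hpa
    have h2 : Tendsto (fun t => B.geod t a₁) (𝓝[>] 0) (𝓝 a₁) := by
      have := ((continuous_geodesicFlow_left B.complete a₁).tendsto 0).mono_left
        (nhdsWithin_le_nhds (s := Ioi (0 : ℝ)))
      rwa [geodesicFlow_zero B.complete] at this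
    obtain ⟨δ, ⟨hδ0, hδh⟩, hδb, hδε⟩ := ((B.eventually_lt_hitTime h11 haN).and
      ((h2.eventually hpb).and (Ioo_mem_nhdsGT hε))).exists
    refine ⟨δ, hδ0, hδh, fun s hs => hab (hε' ?_) hδb⟩
    rw [Real.dist_0_eq_abs, abs_neg, abs_of_nonneg (by linarith [hs.2])]
    linarith [hs.1, hδε.2]
  set r := B.geod δ a₁ with hr
  have hrint : r ∈ B.phaseInt := by
    have := B.geod_launch_mem_phaseInt haN hδ0 hδhit
    rwa [one_mul] at this
  have hflow : m.flow δ (m.proj a) = m.proj r := by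
    have := m.flow_proj_geod h11 haN hδ0 hδhit
    rwa [one_mul] at this
  have hdom : (δ, m.proj a) ∈ m.domain := by
    have := m.mem_domain (B.mem_domain_of_le_hitTime h11 haN hδ0.le hδhit)
    rwa [one_mul] at this
  -- the trajectories at time `δ` converge
  have hpair : Tendsto (fun z => (δ, m.proj z)) 𝒰 (𝓝 (δ, m.proj a)) :=
    tendsto_const_nhds.prodMk_nhds h
  have hmf : Tendsto (fun z => m.flow δ (m.proj z)) 𝒰 (𝓝 (m.proj r)) := by
    rw [← hflow]; exact (m.continuousAt_flow hdom).tendsto.comp hpair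
  have hD : ∀ᶠ z in (𝒰 : Filter (TangentBundle (𝓡 n) Q)), z ∈ B.nonGrazing ∧ (δ, z) ∈ B.domain := by
    filter_upwards [hN, hpair.eventually (m.isOpen_domain.mem_nhds hdom)] with z hz hz'
    exact ⟨hz, (m.mem_domain_iff hz).1 hz'⟩
  have hBf : Tendsto (fun z => B.flow δ z) 𝒰 (𝓝 r) := by
    have h1 := (hκs.continuousOn.continuousAt
      (m.isOpen_image.mem_nhds ⟨r, hrint, rfl⟩)).tendsto.comp hmf
    rw [hκ r hrint] at h1
    refine h1.congr' ?_
    filter_upwards [hD, hmf.eventually (m.isClosed_gluing.isOpen_compl.mem_nhds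
      (m.proj_not_mem_gluing hrint))] with z hz hz'
    have hz1 : m.flow δ (m.proj z) = m.proj (B.flow δ z) := m.flow_proj hz.2
    change m.flow δ (m.proj z) ∉ m.gluing at hz'
    rw [hz1] at hz'
    change κ (m.flow δ (m.proj z)) = _
    rw [hz1]
    exact hκ _ (m.mem_phaseInt_of_not_mem_gluing (B.flow_mem_nonGrazing hz.2) hz')
  have hback : ∀ s : ℝ, B.geod (-(δ - s)) r = B.geod s a₁ := fun s => by
    rw [hr, B.geod_add]; congr 1; ring
  -- Either the vectors have no collision before the time `δ`, and going back along the geodesic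
  -- leads to `a₁`, or they do, and the last collision before `δ` is examined.
  rcases 𝒰.em (fun z => (δ : EReal) ≤ B.hitTime 1 z) with hcase | hcase
  · refine le_nhds_of_tendsto_launch hN ha₁b ?_
    have h1 : Tendsto (fun z => B.geod (-(δ - 0)) (B.flow δ z)) 𝒰 (𝓝 (B.geod (-(δ - 0)) r)) :=
      (hcont 0 ⟨le_rfl, hδ0.le⟩).tendsto.comp (tendsto_const_nhds.prodMk_nhds hBf)
    rw [hback, B.geod_zero] at h1
    refine h1.congr' ?_
    filter_upwards [hcase] with z hz
    have := B.flow_eq_geod h11 hδ0 hz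
    rw [one_mul] at this
    rw [this, B.geod_add, sub_zero, neg_add_cancel, B.geod_zero]
  · have hex : ∀ z, z ∈ B.nonGrazing ∧ (δ, z) ∈ B.domain ∧ ¬ (δ : EReal) ≤ B.hitTime 1 z →
        ∃ s : ℝ, ∃ b, 0 < s ∧ s < δ ∧ b ∈ B.phaseBdry \ B.grazing ∧ 0 < 1 * B.normalComp b ∧
        B.flow δ z = B.geod (δ - s) (B.launch 1 b) ∧
        (b = B.geod s (B.launch 1 z) ∨
          ∃ s', 0 < s' ∧ s' ≤ s ∧ (B.geod (-s') b).1 ∈ B.obstacle) := by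
      rintro z ⟨hz, hzD, hzh⟩
      rw [← one_mul δ] at hzD
      have hzm := ((B.mem_domain_iff h11 hδ0.le).1 hzD).2
      obtain ⟨s, hs0, hsδ, b, hb, hb1, hb2, hb3⟩ :=
        B.exists_last_reflection h11 _ hz (not_le.1 hzh) (B.le_nthTime_sInf hzm)
      rw [← B.flow_eq_travel h11 hδ0] at hb2
      simp only [one_mul] at hb2 hb3
      exact ⟨s, b, hs0, hsδ, hb, hb1, hb2, hb3⟩
    have : Nonempty (TangentBundle (𝓡 n) Q) := ⟨a⟩
    choose! s b hsb using hex
    have hev : ∀ᶠ z in (𝒰 : Filter (TangentBundle (𝓡 n) Q)),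
        z ∈ B.nonGrazing ∧ (δ, z) ∈ B.domain ∧ ¬ (δ : EReal) ≤ B.hitTime 1 z := by
      filter_upwards [hD, hcase] with z h1 h2 using ⟨h1.1, h1.2, h2⟩
    have hevsb := hev.mono hsb
    obtain ⟨s₀, hs₀, hs₀lim⟩ : ∃ s₀ ∈ Icc 0 δ, Tendsto s 𝒰 (𝓝 s₀) := by
      refine isCompact_Icc.ultrafilter_le_nhds (𝒰.map s) (le_principal_iff.2 ?_)
      exact hevsb.mono fun z hz => (⟨hz.1.le, hz.2.1.le⟩ : s z ∈ Icc 0 δ)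
    have hLb : Tendsto (fun z => B.launch 1 (b z)) 𝒰 (𝓝 (B.geod s₀ a₁)) := by
      have h1 : Tendsto (fun z => B.geod (-(δ - s z)) (B.flow δ z)) 𝒰
          (𝓝 (B.geod (-(δ - s₀)) r)) :=
        (hcont s₀ hs₀).tendsto.comp ((tendsto_const_nhds.sub hs₀lim).neg.prodMk_nhds hBf)
      rw [hback] at h1
      refine h1.congr' ?_
      filter_upwards [hevsb] with z hz
      rw [hz.2.2.2.2.1, B.geod_add, neg_add_cancel, B.geod_zero]
    -- The limit of the collision points lies in the closed obstacle set, but the flight of `a₁`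
    -- avoids it at the times in `(0, δ]`.
    have hs₀0 : s₀ = 0 := by
      by_contra h0
      have h1 : (B.geod s₀ a₁).1 ∈ B.obstacle := by
        refine B.isClosed_obstacle.mem_of_tendsto
          ((continuous_tangentBundle_proj.tendsto _).comp hLb) ?_
        filter_upwards [hevsb] with z hz
        change (B.launch 1 (b z)).1 ∈ _
        rw [B.launch_fst]
        exact B.mem_obstacle_of_mem_phaseBdry hz.2.2.1.1
      have h2 := B.not_mem_obstacle_of_lt_hitTime (σ := 1) (p := a) (s := s₀)
        (lt_of_le_of_ne hs₀.1 (Ne.symm h0)) ((EReal.coe_le_coe_iff.2 hs₀.2).trans_lt hδhit)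
      rw [one_mul] at h2
      exact h2 h1
    rw [hs₀0] at hs₀lim
    rw [hs₀0, B.geod_zero] at hLb
    have hb2 : Tendsto b 𝒰 (𝓝 a₂) := by
      have hz2 : ∀ᶠ z in (𝒰 : Filter (TangentBundle (𝓡 n) Q)),
          B.launch 1 (b z) = B.reflect (b z) := by
        filter_upwards [hevsb] with z hz using B.launch_of_pos hz.2.2.1.1 hz.2.2.2.1
      have h1 := (B.continuousWithinAt_reflect ha₁b.1.2).tendsto.comp
        (tendsto_nhdsWithin_iff.2 ⟨hLb, by
          filter_upwards [hevsb] with z hz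
          rw [B.launch_fst]; exact hz.2.2.1.1.2⟩)
      refine h1.congr' ?_
      filter_upwards [hevsb, hz2] with z hz hz2
      change B.reflect (B.launch 1 (b z)) = _
      rw [hz2, B.reflect_reflect hz.2.2.1.1.2]
    refine le_nhds_of_tendsto_launch hN ha₂b ?_
    have h1 : Tendsto (fun z => B.geod (-s z) (b z)) 𝒰 (𝓝 a₂) :=
      (continuousAt_geodesicFlow_zero B.complete a₂).comp
        ((by simpa using hs₀lim.neg : Tendsto (fun z => -s z) 𝒰 (𝓝 0)).prodMk_nhds hb2)
    refine h1.congr' ?_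
    filter_upwards [hevsb, hb2.eventually hct, hs₀lim.eventually (gt_mem_nhds hc)]
      with z hz hzt hzc
    -- If the last collision is also the first one, the launch of `z` lies a vanishing time before
    -- it. An earlier collision would put the backward trajectory of an almost arriving vector into
    -- the obstacle set within a short time, against transversality at `a₂`.
    rcases hz.2.2.2.2.2 with h2 | ⟨s', h3, h4, h5⟩
    · rw [h2, B.geod_add, neg_add_cancel, B.geod_zero]
    · have h6 := (hzt hz.2.2.1.1.2 (-s') (neg_ne_zero.2 h3.ne')
        (by rw [abs_neg, abs_of_pos h3]; linarith)).1 h5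
      nlinarith

/-- The projection onto the model is proper. -/
theorem isCompact_preimage {W : Set 𝓜} (hW : IsCompact W) :
    IsCompact (B.nonGrazing ∩ m.proj ⁻¹' W) := by
  rw [isCompact_iff_ultrafilter_le_nhds]
  intro 𝒰 h𝒰
  have hN : B.nonGrazing ∈ 𝒰 := mem_of_superset (le_principal_iff.1 h𝒰) inter_subset_left
  have hWU : m.proj ⁻¹' W ∈ 𝒰 := mem_of_superset (le_principal_iff.1 h𝒰) inter_subset_right
  obtain ⟨p, hp, hlim⟩ := hW.ultrafilter_le_nhds (𝒰.map m.proj) (le_principal_iff.2 hWU)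
  replace hlim : Tendsto m.proj 𝒰 (𝓝 p) := hlim
  obtain ⟨x, hx, hx'⟩ : ∃ x ∈ B.nonGrazing, (𝒰 : Filter (TangentBundle (𝓡 n) Q)) ≤ 𝓝 x := by
    by_cases hpg : p ∈ m.gluing
    · exact m.exists_le_nhds_of_mem_gluing hN hpg hlim
    · exact m.exists_le_nhds_of_not_mem_gluing hN hpg hlim
  refine ⟨x, ⟨hx, ?_⟩, hx'⟩
  have h1 : Tendsto m.proj 𝒰 (𝓝 (m.proj x)) :=
    (m.proj_smooth.continuousOn x hx).tendsto.mono_left (le_inf hx' (le_principal_iff.2 hN))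
  change m.proj x ∈ W
  rwa [tendsto_nhds_unique h1 hlim]

/-- Compact sets are pushed forward by continuity and pulled back by properness of `π`. -/
theorem proj_mem_trapped_iff {q : TangentBundle (𝓡 n) Q} (hq : q ∈ B.nonGrazing) :
    m.proj q ∈ m.trapped ↔ q ∈ B.trapped := by
  constructor
  · rintro ⟨h1, W, hW, hW'⟩
    have hd : ∀ t : ℝ, (t, q) ∈ B.domain := fun t => (m.mem_domain_iff hq).1 (h1 t)
    refine ⟨hq, hd, _, m.isCompact_preimage hW, inter_subset_left, fun t => ?_⟩
    refine ⟨B.flow_mem_nonGrazing (hd t), ?_⟩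
    rw [mem_preimage, ← m.flow_proj (hd t)]
    exact hW' t
  · rintro ⟨-, hd, W, hW, hWN, hW'⟩
    refine ⟨fun t => m.mem_domain (hd t), m.proj '' W,
      hW.image_of_continuousOn (m.proj_smooth.continuousOn.mono hWN), fun t => ?_⟩
    rw [m.flow_proj (hd t)]
    exact mem_image_of_mem _ (hW' t)

theorem trapped_eq_image : m.trapped = m.proj '' B.trapped := by
  ext p
  constructor
  · intro h
    obtain ⟨q, hq, rfl⟩ := m.proj_surj p
    exact ⟨q, (m.proj_mem_trapped_iff hq).1 h, rfl⟩
  · rintro ⟨q, hq, rfl⟩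
    exact (m.proj_mem_trapped_iff hq.1).2 hq

theorem isCompact_trapped (h : IsCompact B.trapped) : IsCompact m.trapped := by
  rw [m.trapped_eq_image]
  exact h.image_of_continuousOn (m.proj_smooth.continuousOn.mono fun q hq => hq.1)

variable {m}

theorem domain_flow_of_mem_trapped {p : 𝓜} (hp : p ∈ m.trapped) (s t : ℝ) :
    (s, m.flow t p) ∈ m.domain := by
  rw [m.trapped_eq_image] at hp
  obtain ⟨q, hq, rfl⟩ := hp
  rw [m.flow_proj (hq.2.1 t)]
  exact m.mem_domain (B.complete_iff.1 ((B.complete_iff.2 hq.2.1).flow t) s)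

theorem flow_add_of_mem_trapped {p : 𝓜} (hp : p ∈ m.trapped) (s t : ℝ) :
    m.flow t (m.flow s p) = m.flow (t + s) p :=
  (m.flow_add s t p (hp.1 s) (domain_flow_of_mem_trapped hp t s) (hp.1 _)).symm

theorem flow_mem_trapped {p : 𝓜} (hp : p ∈ m.trapped) (t : ℝ) : m.flow t p ∈ m.trapped := by
  obtain ⟨W, hW, hW'⟩ := hp.2
  refine ⟨fun s => domain_flow_of_mem_trapped hp s t, W, hW, fun s => ?_⟩
  rw [flow_add_of_mem_trapped hp]
  exact hW' _

end SmoothModel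

end ModelTopology

/-! ### The radial retraction onto the unit tangent bundle. -/

section UnitRetraction

variable {n : ℕ} {Q : Type*} [TopologicalSpace Q] [ChartedSpace (EuclideanSpace ℝ (Fin n)) Q]
  [IsManifold (𝓡 n) ∞ Q] (g : RiemMetric n Q)

theorem contMDiffAt_normSq (q : TangentBundle (𝓡 n) Q) :
    ContMDiffAt (𝓡 n).tangent 𝓘(ℝ, ℝ) ∞ (normSq g) q := by
  set Ψ := extChartAt (𝓡 n).tangent q with hΨ
  have hsrc : ∀ᶠ p in 𝓝 q, p ∈ Ψ.source :=
    (isOpen_extChartAt_source q).mem_nhds (mem_extChartAt_source q)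
  have h1 : normSq g =ᶠ[𝓝 q] (fun z : EuclideanSpace ℝ (Fin n) × EuclideanSpace ℝ (Fin n) =>
      g.chartForm q.1 z.1 z.2 z.2) ∘ Ψ := by
    filter_upwards [hsrc] with p hp
    have hp' := (mem_extChartAt_tangent_source q p).1 hp
    rw [g.normSq_eq_chartForm q p hp', Function.comp_apply, hΨ, extChartAt_tangent_apply q p hp']
  refine ContMDiffAt.congr_of_eventuallyEq ?_ h1
  have hq : (Ψ q).1 ∈ (extChartAt (𝓡 n) q.1).target := by
    rw [hΨ, extChartAt_tangent_apply q q (mem_extChartAt_source q.1)]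
    exact mem_extChartAt_target q.1
  have h2 : ContDiffAt ℝ ∞ (g.chartForm q.1) (Ψ q).1 :=
    (g.contDiffOn_chartForm q.1).contDiffAt ((isOpen_extChartAt_target q.1).mem_nhds hq)
  have h3 : ContDiffAt ℝ ∞ (fun z : EuclideanSpace ℝ (Fin n) × EuclideanSpace ℝ (Fin n) =>
      g.chartForm q.1 z.1 z.2 z.2) (Ψ q) :=
    ((h2.comp (Ψ q) contDiffAt_fst).clm_apply contDiffAt_snd).clm_apply contDiffAt_snd
  exact h3.contMDiffAt.comp q contMDiffAt_extChartAt

/-- The radial retraction of the tangent bundle without zero section onto the unit tangent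
bundle. -/
def unitRetract (p : TangentBundle (𝓡 n) Q) : TangentBundle (𝓡 n) Q :=
  ⟨p.1, (√(normSq g p))⁻¹ • p.2⟩

variable {g}

theorem unitRetract_of_mem {p : TangentBundle (𝓡 n) Q} (hp : p ∈ unitBundle g) :
    unitRetract g p = p := by
  have h : normSq g p = 1 := hp
  unfold unitRetract
  rw [h, Real.sqrt_one, inv_one, one_smul]

theorem unitRetract_mem {p : TangentBundle (𝓡 n) Q} (hp : 0 < normSq g p) :
    unitRetract g p ∈ unitBundle g := by
  have h : ∀ (c : ℝ) (v : EuclideanSpace ℝ (Fin n)),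
      g.form p.1 (c • v) (c • v) = c * (c * g.form p.1 v v) := fun c v => by
    simp only [map_smul, smul_apply, smul_eq_mul]
  refine (h _ p.2).trans ?_
  change (√(normSq g p))⁻¹ * ((√(normSq g p))⁻¹ * normSq g p) = 1
  have h2 := Real.sq_sqrt hp.le
  have h3 := (Real.sqrt_pos.2 hp).ne'
  field_simp
  exact h2.symm

theorem extChartAt_unitRetract (q : TangentBundle (𝓡 n) Q) {p : TangentBundle (𝓡 n) Q}
    (hp : p ∈ (extChartAt (𝓡 n).tangent q).source) :
    extChartAt (𝓡 n).tangent q (unitRetract g p) =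
      ((extChartAt (𝓡 n).tangent q p).1,
        (√(normSq g p))⁻¹ • (extChartAt (𝓡 n).tangent q p).2) := by
  have hp' := (mem_extChartAt_tangent_source q p).1 hp
  rw [extChartAt_tangent_apply q p hp', extChartAt_tangent_apply q (unitRetract g p) hp']
  refine Prod.ext rfl ?_
  have h : ∀ (L : EuclideanSpace ℝ (Fin n) →L[ℝ] EuclideanSpace ℝ (Fin n)) (c : ℝ) v,
      L (c • v) = c • L v := fun L c v => map_smul L c v
  exact h _ _ _

theorem contMDiffAt_inv_sqrt_normSq {q : TangentBundle (𝓡 n) Q} (hq : 0 < normSq g q) :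
    ContMDiffAt (𝓡 n).tangent 𝓘(ℝ, ℝ) ∞ (fun p => (√(normSq g p))⁻¹) q := by
  have h1 : ContDiffAt ℝ ∞ (fun x : ℝ => (√x)⁻¹) (normSq g q) :=
    (Real.contDiffAt_sqrt hq.ne').inv (Real.sqrt_pos.2 hq).ne'
  exact h1.contMDiffAt.comp q (contMDiffAt_normSq g q)

theorem contMDiffAt_unitRetract {q : TangentBundle (𝓡 n) Q} (hq : 0 < normSq g q) :
    ContMDiffAt (𝓡 n).tangent (𝓡 n).tangent ∞ (unitRetract g) q := by
  set Ψ := extChartAt (𝓡 n).tangent q with hΨ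
  have hsrc : ∀ᶠ p in 𝓝 q, p ∈ Ψ.source :=
    (isOpen_extChartAt_source q).mem_nhds (mem_extChartAt_source q)
  have hev : unitRetract g =ᶠ[𝓝 q]
      fun p => Ψ.symm ((Ψ p).1, (√(normSq g p))⁻¹ • (Ψ p).2) := by
    filter_upwards [hsrc] with p hp
    rw [← extChartAt_unitRetract q hp, Ψ.left_inv]
    exact (mem_extChartAt_tangent_source q _).2 ((mem_extChartAt_tangent_source q p).1 hp)
  refine ContMDiffAt.congr_of_eventuallyEq ?_ hev
  have hΨc : ContMDiffAt (𝓡 n).tangent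
      𝓘(ℝ, EuclideanSpace ℝ (Fin n) × EuclideanSpace ℝ (Fin n)) ∞ Ψ q := contMDiffAt_extChartAt
  have h1 : ContMDiffAt (𝓡 n).tangent 𝓘(ℝ, EuclideanSpace ℝ (Fin n)) ∞ (fun p => (Ψ p).1) q :=
    contDiffAt_fst.contMDiffAt.comp q hΨc
  have h2 : ContMDiffAt (𝓡 n).tangent 𝓘(ℝ, EuclideanSpace ℝ (Fin n)) ∞ (fun p => (Ψ p).2) q :=
    contDiffAt_snd.contMDiffAt.comp q hΨc
  have h3 := h1.prodMk_space ((contMDiffAt_inv_sqrt_normSq hq).smul h2)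
  have hmem : ((Ψ q).1, (√(normSq g q))⁻¹ • (Ψ q).2) ∈ Ψ.target := by
    rw [← extChartAt_unitRetract q hsrc.self_of_nhds]
    exact Ψ.map_source ((mem_extChartAt_tangent_source q _).2 (mem_extChartAt_source q.1))
  have h4 : ContMDiffAt 𝓘(ℝ, EuclideanSpace ℝ (Fin n) × EuclideanSpace ℝ (Fin n)) (𝓡 n).tangent ∞
      Ψ.symm ((Ψ q).1, (√(normSq g q))⁻¹ • (Ψ q).2) :=
    (contMDiffOn_extChartAt_symm q).contMDiffAt ((isOpen_extChartAt_target q).mem_nhds hmem)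
  exact h4.comp q h3

/-- The differential of the radial retraction is the identity on the tangent spaces of the unit
tangent bundle. -/
theorem mfderiv_unitRetract_apply {q : TangentBundle (𝓡 n) Q} (hq : q ∈ unitBundle g)
    (W : EuclideanSpace ℝ (Fin n) × EuclideanSpace ℝ (Fin n)) (hW : W ∈ unitTangent g q) :
    (mfderiv (𝓡 n).tangent (𝓡 n).tangent (unitRetract g) q :
      EuclideanSpace ℝ (Fin n) × EuclideanSpace ℝ (Fin n) →L[ℝ]
        EuclideanSpace ℝ (Fin n) × EuclideanSpace ℝ (Fin n)) W = W := by
  have hq1 : normSq g q = 1 := hq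
  have hq0 : 0 < normSq g q := hq1 ▸ one_pos
  have hmd : MDifferentiableAt (𝓡 n).tangent (𝓡 n).tangent (unitRetract g) q :=
    (contMDiffAt_unitRetract hq0).mdifferentiableAt (by simp)
  have hnd : MDifferentiableAt (𝓡 n).tangent 𝓘(ℝ, ℝ) (normSq g) q :=
    (contMDiffAt_normSq g q).mdifferentiableAt (by simp)
  set Ψ := extChartAt (𝓡 n).tangent q with hΨ
  have hnf : HasFDerivAt (normSq g ∘ Ψ.symm) (mfderiv (𝓡 n).tangent 𝓘(ℝ, ℝ) (normSq g) q :
      EuclideanSpace ℝ (Fin n) × EuclideanSpace ℝ (Fin n) →L[ℝ] ℝ) (Ψ q) := by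
    have h := hnd.hasMFDerivAt.2
    rw [ModelWithCorners.range_eq_univ] at h
    exact hasFDerivWithinAt_univ.1 h
  set L : EuclideanSpace ℝ (Fin n) × EuclideanSpace ℝ (Fin n) →L[ℝ] ℝ :=
    mfderiv (𝓡 n).tangent 𝓘(ℝ, ℝ) (normSq g) q with hL
  have hLW : L W = 0 := hW
  have hΨq : (normSq g ∘ Ψ.symm) (Ψ q) = 1 := by
    rw [Function.comp_apply, Ψ.left_inv (mem_extChartAt_source q), hq1]
  -- The value of `d` is irrelevant: the differential of the scaling factor is a multiple of that of
  -- `normSq`, which vanishes on `W`.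
  have hη : ∃ d : ℝ, HasFDerivAt (fun z => (√((normSq g ∘ Ψ.symm) z))⁻¹) (d • L) (Ψ q) := by
    have h1 : DifferentiableAt ℝ (fun x : ℝ => (√x)⁻¹) ((normSq g ∘ Ψ.symm) (Ψ q)) := by
      rw [hΨq]
      exact ((Real.contDiffAt_sqrt (n := 1) one_ne_zero).inv
        (by rw [Real.sqrt_one]; exact one_ne_zero)).differentiableAt (by simp)
    exact ⟨_, h1.hasDerivAt.comp_hasFDerivAt _ hnf⟩
  obtain ⟨d, hd⟩ := hη
  set R : EuclideanSpace ℝ (Fin n) × EuclideanSpace ℝ (Fin n) →L[ℝ]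
      EuclideanSpace ℝ (Fin n) × EuclideanSpace ℝ (Fin n) :=
    mfderiv (𝓡 n).tangent (𝓡 n).tangent (unitRetract g) q with hR
  have hρ : HasFDerivAt (writtenInExtChartAt (𝓡 n).tangent (𝓡 n).tangent q (unitRetract g)) R
      (Ψ q) := by
    have h := hmd.hasMFDerivAt.2
    rw [ModelWithCorners.range_eq_univ] at h
    exact hasFDerivWithinAt_univ.1 h
  have hw : writtenInExtChartAt (𝓡 n).tangent (𝓡 n).tangent q (unitRetract g) =ᶠ[𝓝 (Ψ q)]
      fun z => (z.1, (√((normSq g ∘ Ψ.symm) z))⁻¹ • z.2) := by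
    have ht : ∀ᶠ z in 𝓝 (Ψ q), z ∈ Ψ.target :=
      (isOpen_extChartAt_target q).mem_nhds (mem_extChartAt_target q)
    filter_upwards [ht] with z hz
    rw [writtenInExtChartAt, unitRetract_of_mem hq]
    change extChartAt (𝓡 n).tangent q (unitRetract g (Ψ.symm z)) = _
    rw [extChartAt_unitRetract q (Ψ.map_target hz), Ψ.right_inv hz]
    rfl
  have h1 := (hasFDerivAt_fst (p := Ψ q)).prodMk (hd.smul (hasFDerivAt_snd (p := Ψ q)))
  have h2 := (h1.congr_of_eventuallyEq hw).unique hρ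
  have h3 : (√((normSq g ∘ Ψ.symm) (Ψ q)))⁻¹ = 1 := by rw [hΨq]; simp
  rw [h3] at h2
  refine (congrArg (fun M => M W) h2).symm.trans ?_
  refine Prod.ext rfl ?_
  change (1 : ℝ) • W.2 + (d * L W) • (Ψ q).2 = W.2
  rw [hLW]; simp

end UnitRetraction

theorem continuousOn_tangentMap {E E' H H' M M' : Type*} [NormedAddCommGroup E]
    [NormedSpace ℝ E] [NormedAddCommGroup E'] [NormedSpace ℝ E'] [TopologicalSpace H]
    [TopologicalSpace H'] {I : ModelWithCorners ℝ E H} {I' : ModelWithCorners ℝ E' H'}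
    [TopologicalSpace M] [ChartedSpace H M] [IsManifold I 1 M]
    [TopologicalSpace M'] [ChartedSpace H' M'] [IsManifold I' 1 M'] {f : M → M'} {s : Set M}
    (hs : IsOpen s) (hf : ContMDiffOn I I' 1 f s) :
    ContinuousOn (tangentMap I I' f) ((fun W : TangentBundle I M => W.1) ⁻¹' s) :=
  (hf.continuousOn_tangentMapWithin le_rfl hs.uniqueMDiffOn).congr fun W hW =>
    (tangentMapWithin_eq_tangentMap (hs.uniqueMDiffOn W.1 hW)
      ((hf.contMDiffAt (hs.mem_nhds hW)).mdifferentiableAt (by simp))).symm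

/-! ### Differentials of the projection, its inverse and the flows. -/

section ModelDifferentials

variable {n : ℕ} {Q : Type*} [TopologicalSpace Q] [ChartedSpace (EuclideanSpace ℝ (Fin n)) Q]
  [IsManifold (𝓡 n) ∞ Q] [T2Space Q] {B : BilliardSystem n Q}
  {E : Type*} [NormedAddCommGroup E] [NormedSpace ℝ E]
  {𝓜 : Type*} [TopologicalSpace 𝓜] [T2Space 𝓜] [ChartedSpace E 𝓜] (m : SmoothModel B E 𝓜)

namespace SmoothModel

/-- The inverse of the projection off the gluing region. -/
def lift : 𝓜 → TangentBundle (𝓡 n) Q := m.exists_smooth_inverse.choose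

theorem lift_proj {q : TangentBundle (𝓡 n) Q} (hq : q ∈ B.phaseInt) : m.lift (m.proj q) = q :=
  m.exists_smooth_inverse.choose_spec.2 q hq

theorem isOpen_compl_gluing : IsOpen m.gluingᶜ := m.isClosed_gluing.isOpen_compl

theorem contMDiffOn_lift : ContMDiffOn 𝓘(ℝ, E) (𝓡 n).tangent ∞ m.lift m.gluingᶜ := by
  rw [m.compl_gluing]
  exact m.exists_smooth_inverse.choose_spec.1

variable {p : 𝓜}

theorem lift_mem (hp : p ∉ m.gluing) : m.lift p ∈ B.phaseInt := by
  have hp' : p ∈ m.proj '' B.phaseInt := m.compl_gluing ▸ hp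
  obtain ⟨q, hq, rfl⟩ := hp'
  rwa [m.lift_proj hq]

theorem proj_lift (hp : p ∉ m.gluing) : m.proj (m.lift p) = p := by
  have hp' : p ∈ m.proj '' B.phaseInt := m.compl_gluing ▸ hp
  obtain ⟨q, hq, rfl⟩ := hp'
  rw [m.lift_proj hq]

theorem lift_mem_trapped (hp : p ∉ m.gluing) : m.lift p ∈ B.trapped ↔ p ∈ m.trapped := by
  rw [← m.proj_mem_trapped_iff (B.phaseInt_subset_nonGrazing (m.lift_mem hp)), m.proj_lift hp]

theorem contMDiffAt_lift (hp : p ∉ m.gluing) :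
    ContMDiffAt 𝓘(ℝ, E) (𝓡 n).tangent ∞ m.lift p :=
  m.contMDiffOn_lift.contMDiffAt (m.isOpen_compl_gluing.mem_nhds hp)

/-- The differential of the inverse of the projection. -/
def dlift (p : 𝓜) : E →L[ℝ] EuclideanSpace ℝ (Fin n) × EuclideanSpace ℝ (Fin n) :=
  mfderiv 𝓘(ℝ, E) (𝓡 n).tangent m.lift p

theorem hasMFDerivAt_lift (hp : p ∉ m.gluing) :
    HasMFDerivAt 𝓘(ℝ, E) (𝓡 n).tangent m.lift p (m.dlift p) :=
  ((m.contMDiffAt_lift hp).mdifferentiableAt (by simp)).hasMFDerivAt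

/-- Derivatives within the phase space become derivatives on the model. -/
theorem hasMFDerivAt_comp_lift {F H N : Type*} [NormedAddCommGroup F] [NormedSpace ℝ F]
    [TopologicalSpace H] {J : ModelWithCorners ℝ F H} [TopologicalSpace N] [ChartedSpace H N]
    {f : TangentBundle (𝓡 n) Q → N} (hp : p ∉ m.gluing)
    (hf : MDifferentiableWithinAt (𝓡 n).tangent J f B.phaseInt (m.lift p)) :
    HasMFDerivAt 𝓘(ℝ, E) J (f ∘ m.lift) p
      ((mfderivWithin (𝓡 n).tangent J f B.phaseInt (m.lift p)).comp (m.dlift p)) :=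
  (hf.hasMFDerivWithinAt.comp p (m.hasMFDerivAt_lift hp).hasMFDerivWithinAt
    fun _ hx => m.lift_mem hx).hasMFDerivAt (m.isOpen_compl_gluing.mem_nhds hp)

theorem mdifferentiableWithinAt_proj {q : TangentBundle (𝓡 n) Q} (hq : q ∈ B.phaseInt) :
    MDifferentiableWithinAt (𝓡 n).tangent 𝓘(ℝ, E) m.proj B.phaseInt q :=
  ((m.proj_smooth q (B.phaseInt_subset_nonGrazing hq)).mdifferentiableWithinAt (by simp)).mono
    B.phaseInt_subset_nonGrazing

theorem dproj_dlift (hp : p ∉ m.gluing) (w : E) :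
    (m.dproj (m.lift p) : EuclideanSpace ℝ (Fin n) × EuclideanSpace ℝ (Fin n) →L[ℝ] E)
      (m.dlift p w) = w := by
  have h1 := m.hasMFDerivAt_comp_lift hp (m.mdifferentiableWithinAt_proj (m.lift_mem hp))
  have h2 : HasMFDerivAt 𝓘(ℝ, E) 𝓘(ℝ, E) (m.proj ∘ m.lift) p
      (ContinuousLinearMap.id ℝ (TangentSpace 𝓘(ℝ, E) p)) := by
    refine (hasMFDerivAt_id p).congr_of_eventuallyEq ?_
    filter_upwards [m.isOpen_compl_gluing.mem_nhds hp] with x hx using m.proj_lift hx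
  exact congrArg (fun L => L w) (hasMFDerivAt_unique h1 h2)

/-- `normSq` is constant along `lift`, whose values are unit vectors. -/
theorem dlift_mem (hp : p ∉ m.gluing) (w : E) :
    (m.dlift p w) ∈ unitTangent B.metric (m.lift p) := by
  have h0 : MDifferentiableAt (𝓡 n).tangent 𝓘(ℝ, ℝ) (normSq B.metric) (m.lift p) :=
    (contMDiffAt_normSq B.metric _).mdifferentiableAt (by simp)
  have h1 := h0.hasMFDerivAt.comp p (m.hasMFDerivAt_lift hp)
  have h2 : HasMFDerivAt 𝓘(ℝ, E) 𝓘(ℝ, ℝ) (normSq B.metric ∘ m.lift) p 0 := by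
    refine (hasMFDerivAt_const (1 : ℝ) p).congr_of_eventuallyEq ?_
    filter_upwards [m.isOpen_compl_gluing.mem_nhds hp] with x hx using (m.lift_mem hx).1
  exact congrArg (fun L => L w) (hasMFDerivAt_unique h1 h2)

theorem isOpen_retractDomain :
    IsOpen {q : TangentBundle (𝓡 n) Q | 0 < normSq B.metric q ∧ q.1 ∉ B.obstacle} :=
  (isOpen_lt continuous_const (continuous_iff_continuousAt.2 fun q =>
    (contMDiffAt_normSq B.metric q).continuousAt)).inter
    (B.isClosed_obstacle.isOpen_compl.preimage continuous_tangentBundle_proj)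

theorem mem_retractDomain {q : TangentBundle (𝓡 n) Q} (hq : q ∈ B.phaseInt) :
    0 < normSq B.metric q ∧ q.1 ∉ B.obstacle := by
  have h : normSq B.metric q = 1 := hq.1
  exact ⟨h ▸ one_pos, hq.2⟩

/-- The phase space has no interior in `TQ`, so `dproj q` is some derivative within a set and not
unique. After composition with the retraction of an open set it becomes an honest derivative. -/
theorem hasMFDerivAt_proj_unitRetract {q : TangentBundle (𝓡 n) Q} (hq : q ∈ B.phaseInt) :
    HasMFDerivAt (𝓡 n).tangent 𝓘(ℝ, E) (m.proj ∘ unitRetract B.metric) q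
      ((m.dproj q : EuclideanSpace ℝ (Fin n) × EuclideanSpace ℝ (Fin n) →L[ℝ] E).comp
        (mfderiv (𝓡 n).tangent (𝓡 n).tangent (unitRetract B.metric) q :
          EuclideanSpace ℝ (Fin n) × EuclideanSpace ℝ (Fin n) →L[ℝ]
          EuclideanSpace ℝ (Fin n) × EuclideanSpace ℝ (Fin n))) := by
  have hO := isOpen_retractDomain.mem_nhds (mem_retractDomain hq)
  -- The chain rule asks for the derivative at `unitRetract B.metric q`, which equals `q` only
  -- propositionally; a variable base point allows substitution.
  have h1 : ∀ q' : TangentBundle (𝓡 n) Q, q' = q → HasMFDerivWithinAt (𝓡 n).tangent 𝓘(ℝ, E)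
      m.proj B.phaseInt q'
      (m.dproj q : EuclideanSpace ℝ (Fin n) × EuclideanSpace ℝ (Fin n) →L[ℝ] E) := by
    rintro q' rfl
    exact (m.mdifferentiableWithinAt_proj hq).hasMFDerivWithinAt
  have h2 : HasMFDerivAt (𝓡 n).tangent (𝓡 n).tangent (unitRetract B.metric) q
      (mfderiv (𝓡 n).tangent (𝓡 n).tangent (unitRetract B.metric) q) :=
    ((contMDiffAt_unitRetract (mem_retractDomain hq).1).mdifferentiableAt (by simp)).hasMFDerivAt
  exact ((h1 _ (unitRetract_of_mem hq.1)).comp q (h2.hasMFDerivWithinAt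
    (s := {q : TangentBundle (𝓡 n) Q | 0 < normSq B.metric q ∧ q.1 ∉ B.obstacle}))
    fun _ hx => ⟨unitRetract_mem hx.1, hx.2⟩).hasMFDerivAt hO

theorem mfderiv_proj_unitRetract_apply {q : TangentBundle (𝓡 n) Q} (hq : q ∈ B.phaseInt)
    (W : EuclideanSpace ℝ (Fin n) × EuclideanSpace ℝ (Fin n)) (hW : W ∈ unitTangent B.metric q) :
    (mfderiv (𝓡 n).tangent 𝓘(ℝ, E) (m.proj ∘ unitRetract B.metric) q :
      EuclideanSpace ℝ (Fin n) × EuclideanSpace ℝ (Fin n) →L[ℝ] E) W =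
    (m.dproj q : EuclideanSpace ℝ (Fin n) × EuclideanSpace ℝ (Fin n) →L[ℝ] E) W := by
  refine (congrArg (fun L => L W) (m.hasMFDerivAt_proj_unitRetract hq).mfderiv).trans ?_
  exact congrArg (m.dproj q : EuclideanSpace ℝ (Fin n) × EuclideanSpace ℝ (Fin n) →L[ℝ] E)
    (mfderiv_unitRetract_apply hq.1 W hW)

/-- Differentiate `lift ∘ π ∘ r = r` near the point, where `r` is the radial retraction, and use
that `dr` fixes `W`. -/
theorem dlift_dproj (hp : p ∉ m.gluing)
    (W : EuclideanSpace ℝ (Fin n) × EuclideanSpace ℝ (Fin n))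
    (hW : W ∈ unitTangent B.metric (m.lift p)) :
    m.dlift p ((m.dproj (m.lift p) :
      EuclideanSpace ℝ (Fin n) × EuclideanSpace ℝ (Fin n) →L[ℝ] E) W) = W := by
  have hq := m.lift_mem hp
  have hO : ∀ᶠ x in 𝓝 (m.lift p), 0 < normSq B.metric x ∧ x.1 ∉ B.obstacle :=
    isOpen_retractDomain.mem_nhds (mem_retractDomain hq)
  have h1 : ∀ p' : 𝓜, p' = p → HasMFDerivAt 𝓘(ℝ, E) (𝓡 n).tangent m.lift p' (m.dlift p) := by
    rintro _ rfl
    exact m.hasMFDerivAt_lift hp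
  have h2 := (h1 ((m.proj ∘ unitRetract B.metric) (m.lift p)) (by
    rw [Function.comp_apply, unitRetract_of_mem hq.1, m.proj_lift hp])).comp (m.lift p)
    (m.hasMFDerivAt_proj_unitRetract hq)
  have h3 := ((contMDiffAt_unitRetract (mem_retractDomain hq).1).mdifferentiableAt
    (by simp)).hasMFDerivAt.congr_of_eventuallyEq
      (f₁ := m.lift ∘ (m.proj ∘ unitRetract B.metric)) (by
    filter_upwards [hO] with x hx
    exact m.lift_proj ⟨unitRetract_mem hx.1, hx.2⟩)
  have h4 := congrArg (fun L => L W) (hasMFDerivAt_unique h2 h3)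
  have h5 := mfderiv_unitRetract_apply hq.1 W hW
  have h6 : m.dlift p ((m.dproj (m.lift p) :
      EuclideanSpace ℝ (Fin n) × EuclideanSpace ℝ (Fin n) →L[ℝ] E)
      ((mfderiv (𝓡 n).tangent (𝓡 n).tangent (unitRetract B.metric) (m.lift p) :
          EuclideanSpace ℝ (Fin n) × EuclideanSpace ℝ (Fin n) →L[ℝ]
          EuclideanSpace ℝ (Fin n) × EuclideanSpace ℝ (Fin n)) W)) = _ := h4
  rw [h5] at h6
  exact h6.trans h5

theorem flow_lift {t : ℝ} (hp : p ∉ m.gluing) (ht : (t, p) ∈ m.domain)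
    (hp' : m.flow t p ∉ m.gluing) : B.flow t (m.lift p) = m.lift (m.flow t p) := by
  have hN := B.phaseInt_subset_nonGrazing (m.lift_mem hp)
  rw [← m.proj_lift hp, m.mem_domain_iff hN] at ht
  have h := m.flow_proj ht
  rw [m.proj_lift hp] at h
  rw [h] at hp' ⊢
  rw [m.lift_proj (m.mem_phaseInt_of_not_mem_gluing (B.flow_mem_nonGrazing ht) hp')]

theorem contMDiffAt_flow {t : ℝ} (ht : (t, p) ∈ m.domain) :
    ContMDiffAt 𝓘(ℝ, E) 𝓘(ℝ, E) ∞ (m.flow t) p :=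
  ((m.flow_smooth.contMDiffAt (m.isOpen_domain.mem_nhds ht)).comp p
    (contMDiffAt_const.prodMk contMDiffAt_id) :)

theorem hasMFDerivAt_flow {t : ℝ} (ht : (t, p) ∈ m.domain) :
    HasMFDerivAt 𝓘(ℝ, E) 𝓘(ℝ, E) (m.flow t) p (m.dflow t p) :=
  ((m.contMDiffAt_flow ht).mdifferentiableAt (by simp)).hasMFDerivAt

theorem eventually_mem_domain {t : ℝ} (ht : (t, p) ∈ m.domain) :
    ∀ᶠ x in 𝓝 p, (t, x) ∈ m.domain := by
  have h : Tendsto (fun x => (t, x)) (𝓝 p) (𝓝 (t, p)) := (Continuous.prodMk_right t).tendsto p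
  exact h.eventually (m.isOpen_domain.mem_nhds ht)

/-- Both sides are the derivative of `lift ∘ φ_t` on the model, where derivatives are unique. -/
theorem dflow_dlift {t : ℝ} (hp : p ∉ m.gluing) (ht : (t, p) ∈ m.domain)
    (hp' : m.flow t p ∉ m.gluing) (w : E) :
    (B.dflow t (m.lift p) : EuclideanSpace ℝ (Fin n) × EuclideanSpace ℝ (Fin n) →L[ℝ]
      EuclideanSpace ℝ (Fin n) × EuclideanSpace ℝ (Fin n)) (m.dlift p w) =
    m.dlift (m.flow t p) ((m.dflow t p : E →L[ℝ] E) w) := by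
  have hq := m.lift_mem hp
  have h1 : HasMFDerivAt 𝓘(ℝ, E) (𝓡 n).tangent (m.lift ∘ m.flow t) p _ :=
    (m.hasMFDerivAt_lift hp').comp p (m.hasMFDerivAt_flow ht)
  have hev : ∀ᶠ x in 𝓝 p, x ∉ m.gluing ∧ (t, x) ∈ m.domain ∧ m.flow t x ∉ m.gluing := by
    have h2 : ∀ᶠ x in 𝓝 p, x ∉ m.gluing := m.isOpen_compl_gluing.mem_nhds hp
    have h3 : ∀ᶠ x in 𝓝 p, m.flow t x ∉ m.gluing :=
      (m.contMDiffAt_flow ht).continuousAt.preimage_mem_nhds (m.isOpen_compl_gluing.mem_nhds hp')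
    exact h2.and ((m.eventually_mem_domain ht).and h3)
  -- Differentiability of the billiard flow is not given; it follows from writing the flow as `lift
  -- ∘ φ_t ∘ π` near the point.
  have hmd : MDifferentiableWithinAt (𝓡 n).tangent (𝓡 n).tangent (B.flow t) B.phaseInt
      (m.lift p) := by
    have h2 : MDifferentiableAt 𝓘(ℝ, E) (𝓡 n).tangent (m.lift ∘ m.flow t)
        (m.proj (m.lift p)) := by
      rw [m.proj_lift hp]; exact h1.mdifferentiableAt
    have h3 : MDifferentiableWithinAt (𝓡 n).tangent (𝓡 n).tangent
        ((m.lift ∘ m.flow t) ∘ m.proj) B.phaseInt (m.lift p) :=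
      h2.comp_mdifferentiableWithinAt _ (m.mdifferentiableWithinAt_proj hq)
    have h4 : ∀ᶠ x in 𝓝[B.phaseInt] (m.lift p), m.proj x ∉ m.gluing ∧
        (t, m.proj x) ∈ m.domain ∧ m.flow t (m.proj x) ∉ m.gluing := by
      have h5 := (m.mdifferentiableWithinAt_proj hq).continuousWithinAt.tendsto
      rw [m.proj_lift hp] at h5
      exact h5.eventually hev
    have key : ∀ x ∈ B.phaseInt, m.proj x ∉ m.gluing ∧
        (t, m.proj x) ∈ m.domain ∧ m.flow t (m.proj x) ∉ m.gluing →
        B.flow t x = ((m.lift ∘ m.flow t) ∘ m.proj) x := fun x hx h => by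
      have := m.flow_lift h.1 h.2.1 h.2.2
      rwa [m.lift_proj hx] at this
    refine h3.congr_of_eventuallyEq ?_ (key _ hq ?_)
    · filter_upwards [h4, self_mem_nhdsWithin] with x hx hx' using key x hx' hx
    · rw [m.proj_lift hp]; exact ⟨hp, ht, hp'⟩
  have h2 := (m.hasMFDerivAt_comp_lift hp hmd).congr_of_eventuallyEq
    (f₁ := m.lift ∘ m.flow t) (by
      filter_upwards [hev] with x hx using (m.flow_lift hx.1 hx.2.1 hx.2.2).symm)
  exact congrArg (fun L => L w) (hasMFDerivAt_unique h2 h1)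

theorem eventually_zero_mem_domain (p : 𝓜) : ∀ᶠ t in 𝓝 (0 : ℝ), (t, p) ∈ m.domain := by
  have h : Tendsto (fun t : ℝ => (t, p)) (𝓝 0) (𝓝 (0, p)) := (Continuous.prodMk_left p).tendsto 0
  exact h.eventually (m.isOpen_domain.mem_nhds (m.zero_mem_domain p))

theorem mdifferentiableAt_flow_left {t : ℝ} (ht : (t, p) ∈ m.domain) :
    MDifferentiableAt 𝓘(ℝ, ℝ) 𝓘(ℝ, E) (fun t : ℝ => m.flow t p) t :=
  (((m.flow_smooth.contMDiffAt (m.isOpen_domain.mem_nhds ht)).comp t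
    (contMDiffAt_id.prodMk contMDiffAt_const) :
    ContMDiffAt 𝓘(ℝ, ℝ) 𝓘(ℝ, E) ∞ (fun t : ℝ => m.flow t p) t)).mdifferentiableAt (by simp)

theorem flowDir_lift (hp : p ∉ m.gluing) :
    B.flowDir (m.lift p) = m.dlift p (m.generator p) := by
  have h1 : ∀ p' : 𝓜, p' = p → HasMFDerivAt 𝓘(ℝ, E) (𝓡 n).tangent m.lift p' (m.dlift p) := by
    rintro _ rfl
    exact m.hasMFDerivAt_lift hp
  have h2 := (h1 _ (m.flow_zero p)).comp (0 : ℝ)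
    (m.mdifferentiableAt_flow_left (m.zero_mem_domain p)).hasMFDerivAt
  have hev : (fun t => B.flow t (m.lift p)) =ᶠ[𝓝 0] m.lift ∘ fun t => m.flow t p := by
    have h3 : ∀ᶠ t in 𝓝 (0 : ℝ), m.flow t p ∉ m.gluing :=
      (m.tendsto_flow_zero p).eventually (m.isOpen_compl_gluing.mem_nhds hp)
    filter_upwards [h3, m.eventually_zero_mem_domain p] with t ht ht'
    exact m.flow_lift hp ht' ht
  exact congrArg (fun L => L (1 : ℝ)) (h2.congr_of_eventuallyEq hev).mfderiv

variable [IsManifold 𝓘(ℝ, E) ∞ 𝓜]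

theorem continuousOn_dlift :
    ContinuousOn (fun W : TangentBundle 𝓘(ℝ, E) 𝓜 =>
      (⟨m.lift W.1, m.dlift W.1 W.2⟩ : TangentBundle (𝓡 n).tangent (TangentBundle (𝓡 n) Q)))
      {W | W.1 ∉ m.gluing} :=
  continuousOn_tangentMap m.isOpen_compl_gluing (m.contMDiffOn_lift.of_le (by simp))

/-- On unit tangent vectors `dproj` is the tangent map of `π ∘ r`, with `r` the radial retraction, a
`C¹` map on an open set. -/
theorem continuousOn_dproj :
    ContinuousOn (fun W : TangentBundle (𝓡 n).tangent (TangentBundle (𝓡 n) Q) =>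
      (⟨m.proj W.1, m.dproj W.1 W.2⟩ : TangentBundle 𝓘(ℝ, E) 𝓜))
      {W | W.1 ∈ B.phaseInt ∧ W.2 ∈ unitTangent B.metric W.1} := by
  have hsm : ContMDiffOn (𝓡 n).tangent 𝓘(ℝ, E) 1 (m.proj ∘ unitRetract B.metric)
      {q : TangentBundle (𝓡 n) Q | 0 < normSq B.metric q ∧ q.1 ∉ B.obstacle} :=
    (m.proj_smooth.of_le (by simp)).comp (fun q hq =>
      ((contMDiffAt_unitRetract hq.1).of_le (by simp)).contMDiffWithinAt)
      fun q hq => B.phaseInt_subset_nonGrazing ⟨unitRetract_mem hq.1, hq.2⟩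
  refine ((continuousOn_tangentMap isOpen_retractDomain hsm).mono
    fun W hW => mem_retractDomain hW.1).congr fun W hW => ?_
  have h1 : m.proj (unitRetract B.metric W.1) = m.proj W.1 := by rw [unitRetract_of_mem hW.1.1]
  have h2 : ∀ (x y : 𝓜) (v w : E), x = y → v = w →
      (⟨x, v⟩ : TangentBundle 𝓘(ℝ, E) 𝓜) = ⟨y, w⟩ := by
    rintro x _ v _ rfl rfl; rfl
  exact h2 _ _ _ _ h1.symm (m.mfderiv_proj_unitRetract_apply hW.1 W.2 hW.2).symm

end SmoothModel

end ModelDifferentials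

/-! ### Comparison of continuous norms on tangent bundles. -/

section BundleNorms

variable {E : Type*} [NormedAddCommGroup E] [NormedSpace ℝ E]
  {N : Type*} [TopologicalSpace N] [ChartedSpace E N] [IsManifold 𝓘(ℝ, E) 1 N]

variable (E) in
/-- Coordinates of tangent vectors in the trivialization at `x₀`. -/
def tangentCoord (x₀ x : N) : E →L[ℝ] E :=
  (trivializationAt E (TangentSpace 𝓘(ℝ, E)) x₀).continuousLinearMapAt ℝ x

variable (E) in
/-- The tangent vector with given coordinates in the trivialization at `x₀`. -/
def tangentCoordSymm (x₀ x : N) : E →L[ℝ] E :=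
  (trivializationAt E (TangentSpace 𝓘(ℝ, E)) x₀).symmL ℝ x

theorem mem_baseSet_iff {x₀ x : N} :
    x ∈ (trivializationAt E (TangentSpace 𝓘(ℝ, E)) x₀).baseSet ↔ x ∈ (chartAt E x₀).source := by
  simp

theorem tangentCoordSymm_tangentCoord {x₀ x : N} (hx : x ∈ (chartAt E x₀).source) (w : E) :
    tangentCoordSymm E x₀ x (tangentCoord E x₀ x w) = w :=
  (trivializationAt E (TangentSpace 𝓘(ℝ, E)) x₀).symmL_continuousLinearMapAt
    (mem_baseSet_iff.2 hx) w

theorem tangentCoord_tangentCoordSymm {x₀ x : N} (hx : x ∈ (chartAt E x₀).source) (w : E) :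
    tangentCoord E x₀ x (tangentCoordSymm E x₀ x w) = w :=
  (trivializationAt E (TangentSpace 𝓘(ℝ, E)) x₀).continuousLinearMapAt_symmL
    (mem_baseSet_iff.2 hx) w

theorem continuousOn_tangentCoord (x₀ : N) :
    ContinuousOn (fun W : TangentBundle 𝓘(ℝ, E) N => tangentCoord E x₀ W.1 W.2)
      {W | W.1 ∈ (chartAt E x₀).source} := by
  set e := trivializationAt E (TangentSpace 𝓘(ℝ, E)) x₀ with he
  have h1 : ContinuousOn (fun W : TangentBundle 𝓘(ℝ, E) N => (e W).2)
      {W | W.1 ∈ (chartAt E x₀).source} :=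
    (continuous_snd.comp_continuousOn e.continuousOn).mono fun W hW =>
      e.mem_source.2 (mem_baseSet_iff.2 hW)
  exact h1.congr fun W hW =>
    e.continuousLinearMapAt_apply_of_mem ℝ (mem_baseSet_iff.2 hW) W.2

theorem continuousOn_tangentCoordSymm (x₀ : N) :
    ContinuousOn (fun z : N × E => (⟨z.1, tangentCoordSymm E x₀ z.1 z.2⟩ : TangentBundle 𝓘(ℝ, E) N))
      ((chartAt E x₀).source ×ˢ univ) := by
  set e := trivializationAt E (TangentSpace 𝓘(ℝ, E)) x₀ with he
  have h := e.continuousOn_symm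
  refine (h.mono fun z hz => ⟨mem_baseSet_iff.2 hz.1, hz.2⟩).congr fun z hz => ?_
  exact congrArg (fun v : E => (⟨z.1, v⟩ : TangentBundle 𝓘(ℝ, E) N))
    (e.symmL_apply (R := ℝ) (mem_baseSet_iff.2 hz.1) z.2)

/-- Continuous norms are locally comparable. -/
theorem IsContinuousNormOn.exists_eventually_le [FiniteDimensional ℝ E] {A : Set N}
    {ν ν' : ∀ p : N, TangentSpace 𝓘(ℝ, E) p → ℝ}
    (hν : IsContinuousNormOn 𝓘(ℝ, E) A (fun _ => ⊤) ν)
    (hν' : IsContinuousNormOn 𝓘(ℝ, E) A (fun _ => ⊤) ν') {p : N} (hp : p ∈ A) :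
    ∃ C > (0 : ℝ), ∀ᶠ x in 𝓝 p, x ∈ A → ∀ W : TangentSpace 𝓘(ℝ, E) x, ν x W ≤ C * ν' x W := by
  have hsrc : ∀ᶠ z in 𝓝 p, z ∈ (chartAt E p).source :=
    (chartAt E p).open_source.mem_nhds (mem_chart_source E p)
  set j : N × E → TangentBundle 𝓘(ℝ, E) N :=
    fun z => ⟨z.1, tangentCoordSymm E p z.1 z.2⟩ with hj
  set S : Set (N × E) := (A ∩ (chartAt E p).source) ×ˢ univ with hS
  have hjc : ContinuousOn j S := (continuousOn_tangentCoordSymm p).mono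
    fun z hz => ⟨hz.1.2, hz.2⟩
  have hf : ∀ {μ : ∀ p : N, TangentSpace 𝓘(ℝ, E) p → ℝ},
      IsContinuousNormOn 𝓘(ℝ, E) A (fun _ => ⊤) μ →
      ContinuousOn (fun z => μ (j z).1 (j z).2) S := fun hμ =>
    hμ.continuousOn.comp hjc fun z hz => ⟨hz.1.1, Submodule.mem_top⟩
  have hpS : ∀ w, (p, w) ∈ S := fun w => ⟨⟨hp, mem_chart_source E p⟩, mem_univ w⟩
  have hK : IsCompact (Metric.sphere (0 : E) 1) := isCompact_sphere 0 1
  have hpos : ∀ w ∈ Metric.sphere (0 : E) 1, 0 < ν' p (tangentCoordSymm E p p w) := by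
    intro w hw
    refine hν'.pos p hp _ Submodule.mem_top fun h => ?_
    have h1 := tangentCoord_tangentCoordSymm (mem_chart_source E p) w
    have h2 : tangentCoordSymm E p p w = 0 := h
    rw [h2, map_zero] at h1
    rw [← h1, mem_sphere_iff_norm, sub_self, norm_zero] at hw
    exact zero_ne_one hw
  have hline : ContinuousOn (fun w : E => (p, w)) (Metric.sphere (0 : E) 1) :=
    (Continuous.prodMk_right p).continuousOn
  obtain ⟨M, hM⟩ := hK.exists_bound_of_continuousOn
    (f := fun w => ν p (tangentCoordSymm E p p w) / ν' p (tangentCoordSymm E p p w))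
    (((hf hν).comp hline fun w _ => hpS w).div ((hf hν').comp hline fun w _ => hpS w)
      fun w hw => (hpos w hw).ne')
  have hM0 : 0 < max M 0 + 1 := by positivity
  refine ⟨max M 0 + 1, hM0, ?_⟩
  -- `M` bounds the quotient of the norms on the unit sphere of the fibre at `p`. The summand `1`
  -- makes the inequality strict, so that it persists at nearby points, uniformly over the compact
  -- sphere.
  have key := hK.eventually_forall_of_forall_eventually (x₀ := p)
    (P := fun x w => x ∈ A ∩ (chartAt E p).source →
      ν x (tangentCoordSymm E p x w) < (max M 0 + 1) * ν' x (tangentCoordSymm E p x w)) (by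
    intro w hw
    have h1 : ν p (tangentCoordSymm E p p w) < (max M 0 + 1) * ν' p (tangentCoordSymm E p p w) := by
      have h2 := (le_abs_self _).trans (hM w hw)
      rw [div_le_iff₀ (hpos w hw)] at h2
      nlinarith [le_max_left M 0, hpos w hw]
    have h3 := ((hf hν) (p, w) (hpS w)).tendsto.eventually_lt
      ((continuousWithinAt_const (b := max M 0 + 1)).mul ((hf hν') (p, w) (hpS w))).tendsto h1
    filter_upwards [eventually_nhdsWithin_iff.1 h3] with z hz hzA
    exact hz ⟨hzA, mem_univ _⟩)
  filter_upwards [key, hsrc] with x hx hxs hxA W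
  set w := tangentCoord E p x W with hw
  have hWw : W = tangentCoordSymm E p x w := (tangentCoordSymm_tangentCoord hxs W).symm
  rcases eq_or_ne w 0 with h0 | h0
  · have hW0 : W = (0 : ℝ) • W := by
      have : W = (0 : E) := by rw [hWw, h0, map_zero]
      rw [zero_smul]; exact this
    rw [hW0, hν.smul x hxA W Submodule.mem_top, hν'.smul x hxA W Submodule.mem_top]
    simp
  · have hn : 0 < ‖w‖ := norm_pos_iff.2 h0
    have h1 := hx (‖w‖⁻¹ • w) (by
      rw [mem_sphere_iff_norm, sub_zero, norm_smul, norm_inv, norm_norm,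
        inv_mul_cancel₀ hn.ne']) ⟨hxA, hxs⟩
    rw [map_smul, ← hWw] at h1
    have h2 : ν x (‖w‖⁻¹ • W) < (max M 0 + 1) * ν' x (‖w‖⁻¹ • W) := h1
    rw [hν.smul x hxA W Submodule.mem_top, hν'.smul x hxA W Submodule.mem_top,
      abs_of_pos (inv_pos.2 hn)] at h2
    have h3 := mul_lt_mul_of_pos_left h2 hn
    rw [← mul_assoc, mul_inv_cancel₀ hn.ne', one_mul, mul_left_comm, ← mul_assoc ‖w‖,
      mul_inv_cancel₀ hn.ne', one_mul] at h3
    exact h3.le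

/-- Continuous norms are comparable over compact sets. -/
theorem IsContinuousNormOn.exists_le_of_isCompact [FiniteDimensional ℝ E] {A K : Set N}
    {ν ν' : ∀ p : N, TangentSpace 𝓘(ℝ, E) p → ℝ}
    (hν : IsContinuousNormOn 𝓘(ℝ, E) A (fun _ => ⊤) ν)
    (hν' : IsContinuousNormOn 𝓘(ℝ, E) A (fun _ => ⊤) ν') (hK : IsCompact K) (hKA : K ⊆ A) :
    ∃ C > (0 : ℝ), ∀ x ∈ K, ∀ W : TangentSpace 𝓘(ℝ, E) x, ν x W ≤ C * ν' x W := by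
  have hnn : ∀ x ∈ A, ∀ W : TangentSpace 𝓘(ℝ, E) x, 0 ≤ ν' x W := fun x hx W => by
    by_cases h : W = 0
    · have := hν'.smul x hx W Submodule.mem_top 0
      rw [zero_smul, abs_zero, zero_mul] at this
      rw [h, this]
    · exact (hν'.pos x hx W Submodule.mem_top h).le
  refine hK.induction_on (p := fun S => ∃ C > (0 : ℝ), ∀ x ∈ S, x ∈ A →
    ∀ W : TangentSpace 𝓘(ℝ, E) x, ν x W ≤ C * ν' x W) ?_ ?_ ?_ ?_ |>.imp fun C hC =>
      ⟨hC.1, fun x hx => hC.2 x hx (hKA hx)⟩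
  · exact ⟨1, one_pos, fun x hx => absurd hx (notMem_empty x)⟩
  · rintro s t hst ⟨C, hC, h⟩
    exact ⟨C, hC, fun x hx => h x (hst hx)⟩
  · rintro s t ⟨C, hC, h⟩ ⟨C', hC', h'⟩
    refine ⟨max C C', lt_max_of_lt_left hC, fun x hx hxA W => ?_⟩
    rcases hx with hx | hx
    · exact (h x hx hxA W).trans (mul_le_mul_of_nonneg_right (le_max_left _ _) (hnn x hxA W))
    · exact (h' x hx hxA W).trans (mul_le_mul_of_nonneg_right (le_max_right _ _) (hnn x hxA W))
  · intro x hx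
    obtain ⟨C, hC, h⟩ := hν.exists_eventually_le hν' (hKA hx)
    exact ⟨_, mem_nhdsWithin_of_mem_nhds h, C, hC, fun y hy => hy⟩

end BundleNorms

/-! ### Existence of norms, and weights that vanish on a closed set. -/

section ReferenceNorm

variable {E : Type*} [NormedAddCommGroup E] [NormedSpace ℝ E] [FiniteDimensional ℝ E]
  {N : Type*} [TopologicalSpace N] [T2Space N] [SecondCountableTopology N] [ChartedSpace E N]
  [IsManifold 𝓘(ℝ, E) ∞ N]

theorem IsContinuousNormOn.nonneg {A : Set N} {ν : ∀ p : N, TangentSpace 𝓘(ℝ, E) p → ℝ}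
    (hν : IsContinuousNormOn 𝓘(ℝ, E) A (fun _ => ⊤) ν) {p : N} (hp : p ∈ A)
    (W : TangentSpace 𝓘(ℝ, E) p) : 0 ≤ ν p W := by
  by_cases h : W = 0
  · have := hν.smul p hp W Submodule.mem_top 0
    rw [zero_smul, abs_zero, zero_mul] at this
    rw [h, this]
  · exact (hν.pos p hp W Submodule.mem_top h).le

variable (E N) in
/-- Every manifold has a continuous norm on its tangent bundle. -/
theorem exists_isContinuousNormOn :
    ∃ μ : ∀ p : N, TangentSpace 𝓘(ℝ, E) p → ℝ,
      IsContinuousNormOn 𝓘(ℝ, E) univ (fun _ => ⊤) μ := by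
  have : LocallyCompactSpace N := Manifold.locallyCompact_of_finiteDimensional 𝓘(ℝ, E)
  obtain ⟨f, hf⟩ := SmoothPartitionOfUnity.exists_isSubordinate_chartAt_source 𝓘(ℝ, E) N
  have hsrc : ∀ {i p : N}, f i p ≠ 0 → p ∈ (chartAt E i).source := fun {i p} h =>
    hf i (subset_tsupport _ h)
  have hfin : ∀ (p : N) (a : N → ℝ), Function.HasFiniteSupport fun i => f i p * a i := fun p a =>
    (f.locallyFinite.point_finite p).subset fun i hi h => hi (by
      change f i p * a i = 0
      rw [h, zero_mul])
  set c : N → (p : N) → TangentSpace 𝓘(ℝ, E) p → E := fun i p W => tangentCoord E i p W with hc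
  have hc1 : ∀ i p (r : ℝ) W, c i p (r • W) = r • c i p W := fun i p r W =>
    map_smul (tangentCoord E i p) r W
  have hc2 : ∀ i p W W', c i p (W + W') = c i p W + c i p W' := fun i p W W' =>
    map_add (tangentCoord E i p) W W'
  -- The norms of the coordinates in the charts, glued by the partition of unity.
  refine ⟨fun p W => ∑ᶠ i, f i p * ‖c i p W‖, ?_, ?_, ?_, ?_⟩
  · intro p _ W _ hW
    refine finsum_pos (fun i => mul_nonneg (f.nonneg i p) (norm_nonneg _)) ?_ (hfin p _)
    obtain ⟨i, hi⟩ := f.exists_pos_of_mem (mem_univ p)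
    refine ⟨i, mul_pos hi (norm_pos_iff.2 fun h => hW ?_)⟩
    have h1 := tangentCoordSymm_tangentCoord (hsrc hi.ne') W
    have h2 : tangentCoord E i p W = 0 := h
    rw [h2, map_zero] at h1
    exact h1.symm
  · intro p _ W _ r
    rw [mul_finsum]
    refine finsum_congr fun i => ?_
    rw [hc1, norm_smul, Real.norm_eq_abs]
    ring
  · intro p _ W _ W' _
    rw [← finsum_add_distrib (hfin p _) (hfin p _)]
    refine finsum_le_finsum' (hfin p _) ?_ fun i => ?_
    · have := hfin p (fun i => ‖c i p W‖ + ‖c i p W'‖)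
      simpa only [mul_add] using this
    · change _ ≤ f i p * ‖c i p W‖ + f i p * ‖c i p W'‖
      rw [← mul_add, hc2]
      exact mul_le_mul_of_nonneg_left (norm_add_le _ _) (f.nonneg i p)
  · refine Continuous.continuousOn (continuous_finsum (fun i => ?_) ?_)
    · have hproj : Continuous fun W : TangentBundle 𝓘(ℝ, E) N => W.1 :=
        FiberBundle.continuous_proj E (TangentSpace 𝓘(ℝ, E))
      have hfc : Continuous (f i) := (f i).contMDiff.continuous
      refine continuous_iff_continuousAt.2 fun W => ?_
      by_cases hW : W.1 ∈ (chartAt E i).source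
      · have h1 := (continuousOn_tangentCoord i).continuousAt
          (((chartAt E i).open_source.preimage hproj).mem_nhds hW)
        exact (hfc.comp hproj).continuousAt.mul h1.norm
      · have h1 : ∀ᶠ W' : TangentBundle 𝓘(ℝ, E) N in 𝓝 W, W'.1 ∉ tsupport (f i) :=
          ((isClosed_tsupport (f i)).isOpen_compl.preimage hproj).mem_nhds
            (fun h => hW (hf i h))
        refine (continuousAt_const (y := (0 : ℝ))).congr ?_
        filter_upwards [h1] with W' hW'
        rw [image_eq_zero_of_notMem_tsupport hW', zero_mul]
    · have hproj : Continuous fun W : TangentBundle 𝓘(ℝ, E) N => W.1 :=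
        FiberBundle.continuous_proj E (TangentSpace 𝓘(ℝ, E))
      refine (f.locallyFinite.preimage_continuous hproj).subset fun i W hW h => hW ?_
      change f i W.1 * _ = 0
      rw [h, zero_mul]

/-- A norm off a closed set becomes a continuous function on the whole tangent bundle after
multiplication with a weight that vanishes exactly on that set. -/
theorem exists_weight {G : Set N} (hG : IsClosed G) {ν : ∀ p : N, TangentSpace 𝓘(ℝ, E) p → ℝ}
    (hν : IsContinuousNormOn 𝓘(ℝ, E) Gᶜ (fun _ => ⊤) ν) :
    ∃ w : N → ℝ, Continuous w ∧ (∀ p, 0 ≤ w p) ∧ (∀ p, w p = 0 ↔ p ∈ G) ∧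
      Continuous (fun W : TangentBundle 𝓘(ℝ, E) N => w W.1 * ν W.1 W.2) := by
  classical
  have : LocallyCompactSpace N := Manifold.locallyCompact_of_finiteDimensional 𝓘(ℝ, E)
  have hmet : TopologicalSpace.MetrizableSpace N := Manifold.metrizableSpace 𝓘(ℝ, E) N
  let _ : MetricSpace N := TopologicalSpace.metrizableSpaceMetric N
  obtain ⟨μ, hμ⟩ := exists_isContinuousNormOn E N
  have hμ' : IsContinuousNormOn 𝓘(ℝ, E) Gᶜ (fun _ => ⊤) μ :=
    ⟨fun p _ => hμ.pos p (mem_univ p), fun p _ => hμ.smul p (mem_univ p),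
      fun p _ => hμ.add_le p (mem_univ p), hμ.continuousOn.mono fun W _ =>
        ⟨mem_univ _, Submodule.mem_top⟩⟩
  obtain ⟨d, hdc, hdr, hd0, -⟩ := exists_contMDiff_zero_iff_one_iff_of_isClosed
    (n := ⊤) 𝓘(ℝ, E) hG isClosed_empty (disjoint_empty G)
  have hdn : ∀ p, 0 ≤ d p := fun p => (hdr (mem_range_self p)).1
  -- The admissible values of the weight at `p`. The bounds by `d` and `d μ`, which tend to `0` at
  -- `G`, make the weight and its product with `ν` continuous there. Convexity and local
  -- comparability of norms permit a continuous selection.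
  set t : (Gᶜ : Set N) → Set ℝ := fun p =>
    {c | 0 < c ∧ c ≤ d p ∧ ∀ W : TangentSpace 𝓘(ℝ, E) p.1, c * ν p W ≤ d p * μ p W} with ht
  have htc : ∀ p, Convex ℝ (t p) := by
    intro p
    have h1 : (t p).OrdConnected := ⟨fun a ha b hb c hc => ⟨ha.1.trans_le hc.1,
      hc.2.trans hb.2.1, fun W => ?_⟩⟩
    · exact h1.convex
    exact (mul_le_mul_of_nonneg_right hc.2 (hν.nonneg p.2 W)).trans (hb.2.2 W)
  obtain ⟨g, hg⟩ := exists_continuous_forall_mem_convex_of_local_const htc fun p => by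
    obtain ⟨C, hC, hle⟩ := hν.exists_eventually_le hμ' p.2
    have hdp : 0 < d p := lt_of_le_of_ne (hdn p) fun h => p.2 ((hd0 p).2 h.symm)
    -- One half leaves room for `d` to vary near `p`; the division by `C` turns `ν ≤ C μ` into the
    -- bound by `d μ`.
    refine ⟨min (d p / 2) (d p / 2 / C), ?_⟩
    have h1 : ∀ᶠ y : (Gᶜ : Set N) in 𝓝 p, d p / 2 < d y :=
      (hdc.continuous.comp continuous_subtype_val).continuousAt.eventually
        (lt_mem_nhds (by change d p / 2 < d p; linarith))
    have h2 := continuous_subtype_val.continuousAt.eventually hle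
    filter_upwards [h1, h2] with y hy hy'
    refine ⟨by positivity, (min_le_left _ _).trans hy.le, fun W => ?_⟩
    calc min (d p / 2) (d p / 2 / C) * ν y W ≤ (d p / 2 / C) * (C * μ y W) :=
          mul_le_mul (min_le_right _ _) (hy' y.2 W) (hν.nonneg y.2 W) (by positivity)
      _ = d p / 2 * μ y W := by field_simp
      _ ≤ d y * μ y W := mul_le_mul_of_nonneg_right hy.le (hμ.nonneg (mem_univ _) W)
  set w : N → ℝ := fun p => if h : p ∈ Gᶜ then g ⟨p, h⟩ else 0 with hw
  have hwG : ∀ p ∈ G, w p = 0 := fun p hp => dif_neg fun h => h hp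
  have hwg : ∀ p (h : p ∈ Gᶜ), w p = g ⟨p, h⟩ := fun p h => dif_pos h
  have hwpos : ∀ p ∈ Gᶜ, 0 < w p := fun p hp => by rw [hwg p hp]; exact (hg ⟨p, hp⟩).1
  have hw0 : ∀ p, 0 ≤ w p := fun p => by
    by_cases h : p ∈ G
    · rw [hwG p h]
    · exact (hwpos p h).le
  have hwd : ∀ p, w p ≤ d p := fun p => by
    by_cases h : p ∈ G
    · rw [hwG p h]; exact hdn p
    · rw [hwg p h]; exact (hg ⟨p, h⟩).2.1
  have hwμ : ∀ p (W : TangentSpace 𝓘(ℝ, E) p), w p * ν p W ≤ d p * μ p W := fun p W => by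
    by_cases h : p ∈ G
    · rw [hwG p h, zero_mul]; exact mul_nonneg (hdn p) (hμ.nonneg (mem_univ p) W)
    · rw [hwg p h]; exact (hg ⟨p, h⟩).2.2 W
  have hwn : ∀ p (W : TangentSpace 𝓘(ℝ, E) p), 0 ≤ w p * ν p W := fun p W => by
    by_cases h : p ∈ G
    · rw [hwG p h, zero_mul]
    · exact mul_nonneg (hw0 p) (hν.nonneg h W)
  have hwon : ContinuousOn w Gᶜ := by
    rw [continuousOn_iff_continuous_domRestrict]
    exact g.continuous.congr fun p => (hwg p.1 p.2).symm
  have hwc : Continuous w := continuous_iff_continuousAt.2 fun p => by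
    by_cases h : p ∈ G
    · have h1 : Tendsto d (𝓝 p) (𝓝 0) := by
        have := hdc.continuous.tendsto p
        rwa [(hd0 p).1 h] at this
      rw [ContinuousAt, hwG p h]
      exact squeeze_zero hw0 hwd h1
    · exact hwon.continuousAt (hG.isOpen_compl.mem_nhds h)
  refine ⟨w, hwc, hw0, fun p => ⟨fun h => by_contra fun h' => (hwpos p h').ne' h, hwG p⟩, ?_⟩
  have hproj : Continuous fun W : TangentBundle 𝓘(ℝ, E) N => W.1 :=
    FiberBundle.continuous_proj E (TangentSpace 𝓘(ℝ, E))
  refine continuous_iff_continuousAt.2 fun W => ?_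
  by_cases h : W.1 ∈ G
  · have h1 : ContinuousAt (fun W : TangentBundle 𝓘(ℝ, E) N => d W.1 * μ W.1 W.2) W :=
      (hdc.continuous.comp hproj).continuousAt.mul
        (hμ.continuousOn.continuousAt (univ_mem' fun _ => ⟨mem_univ _, Submodule.mem_top⟩))
    have h2 : Tendsto (fun W : TangentBundle 𝓘(ℝ, E) N => d W.1 * μ W.1 W.2) (𝓝 W) (𝓝 0) := by
      have h3 : d W.1 * μ W.1 W.2 = 0 := by rw [(hd0 W.1).1 h, zero_mul]
      rw [← h3]; exact h1
    rw [ContinuousAt, hwG W.1 h, zero_mul]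
    exact squeeze_zero (fun W' => hwn W'.1 W'.2) (fun W' => hwμ W'.1 W'.2) h2
  · have ho : {W : TangentBundle 𝓘(ℝ, E) N | W.1 ∈ Gᶜ ∧ W.2 ∈ (⊤ : Submodule ℝ
        (TangentSpace 𝓘(ℝ, E) W.1))} ∈ 𝓝 W :=
      mem_of_superset ((hG.isOpen_compl.preimage hproj).mem_nhds h)
        fun W' hW' => ⟨hW', Submodule.mem_top⟩
    exact (hwc.comp hproj).continuousAt.mul (hν.continuousOn.continuousAt ho)

end ReferenceNorm

/-! ### The differential of the model flow as a flow on the tangent bundle. -/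

section TangentFlow

variable {n : ℕ} {Q : Type*} [TopologicalSpace Q] [ChartedSpace (EuclideanSpace ℝ (Fin n)) Q]
  [IsManifold (𝓡 n) ∞ Q] [T2Space Q] {B : BilliardSystem n Q}
  {E : Type*} [NormedAddCommGroup E] [NormedSpace ℝ E]
  {𝓜 : Type*} [TopologicalSpace 𝓜] [T2Space 𝓜] [ChartedSpace E 𝓜] (m : SmoothModel B E 𝓜)

namespace SmoothModel

/-- The flow of the differentials of the model flow on the tangent bundle. -/
def tangentFlow (t : ℝ) (W : TangentBundle 𝓘(ℝ, E) 𝓜) : TangentBundle 𝓘(ℝ, E) 𝓜 :=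
  ⟨m.flow t W.1, m.dflow t W.1 W.2⟩

theorem flow_zero_eq : m.flow 0 = id := funext m.flow_zero

theorem tangentFlow_zero (W : TangentBundle 𝓘(ℝ, E) 𝓜) : m.tangentFlow 0 W = W := by
  change tangentMap 𝓘(ℝ, E) 𝓘(ℝ, E) (m.flow 0) W = W
  rw [m.flow_zero_eq, tangentMap_id, id]

theorem tangentFlow_add {s t : ℝ} {W : TangentBundle 𝓘(ℝ, E) 𝓜} (hs : (s, W.1) ∈ m.domain)
    (ht : (t, m.flow s W.1) ∈ m.domain) (hst : (t + s, W.1) ∈ m.domain) :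
    m.tangentFlow t (m.tangentFlow s W) = m.tangentFlow (t + s) W := by
  have h1 : m.flow (t + s) =ᶠ[𝓝 W.1] m.flow t ∘ m.flow s := by
    have h2 := (m.contMDiffAt_flow hs).continuousAt.eventually (m.eventually_mem_domain ht)
    filter_upwards [m.eventually_mem_domain hs, h2, m.eventually_mem_domain hst] with x h3 h4 h5
    exact m.flow_add s t x h3 h4 h5
  have h2 := tangentMap_comp_at W ((m.contMDiffAt_flow ht).mdifferentiableAt (by simp))
    ((m.contMDiffAt_flow hs).mdifferentiableAt (by simp))
  refine h2.symm.trans ?_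
  have h3 : mfderiv 𝓘(ℝ, E) 𝓘(ℝ, E) (m.flow (t + s)) W.1 =
    mfderiv 𝓘(ℝ, E) 𝓘(ℝ, E) (m.flow t ∘ m.flow s) W.1 := h1.mfderiv_eq
  have h4 : ∀ (x y : 𝓜) (v w : E), x = y → v = w →
      (⟨x, v⟩ : TangentBundle 𝓘(ℝ, E) 𝓜) = ⟨y, w⟩ := by
    rintro x _ v _ rfl rfl; rfl
  exact h4 _ _ _ _ h1.self_of_nhds.symm (congrArg (fun L => L W.2) h3).symm

/-- Both sides are the velocity of `s ↦ φ_{t+s}(p)` at `s = 0`. -/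
theorem dflow_generator {t : ℝ} {p : 𝓜} (ht : (t, p) ∈ m.domain) :
    (m.dflow t p : E →L[ℝ] E) (m.generator p) = m.generator (m.flow t p) := by
  have h0 : (t, m.flow 0 p) ∈ m.domain := by rwa [m.flow_zero]
  have h1 : ∀ p' : 𝓜, p' = p → HasMFDerivAt 𝓘(ℝ, E) 𝓘(ℝ, E) (m.flow t) p'
      (m.dflow t p : E →L[ℝ] E) := by
    rintro _ rfl
    exact m.hasMFDerivAt_flow ht
  have h2 := (h1 _ (m.flow_zero p)).comp (0 : ℝ)
    (m.mdifferentiableAt_flow_left (m.zero_mem_domain p)).hasMFDerivAt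
  have hev : (fun s => m.flow s (m.flow t p)) =ᶠ[𝓝 0] m.flow t ∘ fun s => m.flow s p := by
    have h3 : Tendsto (fun s => (t, m.flow s p)) (𝓝 0) (𝓝 (t, p)) :=
      tendsto_const_nhds.prodMk_nhds (m.tendsto_flow_zero p)
    have h4 : Tendsto (fun s : ℝ => (t + s, p)) (𝓝 0) (𝓝 (t, p)) := by
      have : Continuous fun s : ℝ => (t + s, p) := by fun_prop
      simpa using this.tendsto 0
    filter_upwards [h3.eventually (m.isOpen_domain.mem_nhds ht),
      h4.eventually (m.isOpen_domain.mem_nhds ht), m.eventually_zero_mem_domain p,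
      m.eventually_zero_mem_domain (m.flow t p)] with s h5 h6 h7 h8
    rw [Function.comp_apply, ← m.flow_add s t p h7 h5 h6, add_comm t s]
    exact (m.flow_add t s p ht h8 (by rw [add_comm]; exact h6)).symm
  exact congrArg (fun L => L (1 : ℝ)) (h2.congr_of_eventuallyEq hev).mfderiv.symm

variable [IsManifold 𝓘(ℝ, E) ∞ 𝓜]

theorem mfderiv_flow_prod {t : ℝ} {p : 𝓜} (ht : (t, p) ∈ m.domain) (w : E) :
    (mfderiv (𝓘(ℝ, ℝ).prod 𝓘(ℝ, E)) 𝓘(ℝ, E) (fun z : ℝ × 𝓜 => m.flow z.1 z.2) (t, p) :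
      ℝ × E →L[ℝ] E) (0, w) = (m.dflow t p : E →L[ℝ] E) w := by
  have h1 : MDifferentiableAt (𝓘(ℝ, ℝ).prod 𝓘(ℝ, E)) 𝓘(ℝ, E)
      (fun z : ℝ × 𝓜 => m.flow z.1 z.2) (t, p) :=
    (m.flow_smooth.contMDiffAt (m.isOpen_domain.mem_nhds ht)).mdifferentiableAt (by simp)
  have h2 : HasMFDerivAt 𝓘(ℝ, E) (𝓘(ℝ, ℝ).prod 𝓘(ℝ, E)) (fun x : 𝓜 => (t, x)) p
      ((0 : E →L[ℝ] ℝ).prod (ContinuousLinearMap.id ℝ E)) :=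
    (hasMFDerivAt_const t p).prodMk (hasMFDerivAt_id p)
  exact (congrArg (fun L => L w) (h1.hasMFDerivAt.comp p h2).mfderiv).symm

/-- The tangent map of the joint flow on `ℝ × 𝓜`, evaluated at vectors without time component; this
gives continuity in time and vector together. -/
theorem continuousOn_tangentFlow :
    ContinuousOn (fun z : ℝ × TangentBundle 𝓘(ℝ, E) 𝓜 => m.tangentFlow z.1 z.2)
      {z | (z.1, z.2.1) ∈ m.domain} := by
  have h1 := continuousOn_tangentMap (I := 𝓘(ℝ, ℝ).prod 𝓘(ℝ, E)) (I' := 𝓘(ℝ, E))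
    m.isOpen_domain (m.flow_smooth.of_le (by simp))
  have h2 : Continuous fun z : ℝ × TangentBundle 𝓘(ℝ, E) 𝓜 =>
      (equivTangentBundleProd 𝓘(ℝ, ℝ) ℝ 𝓘(ℝ, E) 𝓜).symm
        (Bundle.zeroSection ℝ (TangentSpace 𝓘(ℝ, ℝ)) z.1, z.2) := by
    have h3 : Continuous (Bundle.zeroSection ℝ (TangentSpace 𝓘(ℝ, ℝ) : ℝ → Type)) :=
      (Bundle.contMDiff_zeroSection (n := 0) (IB := 𝓘(ℝ, ℝ)) ℝ (TangentSpace 𝓘(ℝ, ℝ))).continuous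
    exact (contMDiff_equivTangentBundleProd_symm (n := 0)).continuous.comp
      ((h3.comp continuous_fst).prodMk continuous_snd)
  refine (h1.comp h2.continuousOn fun z hz => hz).congr fun z hz => ?_
  exact congrArg (fun v : E => (⟨m.flow z.1 z.2.1, v⟩ : TangentBundle 𝓘(ℝ, E) 𝓜))
    (m.mfderiv_flow_prod hz z.2.2).symm

variable {m}

theorem tangentFlow_add_of_mem_trapped {W : TangentBundle 𝓘(ℝ, E) 𝓜} (hW : W.1 ∈ m.trapped)
    (s t : ℝ) : m.tangentFlow t (m.tangentFlow s W) = m.tangentFlow (t + s) W :=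
  m.tangentFlow_add (hW.1 s) (domain_flow_of_mem_trapped hW t s) (hW.1 _)

variable (m)

/-- A continuous positive time span over which the model flow is defined and which does not shrink
faster than time passes along trapped trajectories. -/
theorem exists_timeSpan [FiniteDimensional ℝ E] [SecondCountableTopology 𝓜] :
    ∃ τ : 𝓜 → ℝ, Continuous τ ∧ (∀ p, 0 < τ p ∧ τ p ≤ 1) ∧
      (∀ p, ∀ t ∈ Icc 0 (τ p), (t, p) ∈ m.domain) ∧
      ∀ p ∈ m.trapped, ∀ s : ℝ, 0 ≤ s → τ p ≤ τ (m.flow s p) + s := by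
  have : LocallyCompactSpace 𝓜 := Manifold.locallyCompact_of_finiteDimensional 𝓘(ℝ, E)
  have hmet : TopologicalSpace.MetrizableSpace 𝓜 := Manifold.metrizableSpace 𝓘(ℝ, E) 𝓜
  let _ : MetricSpace 𝓜 := TopologicalSpace.metrizableSpaceMetric 𝓜
  set T : 𝓜 → Set ℝ := fun p => {x | (0 < x ∧ x ≤ 1) ∧ ∀ r ∈ Icc 0 x, (r, p) ∈ m.domain} with hT
  have hTc : ∀ p, Convex ℝ (T p) := by
    intro p
    have h1 : (T p).OrdConnected := ⟨fun a ha b hb c hc =>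
      ⟨⟨ha.1.1.trans_le hc.1, hc.2.trans hb.1.2⟩, fun r hr => hb.2 r ⟨hr.1, hr.2.trans hc.2⟩⟩⟩
    exact h1.convex
  -- `g` is a continuous time span, as yet without control along trajectories.
  obtain ⟨g, hg⟩ := exists_continuous_forall_mem_convex_of_local_const hTc fun p => by
    have h1 := m.isOpen_domain.mem_nhds (m.zero_mem_domain p)
    rw [nhds_prod_eq] at h1
    obtain ⟨pa, hpa, pb, hpb, hab⟩ := eventually_prod_iff.1
      (show ∀ᶠ z in 𝓝 (0 : ℝ) ×ˢ 𝓝 p, z ∈ m.domain from h1)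
    obtain ⟨ε, hε, hε'⟩ := Metric.eventually_nhds_iff.1 hpa
    refine ⟨min 1 (ε / 2), ?_⟩
    filter_upwards [hpb] with y hy
    refine ⟨⟨by positivity, min_le_left _ _⟩, fun r hr => hab (hε' ?_) hy⟩
    rw [Real.dist_0_eq_abs, abs_of_nonneg hr.1]
    linarith [hr.2, min_le_right 1 (ε / 2)]
  -- The time span will be the minimum of `g(φ_r p) + r` over `0 ≤ r ≤ g p`. The parameter `θ = r /
  -- g p` runs over a fixed compact set, which yields continuity in `p`.
  set f : 𝓜 → unitInterval → ℝ := fun p θ => g (m.flow (θ * g p) p) + θ * g p with hf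
  have hmem : ∀ (p : 𝓜) (θ : unitInterval), (θ : ℝ) * g p ∈ Icc 0 (g p) := fun p θ =>
    ⟨mul_nonneg θ.2.1 (hg p).1.1.le, mul_le_of_le_one_left (hg p).1.1.le θ.2.2⟩
  have hfc : Continuous ↿f := by
    have h1 : Continuous fun z : 𝓜 × unitInterval => ((z.2 : ℝ) * g z.1, z.1) := by fun_prop
    have h2 : Continuous fun z : 𝓜 × unitInterval => m.flow (z.2 * g z.1) z.1 :=
      m.flow_smooth.continuousOn.comp_continuous h1
        fun z => (hg z.1).2 _ (hmem z.1 z.2)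
    have h3 : Continuous fun z : 𝓜 × unitInterval =>
      g (m.flow (z.2 * g z.1) z.1) + z.2 * g z.1 := by fun_prop
    exact h3
  have hfs : ∀ p, Continuous (f p) := fun p => hfc.comp (Continuous.prodMk_right p)
  have hle : ∀ (p : 𝓜) r, r ∈ Icc 0 (g p) → sInf (f p '' univ) ≤ g (m.flow r p) + r := by
    intro p r hr
    have hgp := (hg p).1.1
    have h1 : r / g p ∈ Icc (0 : ℝ) 1 := ⟨div_nonneg hr.1 hgp.le, (div_le_one hgp).2 hr.2⟩
    have h2 := csInf_le (isCompact_univ.image (hfs p)).bddBelow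
      (mem_image_of_mem (f p) (mem_univ (⟨r / g p, h1⟩ : unitInterval)))
    simpa only [hf, div_mul_cancel₀ r hgp.ne'] using h2
  have hatt : ∀ p, ∃ r ∈ Icc 0 (g p), sInf (f p '' univ) = g (m.flow r p) + r := by
    intro p
    obtain ⟨θ, -, hθ⟩ := isCompact_univ.exists_sInf_image_eq univ_nonempty (hfs p).continuousOn
    exact ⟨θ * g p, hmem p θ, hθ⟩
  have hτg : ∀ p, sInf (f p '' univ) ≤ g p := fun p => by
    have := hle p 0 ⟨le_rfl, (hg p).1.1.le⟩
    rwa [m.flow_zero, add_zero] at this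
  refine ⟨fun p => sInf (f p '' univ), isCompact_univ.continuous_sInf hfc, fun p => ⟨?_, ?_⟩,
    fun p t ht => (hg p).2 t ⟨ht.1, ht.2.trans (hτg p)⟩, fun p hp s hs => ?_⟩
  · obtain ⟨r, hr, h⟩ := hatt p
    change 0 < sInf (f p '' univ)
    rw [h]
    exact add_pos_of_pos_of_nonneg (hg _).1.1 hr.1
  · exact (hτg p).trans (hg p).1.2
  · obtain ⟨r, hr, h⟩ := hatt (m.flow s p)
    change sInf (f p '' univ) ≤ sInf (f (m.flow s p) '' univ) + s
    rw [h, flow_add_of_mem_trapped hp, add_assoc]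
    -- Either `r + s` competes in the minimum at `p`, or it exceeds `g p`, which already bounds that
    -- minimum.
    rcases le_or_gt (r + s) (g p) with h1 | h1
    · exact hle p (r + s) ⟨add_nonneg hr.1 hs, h1⟩
    · linarith [hτg p, (hg (m.flow (r + s) p)).1.1]

end SmoothModel

end TangentFlow

/-! ### Suprema over time windows. -/

section WindowSup

/-- The supremum of a function over the interval from `0` to `a`. -/
def windowSup (k : ℝ → ℝ) (a : ℝ) : ℝ := sSup ((fun θ : unitInterval => k (θ * a)) '' univ)

variable {k : ℝ → ℝ} {a : ℝ}

theorem mul_mem_Icc_of_unitInterval (ha : 0 ≤ a) (θ : unitInterval) : (θ : ℝ) * a ∈ Icc 0 a :=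
  ⟨mul_nonneg θ.2.1 ha, mul_le_of_le_one_left ha θ.2.2⟩

theorem continuous_comp_unitInterval (ha : 0 ≤ a) (hk : ContinuousOn k (Icc 0 a)) :
    Continuous fun θ : unitInterval => k (θ * a) :=
  hk.comp_continuous (by fun_prop) fun θ => mul_mem_Icc_of_unitInterval ha θ

theorem le_windowSup (ha : 0 < a) (hk : ContinuousOn k (Icc 0 a)) {t : ℝ} (ht : t ∈ Icc 0 a) :
    k t ≤ windowSup k a := by
  have h1 : t / a ∈ Icc (0 : ℝ) 1 := ⟨div_nonneg ht.1 ha.le, (div_le_one ha).2 ht.2⟩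
  have h2 := le_csSup (isCompact_univ.image (continuous_comp_unitInterval ha.le hk)).bddAbove
    (mem_image_of_mem (fun θ : unitInterval => k (θ * a))
      (mem_univ (⟨t / a, h1⟩ : unitInterval)))
  have h3 : k (t / a * a) ≤ windowSup k a := h2
  rwa [div_mul_cancel₀ t ha.ne'] at h3

theorem exists_windowSup_eq (ha : 0 < a) (hk : ContinuousOn k (Icc 0 a)) :
    ∃ t ∈ Icc 0 a, windowSup k a = k t := by
  obtain ⟨θ, -, hθ⟩ := isCompact_univ.exists_sSup_image_eq univ_nonempty
    (continuous_comp_unitInterval ha.le hk).continuousOn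
  exact ⟨θ * a, mul_mem_Icc_of_unitInterval ha.le θ, hθ⟩

theorem windowSup_const_mul (ha : 0 < a) (hk : ContinuousOn k (Icc 0 a)) {c : ℝ} (hc : 0 ≤ c) :
    windowSup (fun t => c * k t) a = c * windowSup k a := by
  have hck : ContinuousOn (fun t => c * k t) (Icc 0 a) := continuousOn_const.mul hk
  refine le_antisymm ?_ ?_
  · obtain ⟨t, ht, h⟩ := exists_windowSup_eq ha hck
    rw [h]
    exact mul_le_mul_of_nonneg_left (le_windowSup ha hk ht) hc
  · obtain ⟨t, ht, h⟩ := exists_windowSup_eq ha hk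
    rw [h]
    exact le_windowSup ha hck ht

/-- Comparison of the weighted suprema of a function over two windows. -/
theorem ratio_le {w h : ℝ → ℝ} {J₁ J₂ : Set ℝ} {t₁ t₂ K N₁ N₂ W₁ W₂ : ℝ} (hK : 0 ≤ K)
    (hw : ∀ t, 0 ≤ w t) (hh : ∀ t, 0 < w t → 0 ≤ h t)
    (ht₁ : t₁ ∈ J₁) (hN₁ : N₁ = w t₁ * h t₁) (hW₁ : ∀ t ∈ J₁, w t ≤ W₁) (hW₁0 : 0 < W₁)
    (ht₂ : t₂ ∈ J₂) (hN₂ : ∀ t ∈ J₂, w t * h t ≤ N₂) (hW₂ : W₂ = w t₂) (hW₂0 : 0 < W₂)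
    (halt : (0 < w t₁ → h t₁ ≤ K * h t₂) ∨ (t₁ ∈ J₂ ∧ t₂ ∈ J₁ ∧ 1 ≤ K)) :
    N₁ / W₁ ≤ K * (N₂ / W₂) := by
  have hN₂0 : 0 ≤ N₂ := by
    have h1 := hN₂ t₂ ht₂
    have h2 := mul_nonneg (hw t₂) (hh t₂ (hW₂ ▸ hW₂0))
    linarith
  have hR : 0 ≤ N₂ / W₂ := div_nonneg hN₂0 hW₂0.le
  rcases (hw t₁).lt_or_eq with hpos | h0
  · have hht₁ := hh t₁ hpos
    rcases halt with halt | ⟨h1, h2, hK1⟩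
    · have h3 : N₁ / W₁ ≤ h t₁ := by
        rw [hN₁, div_le_iff₀ hW₁0, mul_comm]
        exact mul_le_mul_of_nonneg_left (hW₁ t₁ ht₁) hht₁
      have h4 : h t₂ ≤ N₂ / W₂ := by
        rw [le_div_iff₀ hW₂0, mul_comm, hW₂]
        exact hN₂ t₂ ht₂
      exact (h3.trans (halt hpos)).trans (mul_le_mul_of_nonneg_left h4 hK)
    · have h3 : N₁ / W₁ ≤ N₂ / W₂ := by
        refine div_le_div₀ hN₂0 (hN₁ ▸ hN₂ t₁ h1) hW₂0 ?_
        rw [hW₂]; exact hW₁ t₂ h2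
      nlinarith
  · rw [hN₁, ← h0, zero_mul, zero_div]
    exact mul_nonneg hK hR

end WindowSup

/-! ### A norm on the whole model adapted to a norm off the gluing region. -/

section AdaptedNorm

variable {n : ℕ} {Q : Type*} [TopologicalSpace Q] [ChartedSpace (EuclideanSpace ℝ (Fin n)) Q]
  [IsManifold (𝓡 n) ∞ Q] [T2Space Q] {B : BilliardSystem n Q}
  {E : Type*} [NormedAddCommGroup E] [NormedSpace ℝ E] [FiniteDimensional ℝ E]
  {𝓜 : Type*} [TopologicalSpace 𝓜] [T2Space 𝓜] [SecondCountableTopology 𝓜] [ChartedSpace E 𝓜]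
  [IsManifold 𝓘(ℝ, E) ∞ 𝓜] (m : SmoothModel B E 𝓜)

namespace SmoothModel

/-- The given norm may degenerate or blow up at the gluing region, so it is replaced by a quotient
of weighted suprema over the near future. Bounds for `ν` are assumed only between times off the
gluing region; these suffice, because the weight vanishes at the others. The rate `C₁` is retained,
and `μ` does not depend on the constants. -/
theorem exists_adapted_norm {ν : ∀ p : 𝓜, TangentSpace 𝓘(ℝ, E) p → ℝ}
    (hν : IsContinuousNormOn 𝓘(ℝ, E) m.gluingᶜ (fun _ => ⊤) ν) :
    ∃ μ : ∀ p : 𝓜, TangentSpace 𝓘(ℝ, E) p → ℝ,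
      IsContinuousNormOn 𝓘(ℝ, E) univ (fun _ => ⊤) μ ∧
      ∀ C₀ C₁ : ℝ, 0 < C₀ → 0 < C₁ → ∃ C > (0 : ℝ), ∀ W : TangentBundle 𝓘(ℝ, E) 𝓜,
        W.1 ∈ m.trapped →
        ((∀ t t' : ℝ, t ≤ t' → m.flow t W.1 ∉ m.gluing → m.flow t' W.1 ∉ m.gluing →
            ν _ (m.tangentFlow t' W).2 ≤ C₀ * Real.exp (-C₁ * (t' - t)) *
              ν _ (m.tangentFlow t W).2) →
          ∀ s : ℝ, 0 ≤ s →
            μ _ (m.tangentFlow s W).2 ≤ C * Real.exp (-C₁ * s) * μ _ W.2) ∧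
        ((∀ t t' : ℝ, t ≤ t' → m.flow t W.1 ∉ m.gluing → m.flow t' W.1 ∉ m.gluing →
            C₀⁻¹ * Real.exp (C₁ * (t' - t)) * ν _ (m.tangentFlow t W).2 ≤
              ν _ (m.tangentFlow t' W).2) →
          ∀ s : ℝ, 0 ≤ s →
            C⁻¹ * Real.exp (C₁ * s) * μ _ W.2 ≤ μ _ (m.tangentFlow s W).2) := by
  obtain ⟨w, hwc, hw0, hwG, hVc⟩ := exists_weight m.isClosed_gluing hν
  obtain ⟨τ, hτc, hτ, hτd, hτs⟩ := m.exists_timeSpan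
  set V : TangentBundle 𝓘(ℝ, E) 𝓜 → ℝ := fun W => w W.1 * ν W.1 W.2 with hV
  set k : TangentBundle 𝓘(ℝ, E) 𝓜 → ℝ → ℝ := fun W t => V (m.tangentFlow t W) with hk
  set u : 𝓜 → ℝ → ℝ := fun p t => w (m.flow t p) with hu
  have hproj : Continuous fun W : TangentBundle 𝓘(ℝ, E) 𝓜 => W.1 :=
    FiberBundle.continuous_proj E (TangentSpace 𝓘(ℝ, E))
  have hkc : ∀ W, ContinuousOn (k W) (Icc 0 (τ W.1)) := fun W =>
    hVc.comp_continuousOn (m.continuousOn_tangentFlow.comp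
      (Continuous.prodMk_left W).continuousOn fun t ht => hτd W.1 t ht)
  have huc : ∀ p, ContinuousOn (u p) (Icc 0 (τ p)) := fun p =>
    hwc.comp_continuousOn (m.flow_smooth.continuousOn.comp
      (Continuous.prodMk_left p).continuousOn fun t ht => hτd p t ht)
  have hupos : ∀ p, m.flow 0 p = p → 0 < windowSup (u p) (τ p) := by
    intro p _
    obtain ⟨t, ht, htτ⟩ := (((m.eventually_not_mem_gluing p).filter_mono
      (nhdsWithin_mono 0 fun x (hx : x ∈ Ioi (0 : ℝ)) => hx.ne')).and
      (Ioo_mem_nhdsGT (hτ p).1)).exists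
    refine lt_of_lt_of_le ?_ (le_windowSup (hτ p).1 (huc p) ⟨htτ.1.le, htτ.2.le⟩)
    exact lt_of_le_of_ne (hw0 _) fun h => ht ((hwG _).1 h.symm)
  replace hupos : ∀ p, 0 < windowSup (u p) (τ p) := fun p => hupos p (m.flow_zero p)
  have hVn : ∀ W, 0 ≤ V W := fun W => by
    by_cases h : W.1 ∈ m.gluing
    · simp only [hV, (hwG _).2 h, zero_mul, le_refl]
    · exact mul_nonneg (hw0 _) (hν.nonneg h _)
  have hVs : ∀ (p : 𝓜) (c : ℝ) (v : E), V ⟨p, c • v⟩ = |c| * V ⟨p, v⟩ := fun p c v => by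
    by_cases h : p ∈ m.gluing
    · simp only [hV, (hwG _).2 h, zero_mul, mul_zero]
    · change w p * ν p (c • v) = |c| * (w p * ν p v)
      have h1 : ν p (c • v) = |c| * ν p v := hν.smul p h v Submodule.mem_top c
      rw [h1]; ring
  have hVa : ∀ (p : 𝓜) (v v' : E), V ⟨p, v + v'⟩ ≤ V ⟨p, v⟩ + V ⟨p, v'⟩ := fun p v v' => by
    by_cases h : p ∈ m.gluing
    · simp only [hV, (hwG _).2 h, zero_mul, add_zero, le_refl]
    · change w p * ν p (v + v') ≤ w p * ν p v + w p * ν p v'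
      have h1 : ν p (v + v') ≤ ν p v + ν p v' :=
        hν.add_le p h v Submodule.mem_top v' Submodule.mem_top
      rw [← mul_add]
      exact mul_le_mul_of_nonneg_left h1 (hw0 p)
  have hks : ∀ (p : 𝓜) (c : ℝ) (v : E) t, k ⟨p, c • v⟩ t = |c| * k ⟨p, v⟩ t := fun p c v t => by
    refine (congrArg (fun x : E => V ⟨m.flow t p, x⟩) (?_ : _ = c • (m.dflow t p : E →L[ℝ] E) v)).trans
      (hVs _ c _)
    exact map_smul (m.dflow t p : E →L[ℝ] E) c v
  have hka : ∀ (p : 𝓜) (v v' : E) t, k ⟨p, v + v'⟩ t ≤ k ⟨p, v⟩ t + k ⟨p, v'⟩ t :=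
    fun p v v' t => by
    refine (congrArg (fun x : E => V ⟨m.flow t p, x⟩)
      (?_ : _ = (m.dflow t p : E →L[ℝ] E) v + (m.dflow t p : E →L[ℝ] E) v')).trans_le
      (hVa _ _ _)
    exact map_add (m.dflow t p : E →L[ℝ] E) v v'
  refine ⟨fun p v => windowSup (k ⟨p, v⟩) (τ p) / windowSup (u p) (τ p), ⟨?_, ?_, ?_, ?_⟩, ?_⟩
  · intro p _ v _ hv
    refine div_pos ?_ (hupos p)
    -- A short time off the gluing region has positive weight. It is also taken so short that the
    -- flow can be reversed, whence `dφ_t` is injective at `p` even if `p` is not trapped.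
    have h1 : Tendsto (fun t => (-t, m.flow t p)) (𝓝[>] 0) (𝓝 ((0 : ℝ), p)) := by
      have h2 : Tendsto (fun t : ℝ => -t) (𝓝 0) (𝓝 0) := by
        simpa using (continuous_neg (G := ℝ)).tendsto 0
      exact (h2.prodMk_nhds (m.tendsto_flow_zero p)).mono_left nhdsWithin_le_nhds
    obtain ⟨t, ht, htd, htτ⟩ := (((m.eventually_not_mem_gluing p).filter_mono
      (nhdsWithin_mono 0 fun x (hx : x ∈ Ioi (0 : ℝ)) => hx.ne')).and
      ((h1.eventually (m.isOpen_domain.mem_nhds (m.zero_mem_domain p))).and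
      (Ioo_mem_nhdsGT (hτ p).1))).exists
    have htI : t ∈ Icc 0 (τ p) := ⟨htτ.1.le, htτ.2.le⟩
    refine lt_of_lt_of_le ?_ (le_windowSup (hτ p).1 (hkc ⟨p, v⟩) htI)
    refine mul_pos (lt_of_le_of_ne (hw0 _) fun h => ht ((hwG _).1 h.symm)) ?_
    refine hν.pos _ ht _ Submodule.mem_top fun h0 => hv ?_
    have h3 := m.tangentFlow_add (W := ⟨p, v⟩) (hτd p t htI) htd
      (by rw [neg_add_cancel]; exact m.zero_mem_domain p)
    rw [neg_add_cancel, m.tangentFlow_zero] at h3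
    have h4 : (m.dflow (-t) (m.flow t p) : E →L[ℝ] E) ((m.dflow t p : E →L[ℝ] E) v) = v :=
      congrArg (fun Z : TangentBundle 𝓘(ℝ, E) 𝓜 => (Z.2 : E)) h3
    have h5 : (m.dflow t p : E →L[ℝ] E) v = 0 := h0
    rw [h5, map_zero] at h4
    exact h4.symm
  · intro p _ v _ c
    have h1 : k ⟨p, c • v⟩ = fun t => |c| * k ⟨p, v⟩ t := funext fun t => hks p c v t
    rw [h1, windowSup_const_mul (hτ p).1 (hkc ⟨p, v⟩) (abs_nonneg c), mul_div_assoc]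
  · intro p _ v _ v' _
    rw [← add_div]
    refine div_le_div_of_nonneg_right ?_ (hupos p).le
    obtain ⟨t, ht, h⟩ := exists_windowSup_eq (hτ p).1 (hkc ⟨p, v + v'⟩)
    rw [h]
    exact (hka p v v' t).trans (add_le_add (le_windowSup (hτ p).1 (hkc ⟨p, v⟩) ht)
      (le_windowSup (hτ p).1 (hkc ⟨p, v'⟩) ht))
  · refine Continuous.continuousOn (Continuous.div ?_ ?_ fun W => (hupos W.1).ne')
    · refine isCompact_univ.continuous_sSup
        (f := fun (W : TangentBundle 𝓘(ℝ, E) 𝓜) (θ : unitInterval) => k W (θ * τ W.1)) ?_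
      have h1 : Continuous fun z : TangentBundle 𝓘(ℝ, E) 𝓜 × unitInterval =>
          ((z.2 : ℝ) * τ z.1.1, z.1) :=
        ((continuous_subtype_val.comp continuous_snd).mul
          (hτc.comp (hproj.comp continuous_fst))).prodMk continuous_fst
      exact hVc.comp (m.continuousOn_tangentFlow.comp_continuous h1 fun z =>
        hτd _ _ (mul_mem_Icc_of_unitInterval (hτ _).1.le z.2))
    · have h0 : Continuous fun p : 𝓜 => windowSup (u p) (τ p) := by
        refine isCompact_univ.continuous_sSup
          (f := fun (p : 𝓜) (θ : unitInterval) => u p (θ * τ p)) ?_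
        have h1 : Continuous fun z : 𝓜 × unitInterval => ((z.2 : ℝ) * τ z.1, z.1) :=
          ((continuous_subtype_val.comp continuous_snd).mul
            (hτc.comp continuous_fst)).prodMk continuous_fst
        exact hwc.comp (m.flow_smooth.continuousOn.comp_continuous h1 fun z =>
          hτd _ _ (mul_mem_Icc_of_unitInterval (hτ _).1.le z.2))
      exact h0.comp hproj
  · intro C₀ C₁ hC₀ hC₁
    -- `exp C₁` pays for the window length of at most `1`; the maximum with `1` serves the case of
    -- overlapping windows, where no decay is used.
    have hCpos : 0 < max C₀ 1 * Real.exp C₁ := by positivity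
    refine ⟨max C₀ 1 * Real.exp C₁, hCpos, fun W hW => ?_⟩
    set x : ℝ → ℝ := fun t => w (m.flow t W.1) with hx
    set h : ℝ → ℝ := fun t => ν _ (m.tangentFlow t W).2 with hh
    have hx0 : ∀ t, 0 ≤ x t := fun t => hw0 _
    have hxG : ∀ t, 0 < x t → m.flow t W.1 ∉ m.gluing := fun t ht hG => ht.ne' ((hwG _).2 hG)
    have hhn : ∀ t, 0 < x t → 0 ≤ h t := fun t ht => hν.nonneg (hxG t ht) _
    have ha := (hτ W.1).1
    have hkx : ∀ t, k W t = x t * h t := fun t => rfl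
    have hshift : ∀ s t, k (m.tangentFlow s W) t = x (t + s) * h (t + s) := fun s t => by
      change V (m.tangentFlow t (m.tangentFlow s W)) = V (m.tangentFlow (t + s) W)
      rw [tangentFlow_add_of_mem_trapped hW]
    have hshiftu : ∀ s t, u (m.flow s W.1) t = x (t + s) := fun s t => by
      change w (m.flow t (m.flow s W.1)) = w (m.flow (t + s) W.1)
      rw [flow_add_of_mem_trapped hW]
    -- the data of the two windows
    set J₂ := Icc 0 (τ W.1) with hJ₂
    have hN₂ : ∀ t ∈ J₂, x t * h t ≤ windowSup (k W) (τ W.1) := fun t ht =>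
      le_windowSup ha (hkc W) ht
    have hW₂ : ∀ t ∈ J₂, x t ≤ windowSup (u W.1) (τ W.1) := fun t ht =>
      le_windowSup ha (huc W.1) ht
    obtain ⟨tN, htN, hNeq⟩ := exists_windowSup_eq ha (hkc W)
    obtain ⟨tW, htW, hWeq⟩ := exists_windowSup_eq ha (huc W.1)
    -- The window at `φ_s(p)`, written in the time of `p`, is `[s, b + s]`; its right end is not
    -- before that of the window at `p`.
    have later : ∀ s : ℝ, 0 ≤ s → ∃ b : ℝ, τ W.1 ≤ b + s ∧
        (∀ t ∈ Icc s (b + s), x t * h t ≤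
          windowSup (k (m.tangentFlow s W)) (τ (m.flow s W.1))) ∧
        (∀ t ∈ Icc s (b + s), x t ≤ windowSup (u (m.flow s W.1)) (τ (m.flow s W.1))) ∧
        (∃ t ∈ Icc s (b + s), windowSup (k (m.tangentFlow s W)) (τ (m.flow s W.1)) =
          x t * h t) ∧
        ∃ t ∈ Icc s (b + s), windowSup (u (m.flow s W.1)) (τ (m.flow s W.1)) = x t := by
      intro s hs
      have hb := (hτ (m.flow s W.1)).1
      refine ⟨τ (m.flow s W.1), hτs W.1 hW s hs, fun t ht => ?_, fun t ht => ?_, ?_, ?_⟩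
      · have h1 := le_windowSup hb (hkc (m.tangentFlow s W)) (t := t - s)
          ⟨by linarith [ht.1], by linarith [ht.2]⟩
        rwa [hshift, sub_add_cancel] at h1
      · have h1 := le_windowSup hb (huc (m.flow s W.1)) (t := t - s)
          ⟨by linarith [ht.1], by linarith [ht.2]⟩
        rwa [hshiftu, sub_add_cancel] at h1
      · obtain ⟨t, ht, h1⟩ := exists_windowSup_eq hb (hkc (m.tangentFlow s W))
        exact ⟨t + s, ⟨by linarith [ht.1], by linarith [ht.2]⟩, by rw [← hshift]; exact h1⟩
      · obtain ⟨t, ht, h1⟩ := exists_windowSup_eq hb (huc (m.flow s W.1))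
        exact ⟨t + s, ⟨by linarith [ht.1], by linarith [ht.2]⟩, by rw [h1, hshiftu]⟩
    have hexp : ∀ s r r' : ℝ, r ≤ 1 → s ≤ r' → C₀ * Real.exp (-C₁ * (r' - r)) ≤
        max C₀ 1 * Real.exp C₁ * Real.exp (-C₁ * s) := fun s r r' hr hr' => by
      rw [mul_assoc, ← Real.exp_add]
      refine mul_le_mul (le_max_left _ _) (Real.exp_le_exp.2 ?_) (Real.exp_pos _).le (by positivity)
      nlinarith
    have hexp1 : ∀ s : ℝ, s ≤ 1 → 1 ≤ max C₀ 1 * Real.exp C₁ * Real.exp (-C₁ * s) :=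
      fun s hs => by
      rw [mul_assoc, ← Real.exp_add]
      exact one_le_mul_of_one_le_of_one_le (le_max_right _ _) (Real.one_le_exp (by nlinarith))
    constructor
    · intro hest s hs
      obtain ⟨b, hb, -, hl2, ⟨t₁, ht₁, hN₁⟩, -⟩ := later s hs
      -- The later window is evaluated where its numerator is maximal, the earlier one where its
      -- weight is.
      refine ratio_le (J₁ := Icc s (b + s)) (J₂ := J₂) (t₁ := t₁) (t₂ := tW) (by positivity) hx0
        hhn ht₁ hN₁ hl2 (hupos _) htW hN₂ hWeq (hupos _) ?_
      rcases le_or_gt tW t₁ with hle | hlt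
      · refine Or.inl fun hpos => ?_
        have hposW : 0 < x tW := by
          have h0 := hupos W.1
          rw [hWeq] at h0
          exact h0
        refine (hest tW t₁ hle (hxG _ hposW) (hxG _ hpos)).trans ?_
        exact mul_le_mul_of_nonneg_right
          (hexp s tW t₁ (htW.2.trans (hτ _).2) ht₁.1) (hhn _ hposW)
      -- The times are in the wrong order for the estimate. Then `s ≤ t₁ < tW ≤ 1`, both times
      -- belong to both windows, and the constant is at least `1`.
      · refine Or.inr ⟨⟨hs.trans ht₁.1, hlt.le.trans htW.2⟩,
          ⟨ht₁.1.trans hlt.le, htW.2.trans hb⟩, hexp1 s ?_⟩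
        linarith [ht₁.1, htW.2, (hτ W.1).2]
    · intro hest s hs
      obtain ⟨b, hb, hl1, -, -, ⟨t₂, ht₂, hW₂eq⟩⟩ := later s hs
      have key : windowSup (k W) (τ W.1) / windowSup (u W.1) (τ W.1) ≤
          max C₀ 1 * Real.exp C₁ * Real.exp (-C₁ * s) *
          (windowSup (k (m.tangentFlow s W)) (τ (m.flow s W.1)) /
            windowSup (u (m.flow s W.1)) (τ (m.flow s W.1))) := by
        -- Expansion forward is contraction backward, so the two windows exchange roles.
        refine ratio_le (J₁ := J₂) (J₂ := Icc s (b + s)) (t₁ := tN) (t₂ := t₂) (by positivity) hx0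
          hhn htN hNeq hW₂ (hupos _) ht₂ hl1 hW₂eq (hupos _) ?_
        rcases le_or_gt tN t₂ with hle | hlt
        · refine Or.inl fun hpos => ?_
          have hposW : 0 < x t₂ := by
            have h0 := hupos (m.flow s W.1)
            rw [hW₂eq] at h0
            exact h0
          have h1 := hest tN t₂ hle (hxG _ hpos) (hxG _ hposW)
          have h2 : h tN ≤ C₀ * Real.exp (-C₁ * (t₂ - tN)) * h t₂ := by
            have h3 := mul_le_mul_of_nonneg_left h1
              (by positivity : 0 ≤ C₀ * Real.exp (-C₁ * (t₂ - tN)))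
            refine le_trans (le_of_eq ?_) h3
            rw [neg_mul, Real.exp_neg]
            field_simp
            rfl
          exact h2.trans (mul_le_mul_of_nonneg_right
            (hexp s tN t₂ (htN.2.trans (hτ _).2) ht₂.1) (hhn _ hposW))
        · refine Or.inr ⟨⟨ht₂.1.trans hlt.le, htN.2.trans hb⟩,
            ⟨hs.trans ht₂.1, hlt.le.trans htN.2⟩, hexp1 s ?_⟩
          linarith [ht₂.1, htN.2, (hτ W.1).2]
      have h3 := mul_le_mul_of_nonneg_left key
        (by positivity : 0 ≤ (max C₀ 1 * Real.exp C₁)⁻¹ * Real.exp (C₁ * s))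
      refine h3.trans (le_of_eq ?_)
      rw [neg_mul, Real.exp_neg]
      have h4 := (Real.exp_pos (C₁ * s)).ne'
      have h5 := (Real.exp_pos C₁).ne'
      have h6 : max C₀ 1 ≠ 0 := by positivity
      change _ = windowSup (k (m.tangentFlow s W)) (τ (m.flow s W.1)) /
            windowSup (u (m.flow s W.1)) (τ (m.flow s W.1))
      field_simp

end SmoothModel

end AdaptedNorm

/-! ### Pulling back direct sum decompositions. -/

theorem iSupIndep.comap_of_injective {ι R V V' : Type*} [Ring R] [AddCommGroup V] [Module R V]
    [AddCommGroup V'] [Module R V'] {p : ι → Submodule R V'} (hp : iSupIndep p) {L : V →ₗ[R] V'}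
    (hL : Function.Injective L) : iSupIndep fun i => (p i).comap L := by
  intro i
  rw [Submodule.disjoint_def]
  intro x hx hx'
  have h1 : (⨆ j, ⨆ (_ : j ≠ i), (p j).comap L) ≤ (⨆ j, ⨆ (_ : j ≠ i), p j).comap L :=
    iSup₂_le fun j hj => Submodule.comap_mono (le_iSup₂_of_le j hj le_rfl)
  have h2 := (Submodule.disjoint_def.1 (hp i)) (L x) hx (h1 hx')
  exact hL (h2.trans (map_zero L).symm)

theorem IsSplitting.le_right {V : Type*} [AddCommGroup V] [Module ℝ V] {X : V}
    {A B T : Submodule ℝ V} (h : IsSplitting X A B T) : A ≤ T ∧ B ≤ T :=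
  ⟨h.2.1 ▸ le_sup_right.trans le_sup_left, h.2.1 ▸ le_sup_right⟩

/-- The summands lie in the range of `L`, so the components of `L v` have preimages, and injectivity
assembles these to `v`. -/
theorem IsSplitting.comap {V V' : Type*} [AddCommGroup V] [Module ℝ V] [AddCommGroup V']
    [Module ℝ V'] {L : V →ₗ[ℝ] V'} (hL : Function.Injective L) {X : V} {A B : Submodule ℝ V'}
    (h : IsSplitting (L X) A B L.range) : IsSplitting X (A.comap L) (B.comap L) ⊤ := by
  have hA := h.le_right.1
  have hB := h.le_right.2
  refine ⟨fun h0 => h.1 (by rw [h0, map_zero]), ?_, ?_⟩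
  · refine eq_top_iff.2 fun v _ => ?_
    have hv : L v ∈ Submodule.span ℝ {L X} ⊔ A ⊔ B := h.2.1 ▸ LinearMap.mem_range_self L v
    obtain ⟨y, hy, b, hb, hyb⟩ := Submodule.mem_sup.1 hv
    obtain ⟨x, hx, a, ha, rfl⟩ := Submodule.mem_sup.1 hy
    obtain ⟨c, rfl⟩ := Submodule.mem_span_singleton.1 hx
    obtain ⟨a, rfl⟩ := hA ha
    obtain ⟨b, rfl⟩ := hB hb
    have hvab : v = c • X + a + b := hL (by rw [map_add, map_add, map_smul, hyb])
    rw [hvab]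
    exact Submodule.add_mem_sup (Submodule.add_mem_sup
      (Submodule.smul_mem _ c (Submodule.mem_span_singleton_self X)) ha) hb
  · refine (iSupIndep.comap_of_injective h.2.2 hL).mono fun i => ?_
    fin_cases i
    · refine (Submodule.span_singleton_le_iff_mem _ _).2 ?_
      exact Submodule.mem_span_singleton_self (L X)
    · exact le_rfl
    · exact le_rfl

/-! ### The splitting on the model. -/

section ExtendedSubbundle

variable {n : ℕ} {Q : Type*} [TopologicalSpace Q] [ChartedSpace (EuclideanSpace ℝ (Fin n)) Q]
  [IsManifold (𝓡 n) ∞ Q] [T2Space Q] {B : BilliardSystem n Q}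
  {E : Type*} [NormedAddCommGroup E] [NormedSpace ℝ E]
  {𝓜 : Type*} [TopologicalSpace 𝓜] [T2Space 𝓜] [ChartedSpace E 𝓜] [IsManifold 𝓘(ℝ, E) ∞ 𝓜]
  (m : SmoothModel B E 𝓜)

namespace SmoothModel

theorem exists_flow_not_mem_gluing (p : 𝓜) : ∃ t : ℝ, m.flow t p ∉ m.gluing :=
  (m.eventually_not_mem_gluing p).exists

/-- A time at which the trajectory of `p` is off the gluing region. -/
def offTime (p : 𝓜) : ℝ := (m.exists_flow_not_mem_gluing p).choose

theorem flow_offTime (p : 𝓜) : m.flow (m.offTime p) p ∉ m.gluing :=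
  (m.exists_flow_not_mem_gluing p).choose_spec

/-- The differential of the flow, followed by that of the inverse of the projection. -/
def dflowLift (t : ℝ) (p : 𝓜) :
    E →L[ℝ] EuclideanSpace ℝ (Fin n) × EuclideanSpace ℝ (Fin n) :=
  (m.dlift (m.flow t p)).comp (m.dflow t p : E →L[ℝ] E)

/-- The pullback of a subbundle over the phase space to the model, extended by the flow over the
gluing region. -/
def extend (F : ∀ q : TangentBundle (𝓡 n) Q, Submodule ℝ (TangentSpace (𝓡 n).tangent q)) (p : 𝓜) :
    Submodule ℝ (TangentSpace 𝓘(ℝ, E) p) :=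
  Submodule.comap (M := E) (m.dflowLift (m.offTime p) p).toLinearMap
    (F (m.lift (m.flow (m.offTime p) p)))

variable {m} {p : 𝓜} {t : ℝ}

theorem dflow_neg_dflow (hp : p ∈ m.trapped) (t : ℝ) (w : E) :
    (m.dflow (-t) (m.flow t p) : E →L[ℝ] E) ((m.dflow t p : E →L[ℝ] E) w) = w := by
  have h := tangentFlow_add_of_mem_trapped (W := (⟨p, w⟩ : TangentBundle 𝓘(ℝ, E) 𝓜)) hp t (-t)
  rw [neg_add_cancel, m.tangentFlow_zero] at h
  exact congrArg (fun Z : TangentBundle 𝓘(ℝ, E) 𝓜 => (Z.2 : E)) h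

theorem flow_neg_flow (hp : p ∈ m.trapped) (t : ℝ) : m.flow (-t) (m.flow t p) = p := by
  rw [flow_add_of_mem_trapped hp, neg_add_cancel, m.flow_zero]

theorem dflow_dflow_neg (hp : p ∈ m.trapped) (t : ℝ) (w : E) :
    (m.dflow t p : E →L[ℝ] E) ((m.dflow (-t) (m.flow t p) : E →L[ℝ] E) w) = w := by
  have h := dflow_neg_dflow (flow_mem_trapped hp t) (-t) w
  have h1 : ∀ p' : 𝓜, p' = p → ∀ s, s = t → ∀ w' : E,
      (m.dflow s p' : E →L[ℝ] E) w' = (m.dflow t p : E →L[ℝ] E) w' := by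
    rintro _ rfl _ rfl _; rfl
  exact (h1 _ (flow_neg_flow hp t) _ (neg_neg t) _).symm.trans h

theorem dlift_injective (hp : p ∉ m.gluing) : Function.Injective (m.dlift p) := fun v w h => by
  rw [← m.dproj_dlift hp v, h, m.dproj_dlift hp w]

theorem dflowLift_injective (hp : p ∈ m.trapped) (ht : m.flow t p ∉ m.gluing) :
    Function.Injective (m.dflowLift t p) :=
  (dlift_injective ht).comp (Function.LeftInverse.injective (dflow_neg_dflow hp t))

theorem dflowLift_mem (ht : m.flow t p ∉ m.gluing) (w : E) :
    m.dflowLift t p w ∈ unitTangent B.metric (m.lift (m.flow t p)) :=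
  m.dlift_mem ht _

/-- The inverse of `dflowLift`. -/
theorem dflowLift_dflow_dproj (hp : p ∈ m.trapped) (ht : m.flow t p ∉ m.gluing)
    (W : EuclideanSpace ℝ (Fin n) × EuclideanSpace ℝ (Fin n))
    (hW : W ∈ unitTangent B.metric (m.lift (m.flow t p))) :
    m.dflowLift t p ((m.dflow (-t) (m.flow t p) : E →L[ℝ] E)
      ((m.dproj (m.lift (m.flow t p)) :
        EuclideanSpace ℝ (Fin n) × EuclideanSpace ℝ (Fin n) →L[ℝ] E) W)) = W := by
  refine (congrArg (m.dlift (m.flow t p)) (dflow_dflow_neg hp t _)).trans ?_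
  exact m.dlift_dproj ht W hW

theorem range_dflowLift (hp : p ∈ m.trapped) (ht : m.flow t p ∉ m.gluing) :
    (m.dflowLift t p).toLinearMap.range = unitTangent B.metric (m.lift (m.flow t p)) := by
  refine le_antisymm ?_ fun W hW => ⟨_, dflowLift_dflow_dproj hp ht W hW⟩
  rintro _ ⟨w, rfl⟩
  exact dflowLift_mem ht w

theorem dflowLift_generator (hp : p ∈ m.trapped) (ht : m.flow t p ∉ m.gluing) :
    m.dflowLift t p (m.generator p) = B.flowDir (m.lift (m.flow t p)) := by
  refine (congrArg (m.dlift (m.flow t p)) (m.dflow_generator (hp.1 t))).trans ?_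
  exact (m.flowDir_lift ht).symm

theorem lift_flow_mem (hp : p ∈ m.trapped) (ht : m.flow t p ∉ m.gluing) :
    m.lift (m.flow t p) ∈ B.trapped ∩ B.phaseInt :=
  ⟨(m.lift_mem_trapped ht).2 (flow_mem_trapped hp t), m.lift_mem ht⟩

/-- The differential of the billiard flow takes `dflowLift s p w` to `dflowLift t p w`. -/
theorem dflow_dflowLift (hp : p ∈ m.trapped) {s : ℝ} (hs : m.flow s p ∉ m.gluing)
    (ht : m.flow t p ∉ m.gluing) (w : E) :
    (⟨B.flow (t - s) (m.lift (m.flow s p)),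
      (B.dflow (t - s) (m.lift (m.flow s p)) : EuclideanSpace ℝ (Fin n) × EuclideanSpace ℝ (Fin n)
        →L[ℝ] EuclideanSpace ℝ (Fin n) × EuclideanSpace ℝ (Fin n)) (m.dflowLift s p w)⟩ :
      TangentBundle (𝓡 n).tangent (TangentBundle (𝓡 n) Q)) =
    ⟨m.lift (m.flow t p), m.dflowLift t p w⟩ := by
  have hst : m.flow (t - s) (m.flow s p) = m.flow t p := by
    rw [flow_add_of_mem_trapped hp, sub_add_cancel]
  have ht' : m.flow (t - s) (m.flow s p) ∉ m.gluing := by rwa [hst]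
  have hd := (flow_mem_trapped hp s).1 (t - s)
  have h1 := m.flow_lift hs hd ht'
  have h2 := m.dflow_dlift hs hd ht' ((m.dflow s p : E →L[ℝ] E) w)
  have h3 := tangentFlow_add_of_mem_trapped (W := (⟨p, w⟩ : TangentBundle 𝓘(ℝ, E) 𝓜)) hp s (t - s)
  rw [sub_add_cancel] at h3
  have h4 : ∀ (x y : TangentBundle (𝓡 n) Q)
      (v w : EuclideanSpace ℝ (Fin n) × EuclideanSpace ℝ (Fin n)), x = y → v = w →
      (⟨x, v⟩ : TangentBundle (𝓡 n).tangent (TangentBundle (𝓡 n) Q)) = ⟨y, w⟩ := by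
    rintro x _ v _ rfl rfl; rfl
  -- An equality in the total space, since the base points `B.flow (t - s) _` and `m.lift (m.flow t
  -- p)` are equal only propositionally.
  refine (h4 _ _ _ _ h1 h2).trans ?_
  exact congrArg (fun Z : TangentBundle 𝓘(ℝ, E) 𝓜 =>
    (⟨m.lift Z.1, m.dlift Z.1 Z.2⟩ : TangentBundle (𝓡 n).tangent (TangentBundle (𝓡 n) Q))) h3

variable {F : ∀ q : TangentBundle (𝓡 n) Q, Submodule ℝ (TangentSpace (𝓡 n).tangent q)}

/-- Invariance under the billiard flow carries membership from the time `s` to the time `t`. There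
is no order between the two, so the condition is the same at all times off the gluing region. -/
theorem dflowLift_mem_of_mem
    (hF : ∀ q ∈ B.trapped ∩ B.phaseInt, ∀ t : ℝ, B.flow t q ∈ B.trapped ∩ B.phaseInt →
      (F q).map (B.dflow t q).toLinearMap = F (B.flow t q))
    (hp : p ∈ m.trapped) {s : ℝ} (hs : m.flow s p ∉ m.gluing) (ht : m.flow t p ∉ m.gluing) {w : E}
    (hw : m.dflowLift s p w ∈ F (m.lift (m.flow s p))) :
    m.dflowLift t p w ∈ F (m.lift (m.flow t p)) := by
  have h1 := dflow_dflowLift hp hs ht w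
  have h2 : B.flow (t - s) (m.lift (m.flow s p)) ∈ B.trapped ∩ B.phaseInt := by
    have h3 : B.flow (t - s) (m.lift (m.flow s p)) = m.lift (m.flow t p) :=
      congrArg (fun Z : TangentBundle (𝓡 n).tangent (TangentBundle (𝓡 n) Q) => Z.1) h1
    rw [h3]
    exact lift_flow_mem hp ht
  have h3 : (⟨B.flow (t - s) (m.lift (m.flow s p)),
      (B.dflow (t - s) (m.lift (m.flow s p)) : EuclideanSpace ℝ (Fin n) × EuclideanSpace ℝ (Fin n)
        →L[ℝ] EuclideanSpace ℝ (Fin n) × EuclideanSpace ℝ (Fin n)) (m.dflowLift s p w)⟩ :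
      TangentBundle (𝓡 n).tangent (TangentBundle (𝓡 n) Q)) ∈
      {Z : TangentBundle (𝓡 n).tangent (TangentBundle (𝓡 n) Q) | Z.2 ∈ F Z.1} := by
    change _ ∈ F (B.flow (t - s) (m.lift (m.flow s p)))
    rw [← hF _ (lift_flow_mem hp hs) _ h2]
    exact Submodule.mem_map_of_mem hw
  rw [h1] at h3
  exact h3

theorem extend_eq
    (hF : ∀ q ∈ B.trapped ∩ B.phaseInt, ∀ t : ℝ, B.flow t q ∈ B.trapped ∩ B.phaseInt →
      (F q).map (B.dflow t q).toLinearMap = F (B.flow t q))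
    (hp : p ∈ m.trapped) (ht : m.flow t p ∉ m.gluing) :
    m.extend F p = Submodule.comap (M := E) (m.dflowLift t p).toLinearMap
      (F (m.lift (m.flow t p))) :=
  le_antisymm (fun _ hw => dflowLift_mem_of_mem hF hp (m.flow_offTime p) ht hw)
    fun _ hw => dflowLift_mem_of_mem hF hp ht (m.flow_offTime p) hw

/-- Test both memberships at one point of the trajectory off the gluing region; they become the same
condition there by the chain rule. -/
theorem dflow_mem_extend_iff
    (hF : ∀ q ∈ B.trapped ∩ B.phaseInt, ∀ t : ℝ, B.flow t q ∈ B.trapped ∩ B.phaseInt →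
      (F q).map (B.dflow t q).toLinearMap = F (B.flow t q))
    (hp : p ∈ m.trapped) (w : E) :
    (m.dflow t p : E →L[ℝ] E) w ∈ m.extend F (m.flow t p) ↔ w ∈ m.extend F p := by
  obtain ⟨s, hs⟩ := m.exists_flow_not_mem_gluing (m.flow t p)
  have hs' : m.flow (s + t) p ∉ m.gluing := by rwa [← flow_add_of_mem_trapped hp]
  rw [extend_eq hF (flow_mem_trapped hp t) hs, extend_eq hF hp hs']
  have h := tangentFlow_add_of_mem_trapped (W := (⟨p, w⟩ : TangentBundle 𝓘(ℝ, E) 𝓜)) hp t s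
  have h1 := congrArg (fun Z : TangentBundle 𝓘(ℝ, E) 𝓜 => m.dlift Z.1 Z.2 ∈ F (m.lift Z.1)) h
  exact Iff.of_eq h1

theorem map_extend
    (hF : ∀ q ∈ B.trapped ∩ B.phaseInt, ∀ t : ℝ, B.flow t q ∈ B.trapped ∩ B.phaseInt →
      (F q).map (B.dflow t q).toLinearMap = F (B.flow t q))
    (hp : p ∈ m.trapped) (t : ℝ) :
    (m.extend F p).map (m.dflow t p).toLinearMap = m.extend F (m.flow t p) := by
  refine le_antisymm ?_ fun w hw => ?_
  · rintro _ ⟨w, hw, rfl⟩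
    exact (dflow_mem_extend_iff hF hp w).2 hw
  · have h := dflow_dflow_neg hp t w
    exact ⟨(m.dflow (-t) (m.flow t p) : E →L[ℝ] E) w,
      (dflow_mem_extend_iff hF hp _).1 (by rw [h]; exact hw), h⟩

theorem extend_eq_comap
    (hF : ∀ q ∈ B.trapped ∩ B.phaseInt, ∀ t : ℝ, B.flow t q ∈ B.trapped ∩ B.phaseInt →
      (F q).map (B.dflow t q).toLinearMap = F (B.flow t q))
    (hp : p ∈ m.trapped) (t : ℝ) :
    m.extend F p = (m.extend F (m.flow t p)).comap (m.dflow t p).toLinearMap :=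
  Submodule.ext fun w => (dflow_mem_extend_iff hF hp w).symm

theorem mem_extend_of_not_mem_gluing
    (hF : ∀ q ∈ B.trapped ∩ B.phaseInt, ∀ t : ℝ, B.flow t q ∈ B.trapped ∩ B.phaseInt →
      (F q).map (B.dflow t q).toLinearMap = F (B.flow t q))
    (hp : p ∈ m.trapped) (hpG : p ∉ m.gluing) (w : E) :
    w ∈ m.extend F p ↔ m.dlift p w ∈ F (m.lift p) := by
  have h0 : m.flow 0 p ∉ m.gluing := by rwa [m.flow_zero]
  rw [extend_eq hF hp h0]
  have h := m.tangentFlow_zero ⟨p, w⟩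
  exact Iff.of_eq
    (congrArg (fun Z : TangentBundle 𝓘(ℝ, E) 𝓜 => m.dlift Z.1 Z.2 ∈ F (m.lift Z.1)) h)

theorem extend_proj
    (hF : ∀ q ∈ B.trapped ∩ B.phaseInt, ∀ t : ℝ, B.flow t q ∈ B.trapped ∩ B.phaseInt →
      (F q).map (B.dflow t q).toLinearMap = F (B.flow t q))
    {q : TangentBundle (𝓡 n) Q} (hq : q ∈ B.trapped ∩ B.phaseInt)
    (hFT : F q ≤ unitTangent B.metric q) :
    m.extend F (m.proj q) = (F q).map (m.dproj q).toLinearMap := by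
  have hpG := m.proj_not_mem_gluing hq.2
  have hl := m.lift_proj hq.2
  have hp : m.proj q ∈ m.trapped :=
    (m.proj_mem_trapped_iff (B.phaseInt_subset_nonGrazing hq.2)).2 hq.1
  have key : ∀ p : 𝓜, p ∈ m.trapped → p ∉ m.gluing →
      F (m.lift p) ≤ unitTangent B.metric (m.lift p) → ∀ w : E, w ∈ m.extend F p ↔
        ∃ W : EuclideanSpace ℝ (Fin n) × EuclideanSpace ℝ (Fin n), W ∈ F (m.lift p) ∧
          (m.dproj (m.lift p) : EuclideanSpace ℝ (Fin n) × EuclideanSpace ℝ (Fin n) →L[ℝ] E) W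
            = w := by
    intro p hp hpG hT w
    refine (mem_extend_of_not_mem_gluing hF hp hpG w).trans ⟨fun h => ⟨_, h, m.dproj_dlift hpG w⟩, ?_⟩
    rintro ⟨W, hW, rfl⟩
    rw [m.dlift_dproj hpG W (hT hW)]
    exact hW
  have h := key _ hp hpG (by rw [hl]; exact hFT)
  rw [hl] at h
  exact Submodule.ext h

theorem generator_proj {q : TangentBundle (𝓡 n) Q} (hq : q ∈ B.phaseInt) :
    m.generator (m.proj q) = m.dproj q (B.flowDir q) := by
  have hpG := m.proj_not_mem_gluing hq
  have h1 := m.dproj_dlift hpG (m.generator (m.proj q))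
  have h2 : (m.dproj (m.lift (m.proj q)) :
      EuclideanSpace ℝ (Fin n) × EuclideanSpace ℝ (Fin n) →L[ℝ] E)
      (B.flowDir (m.lift (m.proj q))) = m.generator (m.proj q) :=
    (congrArg (m.dproj (m.lift (m.proj q)) :
      EuclideanSpace ℝ (Fin n) × EuclideanSpace ℝ (Fin n) →L[ℝ] E) (m.flowDir_lift hpG)).trans h1
  rw [m.lift_proj hq] at h2
  exact h2.symm

theorem isSplitting_extend
    {F' : ∀ q : TangentBundle (𝓡 n) Q, Submodule ℝ (TangentSpace (𝓡 n).tangent q)}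
    (hp : p ∈ m.trapped) (hF : ∀ q ∈ B.trapped ∩ B.phaseInt, ∀ t : ℝ,
      B.flow t q ∈ B.trapped ∩ B.phaseInt → (F q).map (B.dflow t q).toLinearMap = F (B.flow t q))
    (hF' : ∀ q ∈ B.trapped ∩ B.phaseInt, ∀ t : ℝ,
      B.flow t q ∈ B.trapped ∩ B.phaseInt → (F' q).map (B.dflow t q).toLinearMap = F' (B.flow t q))
    (h : ∀ q ∈ B.trapped ∩ B.phaseInt,
      IsSplitting (B.flowDir q) (F q) (F' q) (unitTangent B.metric q)) :
    IsSplitting (m.generator p) (m.extend F p) (m.extend F' p) ⊤ := by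
  obtain ⟨t, ht⟩ := m.exists_flow_not_mem_gluing p
  rw [extend_eq hF hp ht, extend_eq hF' hp ht]
  have h1 := h _ (lift_flow_mem hp ht)
  rw [← range_dflowLift hp ht, ← dflowLift_generator hp ht] at h1
  exact IsSplitting.comap (V := E) (V' := EuclideanSpace ℝ (Fin n) × EuclideanSpace ℝ (Fin n))
    (dflowLift_injective hp ht) h1

/-- A time at which `p₀` is off the gluing region works for all nearby points. With this fixed time
a frame over the phase space is pulled back by `dφ_{-t} ∘ dπ`, which inverts `dflowLift` on unit
tangent vectors. -/
theorem isContinuousSubbundleOn_extend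
    (hF : ∀ q ∈ B.trapped ∩ B.phaseInt, ∀ t : ℝ, B.flow t q ∈ B.trapped ∩ B.phaseInt →
      (F q).map (B.dflow t q).toLinearMap = F (B.flow t q))
    (hFT : ∀ q ∈ B.trapped ∩ B.phaseInt, F q ≤ unitTangent B.metric q)
    (hFc : IsContinuousSubbundleOn (𝓡 n).tangent (B.trapped ∩ B.phaseInt) F) :
    IsContinuousSubbundleOn 𝓘(ℝ, E) m.trapped (m.extend F) := by
  intro p₀ hp₀
  obtain ⟨t, ht⟩ := m.exists_flow_not_mem_gluing p₀
  obtain ⟨U, hU, hqU, k, e, hec, he⟩ := hFc _ (lift_flow_mem hp₀ ht)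
  have hO : {p : 𝓜 | (t, p) ∈ m.domain ∧ m.flow t p ∉ m.gluing ∧ m.lift (m.flow t p) ∈ U} ∈ 𝓝 p₀ := by
    have h1 := (m.contMDiffAt_flow (hp₀.1 t)).continuousAt
    have h2 := (m.contMDiffAt_lift ht).continuousAt
    exact (m.eventually_mem_domain (hp₀.1 t)).and
      ((h1.eventually (m.isOpen_compl_gluing.mem_nhds ht)).and
        (h1.eventually (h2.eventually (hU.mem_nhds hqU))))
  obtain ⟨O, hOs, hOo, hpO⟩ := mem_nhds_iff.1 hO
  have hmem : ∀ p ∈ m.trapped ∩ O, m.lift (m.flow t p) ∈ (B.trapped ∩ B.phaseInt) ∩ U :=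
    fun p hp => ⟨lift_flow_mem hp.1 (hOs hp.2).2.1, (hOs hp.2).2.2⟩
  have heF : ∀ q ∈ (B.trapped ∩ B.phaseInt) ∩ U, ∀ i, e i q ∈ F q := fun q hq i => by
    rw [← (he q hq).2]
    exact Submodule.subset_span (mem_range_self i)
  set v : Fin k → 𝓜 → E := fun i p => (m.dflow (-t) (m.flow t p) : E →L[ℝ] E)
    ((m.dproj (m.lift (m.flow t p)) :
      EuclideanSpace ℝ (Fin n) × EuclideanSpace ℝ (Fin n) →L[ℝ] E) (e i (m.lift (m.flow t p))))
    with hv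
  have hve : ∀ p ∈ m.trapped ∩ O, ∀ i, m.dflowLift t p (v i p) = e i (m.lift (m.flow t p)) :=
    fun p hp i => dflowLift_dflow_dproj hp.1 (hOs hp.2).2.1 _
      (hFT _ (hmem p hp).1 (heF _ (hmem p hp) i))
  refine ⟨O, hOo, hpO, k, v, fun i => ?_, fun p hp => ?_⟩
  · have h1 : ContinuousOn (fun p => m.lift (m.flow t p)) (m.trapped ∩ O) := fun p hp =>
      ((m.contMDiffAt_lift (hOs hp.2).2.1).continuousAt.comp (f := m.flow t)
        (m.contMDiffAt_flow (hp.1.1 t)).continuousAt).continuousWithinAt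
    have h2 := (hec i).comp h1 hmem
    have h3 := m.continuousOn_dproj.comp h2 fun p hp =>
      ⟨(hmem p hp).1.2, hFT _ (hmem p hp).1 (heF _ (hmem p hp) i)⟩
    have hpl : ∀ p ∈ m.trapped ∩ O, m.proj (m.lift (m.flow t p)) = m.flow t p := fun p hp =>
      m.proj_lift (hOs hp.2).2.1
    have h4 := m.continuousOn_tangentFlow.comp
      ((Continuous.prodMk_right (-t)).comp_continuousOn h3) fun p hp => by
        change (-t, m.proj (m.lift (m.flow t p))) ∈ m.domain
        rw [hpl p hp]
        exact (flow_mem_trapped hp.1 t).1 (-t)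
    refine h4.congr fun p hp => ?_
    have h5 : ∀ x : 𝓜, x = m.flow t p → ∀ w : E,
        (⟨p, (m.dflow (-t) (m.flow t p) : E →L[ℝ] E) w⟩ : TangentBundle 𝓘(ℝ, E) 𝓜) =
          m.tangentFlow (-t) ⟨x, w⟩ := by
      rintro _ rfl w
      exact congrArg (fun y : 𝓜 => (⟨y, (m.dflow (-t) (m.flow t p) : E →L[ℝ] E) w⟩ :
        TangentBundle 𝓘(ℝ, E) 𝓜)) (flow_neg_flow hp.1 t).symm
    exact h5 _ (hpl p hp) _
  · have h1 := he _ (hmem p hp)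
    have h2 : (fun i => (m.dflowLift t p).toLinearMap (v i p)) =
        fun i => e i (m.lift (m.flow t p)) := funext fun i => hve p hp i
    constructor
    -- The injective map `dflowLift` takes the new frame to the given one, which gives independence
    -- and the span.
    · refine LinearIndependent.of_comp (M := E) (m.dflowLift t p).toLinearMap ?_
      change LinearIndependent ℝ fun i => (m.dflowLift t p).toLinearMap (v i p)
      rw [h2]
      exact h1.1
    · rw [extend_eq hF hp.1 (hOs hp.2).2.1, ← h1.2, ← h2]
      have h3 : range (fun i => (m.dflowLift t p).toLinearMap (v i p)) =
        (m.dflowLift t p).toLinearMap '' range fun i => v i p := range_comp _ _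
      have h4 := Submodule.comap_map_eq_of_injective
        (f := (m.dflowLift t p).toLinearMap) (dflowLift_injective hp.1 (hOs hp.2).2.1)
        (Submodule.span ℝ (range fun i => v i p))
      rw [Submodule.map_span, ← h3] at h4
      exact h4.symm

end SmoothModel

end ExtendedSubbundle

/-! ### Hyperbolicity estimates on the model. -/

section ModelEstimates

variable {n : ℕ} {Q : Type*} [TopologicalSpace Q] [ChartedSpace (EuclideanSpace ℝ (Fin n)) Q]
  [IsManifold (𝓡 n) ∞ Q] [T2Space Q] {B : BilliardSystem n Q}
  {E : Type*} [NormedAddCommGroup E] [NormedSpace ℝ E]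
  {𝓜 : Type*} [TopologicalSpace 𝓜] [T2Space 𝓜] [ChartedSpace E 𝓜] [IsManifold 𝓘(ℝ, E) ∞ 𝓜]
  (m : SmoothModel B E 𝓜)

namespace SmoothModel

/-- The norm on the model off the gluing region induced by a norm over the phase space. -/
def liftNorm (ν : ∀ q : TangentBundle (𝓡 n) Q, TangentSpace (𝓡 n).tangent q → ℝ) (p : 𝓜)
    (w : TangentSpace 𝓘(ℝ, E) p) : ℝ := ν (m.lift p) (m.dlift p w)

variable {m} {ν : ∀ q : TangentBundle (𝓡 n) Q, TangentSpace (𝓡 n).tangent q → ℝ}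

theorem isContinuousNormOn_liftNorm
    (hν : IsContinuousNormOn (𝓡 n).tangent B.nonGrazing (unitTangent B.metric) ν) :
    IsContinuousNormOn 𝓘(ℝ, E) m.gluingᶜ (fun _ => ⊤) (m.liftNorm ν) where
  pos p hp w _ hw := hν.pos _ (B.phaseInt_subset_nonGrazing (m.lift_mem hp)) _ (m.dlift_mem hp w)
    fun h0 => hw (dlift_injective hp (h0.trans (map_zero (m.dlift p)).symm))
  smul p hp w _ c := by
    refine (congrArg (ν (m.lift p)) (map_smul (m.dlift p) c w)).trans ?_
    exact hν.smul _ (B.phaseInt_subset_nonGrazing (m.lift_mem hp)) _ (m.dlift_mem hp w) c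
  add_le p hp w _ w' _ := by
    refine (congrArg (ν (m.lift p)) (map_add (m.dlift p) w w')).trans_le ?_
    exact hν.add_le _ (B.phaseInt_subset_nonGrazing (m.lift_mem hp)) _ (m.dlift_mem hp w) _
      (m.dlift_mem hp w')
  continuousOn := by
    refine ContinuousOn.mono ?_ (fun W hW => hW.1 :
      _ ⊆ {W : TangentBundle 𝓘(ℝ, E) 𝓜 | W.1 ∉ m.gluing})
    exact hν.continuousOn.comp m.continuousOn_dlift fun W hW =>
      ⟨B.phaseInt_subset_nonGrazing (m.lift_mem hW), m.dlift_mem hW _⟩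

theorem liftNorm_tangentFlow {W : TangentBundle 𝓘(ℝ, E) 𝓜} (hW : W.1 ∈ m.trapped) {s t : ℝ}
    (hs : m.flow s W.1 ∉ m.gluing) (ht : m.flow t W.1 ∉ m.gluing) :
    m.liftNorm ν _ (m.tangentFlow t W).2 = ν (B.flow (t - s) (m.lift (m.flow s W.1)))
      (B.dflow (t - s) (m.lift (m.flow s W.1)) (m.dflowLift s W.1 W.2)) :=
  (congrArg (fun Z : TangentBundle (𝓡 n).tangent (TangentBundle (𝓡 n) Q) => ν Z.1 Z.2)
    (dflow_dflowLift hW hs ht W.2)).symm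

theorem flow_sub_lift_flow_mem {p : 𝓜} (hp : p ∈ m.trapped) {s t : ℝ}
    (hs : m.flow s p ∉ m.gluing) (ht : m.flow t p ∉ m.gluing) :
    B.flow (t - s) (m.lift (m.flow s p)) ∈ B.trapped ∩ B.phaseInt := by
  have h : B.flow (t - s) (m.lift (m.flow s p)) = m.lift (m.flow t p) :=
    congrArg (fun Z : TangentBundle (𝓡 n).tangent (TangentBundle (𝓡 n) Q) => Z.1)
      (dflow_dflowLift hp hs ht 0)
  rw [h]
  exact lift_flow_mem hp ht

/-- Between two times off the gluing region the transported norm changes exactly as the billiard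
norm does, so the billiard estimates are the hypotheses of `exists_adapted_norm`. -/
theorem exists_estimates_extend [FiniteDimensional ℝ E] [SecondCountableTopology 𝓜]
    {Es Eu : ∀ q : TangentBundle (𝓡 n) Q, Submodule ℝ (TangentSpace (𝓡 n).tangent q)}
    (h : B.IsHyperbolicSplitting Es Eu) :
    ∃ μ : ∀ p : 𝓜, TangentSpace 𝓘(ℝ, E) p → ℝ,
      IsContinuousNormOn 𝓘(ℝ, E) univ (fun _ => ⊤) μ ∧
        m.Estimates (m.extend Es) (m.extend Eu) μ := by
  obtain ⟨ν, hν, C₀, C₁, hC₀, hC₁, hest⟩ := h.estimates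
  obtain ⟨μ, hμ, hμC⟩ := m.exists_adapted_norm (isContinuousNormOn_liftNorm (m := m) hν)
  obtain ⟨C, hC, hμ'⟩ := hμC C₀ C₁ hC₀ hC₁
  refine ⟨μ, hμ, C, C₁, hC, hC₁, fun p hp s hs => ⟨fun w hw => ?_, fun w hw => ?_⟩⟩
  · refine (hμ' ⟨p, w⟩ hp).1 (fun t t' htt' ht ht' => ?_) s hs
    rw [liftNorm_tangentFlow (W := ⟨p, w⟩) hp ht ht']
    refine (hest _ (lift_flow_mem hp ht) (t' - t) (sub_nonneg.2 htt')
      (flow_sub_lift_flow_mem hp ht ht')).1 _ ?_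
    rw [extend_eq (fun q hq t hqt => (h.invariant q hq t hqt).1) hp ht] at hw
    exact hw
  · refine (hμ' ⟨p, w⟩ hp).2 (fun t t' htt' ht ht' => ?_) s hs
    rw [liftNorm_tangentFlow (W := ⟨p, w⟩) hp ht ht']
    refine (hest _ (lift_flow_mem hp ht) (t' - t) (sub_nonneg.2 htt')
      (flow_sub_lift_flow_mem hp ht ht')).2 _ ?_
    rw [extend_eq (fun q hq t hqt => (h.invariant q hq t hqt).2) hp ht] at hw
    exact hw

/-- Over a compact trapped set, estimates in one continuous norm yield estimates in any other. -/
theorem Estimates.of_isCompact [FiniteDimensional ℝ E]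
    {Fs Fu : ∀ p : 𝓜, Submodule ℝ (TangentSpace 𝓘(ℝ, E) p)}
    {μ μ' : ∀ p : 𝓜, TangentSpace 𝓘(ℝ, E) p → ℝ} (h : m.Estimates Fs Fu μ)
    (hK : IsCompact m.trapped) (hμ : IsContinuousNormOn 𝓘(ℝ, E) univ (fun _ => ⊤) μ)
    (hμ' : IsContinuousNormOn 𝓘(ℝ, E) univ (fun _ => ⊤) μ') : m.Estimates Fs Fu μ' := by
  obtain ⟨a, ha, hale⟩ := hμ.exists_le_of_isCompact hμ' hK (subset_univ _)
  obtain ⟨b, hb, hble⟩ := hμ'.exists_le_of_isCompact hμ hK (subset_univ _)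
  obtain ⟨C₀, C₁, hC₀, hC₁, hest⟩ := h
  -- One comparison is spent at the start and one at the end of the trajectory; both points lie in
  -- the compact trapped set.
  refine ⟨a * b * C₀, C₁, by positivity, hC₁, fun p hp t ht => ⟨fun w hw => ?_, fun w hw => ?_⟩⟩
  · have h1 := (hest p hp t ht).1 w hw
    have h2 := hble _ (flow_mem_trapped hp t) (m.dflow t p w)
    have h3 := hale p hp w
    have hx := Real.exp_pos (-C₁ * t)
    calc μ' _ (m.dflow t p w) ≤ b * μ _ (m.dflow t p w) := h2
      _ ≤ b * (C₀ * Real.exp (-C₁ * t) * (a * μ' p w)) :=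
        mul_le_mul_of_nonneg_left (h1.trans (mul_le_mul_of_nonneg_left h3 (by positivity))) hb.le
      _ = _ := by ring
  · have h1 := (hest p hp t ht).2 w hw
    have h2 := hale _ (flow_mem_trapped hp t) (m.dflow t p w)
    have h3 := hble p hp w
    have hx := Real.exp_pos (C₁ * t)
    have h4 : (a * b * C₀)⁻¹ * Real.exp (C₁ * t) * μ' p w ≤
        (a * b * C₀)⁻¹ * Real.exp (C₁ * t) * (b * μ p w) :=
      mul_le_mul_of_nonneg_left h3 (by positivity)
    refine h4.trans ?_
    have h5 : (a * b * C₀)⁻¹ * Real.exp (C₁ * t) * (b * μ p w) =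
        a⁻¹ * (C₀⁻¹ * Real.exp (C₁ * t) * μ p w) := by field_simp
    rw [h5, inv_mul_le_iff₀ ha]
    exact h1.trans h2

end SmoothModel

end ModelEstimates

end

/-! ### The proposition. -/

theorem mainTheorem9 {n : ℕ} (hn : 1 ≤ n)
    {Q : Type*} [TopologicalSpace Q] [T2Space Q] [SecondCountableTopology Q] [ConnectedSpace Q]
    [ChartedSpace (EuclideanSpace ℝ (Fin n)) Q] [IsManifold (𝓡 n) ∞ Q]
    (B : BilliardSystem n Q)
    {E : Type*} [NormedAddCommGroup E] [NormedSpace ℝ E] [FiniteDimensional ℝ E]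
    {𝓜 : Type*} [TopologicalSpace 𝓜] [T2Space 𝓜] [SecondCountableTopology 𝓜]
    [ChartedSpace E 𝓜] [IsManifold 𝓘(ℝ, E) ∞ 𝓜]
    (m : SmoothModel B E 𝓜) :
    (B.IsHyperbolic → m.IsHyperbolic) ∧
    ∀ Es Eu : ∀ q : TangentBundle (𝓡 n) Q, Submodule ℝ (TangentSpace (𝓡 n).tangent q),
      B.IsHyperbolicSplitting Es Eu →
      ∃ Fs Fu : ∀ p : 𝓜, Submodule ℝ (TangentSpace 𝓘(ℝ, E) p),
        m.IsHyperbolicSplitting Fs Fu ∧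
        -- the splitting is transported by `dπ` over the interior
        (∀ q ∈ B.trapped ∩ B.phaseInt,
          Fs (m.proj q) = (Es q).map (m.dproj q).toLinearMap ∧
          Fu (m.proj q) = (Eu q).map (m.dproj q).toLinearMap ∧
          m.generator (m.proj q) = m.dproj q (B.flowDir q)) ∧
        -- and extended by the flow over the gluing region
        (∀ p ∈ m.trapped ∩ m.gluing,
          (∀ᶠ t in 𝓝[≠] (0 : ℝ), m.flow t p ∉ m.gluing) ∧
          ∀ t : ℝ, m.flow t p ∉ m.gluing →
            Fs p = (Fs (m.flow t p)).comap (m.dflow t p).toLinearMap ∧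
            Fu p = (Fu (m.flow t p)).comap (m.dflow t p).toLinearMap) ∧
        -- if the trapped set is compact, the choice of the norm is immaterial
        (IsCompact B.trapped → ∀ ν : ∀ p : 𝓜, TangentSpace 𝓘(ℝ, E) p → ℝ,
          IsContinuousNormOn 𝓘(ℝ, E) Set.univ (fun _ => ⊤) ν → m.Estimates Fs Fu ν) := by
  suffices h : ∀ Es Eu, B.IsHyperbolicSplitting Es Eu →
      m.IsHyperbolicSplitting (m.extend Es) (m.extend Eu) by
    refine ⟨fun ⟨Es, Eu, hE⟩ => ⟨_, _, h Es Eu hE⟩, fun Es Eu hE => ⟨_, _, h Es Eu hE, ?_, ?_, ?_⟩⟩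
    · intro q hq
      have hle := (hE.splitting q hq).le_right
      exact ⟨SmoothModel.extend_proj (fun q hq t ht => (hE.invariant q hq t ht).1) hq hle.1,
        SmoothModel.extend_proj (fun q hq t ht => (hE.invariant q hq t ht).2) hq hle.2,
        SmoothModel.generator_proj hq.2⟩
    -- The pullback formula holds at every time, by invariance of the extended splitting.
    · exact fun p hp => ⟨m.eventually_not_mem_gluing p, fun t _ =>
        ⟨SmoothModel.extend_eq_comap (fun q hq t ht => (hE.invariant q hq t ht).1) hp.1 t,
          SmoothModel.extend_eq_comap (fun q hq t ht => (hE.invariant q hq t ht).2) hp.1 t⟩⟩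
    · intro hK ν hν
      obtain ⟨μ, hμ, hest⟩ := SmoothModel.exists_estimates_extend (m := m) hE
      exact hest.of_isCompact (m.isCompact_trapped hK) hμ hν
  intro Es Eu hE
  have hs : ∀ q ∈ B.trapped ∩ B.phaseInt, ∀ t : ℝ, B.flow t q ∈ B.trapped ∩ B.phaseInt →
      (Es q).map (B.dflow t q).toLinearMap = Es (B.flow t q) :=
    fun q hq t ht => (hE.invariant q hq t ht).1
  have hu : ∀ q ∈ B.trapped ∩ B.phaseInt, ∀ t : ℝ, B.flow t q ∈ B.trapped ∩ B.phaseInt →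
      (Eu q).map (B.dflow t q).toLinearMap = Eu (B.flow t q) :=
    fun q hq t ht => (hE.invariant q hq t ht).2
  exact {
    splitting := fun p hp => SmoothModel.isSplitting_extend hp hs hu hE.splitting
    continuous_stable := SmoothModel.isContinuousSubbundleOn_extend hs
      (fun q hq => (hE.splitting q hq).le_right.1) hE.continuous_stable
    continuous_unstable := SmoothModel.isContinuousSubbundleOn_extend hu
      (fun q hq => (hE.splitting q hq).le_right.2) hE.continuous_unstable
    invariant := fun p hp t => ⟨SmoothModel.map_extend hs hp t, SmoothModel.map_extend hu hp t⟩
    estimates := SmoothModel.exists_estimates_extend hE }
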